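/- Conventions. A tensor category is an abelian symmetric monoidal category with additive tensor product in each variable and unit $I$; we write $XY=X\otimes Y$. A supercategory $\mathcal S$ is a well-powered, complete, $\mathbb Q$-linear tensor category with a chosen object $P$ and an isomorphism $\Lambda^2P\cong I$, such that $S^2P\cong 0$. An odd morphism $X\to Y$ is a morphism $PX\to Y$. We assume that $\mathcal S$ has countable coproducts and that $X\otimes(-)$ preserves them for every $X$. For a Lie algebra object $K$ of a (preadditive) symmetric monoidal category, $\mathrm{Mod}(K)$ denotes its $K$-modules with the usual tensor product. Let $\mathcal Q=\mathrm{Mod}(Q)$, where $Q=P$ with zero bracket; its objects are the supercomplexes $(X,d)$, with $d:PX\to X$ odd and $d^2=0$. Let $D=S(P)=I\oplus P$, a commutative algebra in $\mathcal Q$ whose differential is $0$ on $I$ and is the identification $PP\cong\Lambda^2P\cong I$ on $P$. Let $L_0$ be a Lie algebra object of $\mathcal S$ whose underlying object is rigid, with dual $L_0^*$ carrying the coadjoint action. Put $L=DL_0$, a Lie algebra in $\mathcal Q$, and $\mathcal L=\mathrm{Mod}(L)$. A homotopy between $\mathcal L$-morphisms $f,g:X\to Y$ is an odd morphism $h$ of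 $\mathcal S$ from $X$ to $Y$ that commutes with the $L$-action (the odd symbol being moved past $L$ by the symmetry) and satisfies $dh+hd=f-g$, where $PP$ is identified with $I$. A morphism of associative unital algebras in $\mathcal L$ is a quasi-isomorphism if it has a homotopy inverse that is an $\mathcal L$-morphism (not necessarily an algebra morphism). A unital object of $\mathcal L$ is an object $X$ with a morphism $u:I\to X$ in $\mathcal L$. A connection on it is an $L_0$-equivariant odd morphism $\theta$ from $L_0^*$ to $X$ such that the composite $PL_0\otimes PL_0^*\xrightarrow{1\otimes\theta}PL_0\otimes X\to X$ (the last map being the action of $PL_0\subset L$) equals the evaluation $PL_0\otimes PL_0^*\to I$ followed by $u$. Let $\Theta(X)$ be the set of connections on $X$; it is a functor of the unital object $X$. Theorem. (i) The functor $\Theta$ is represented by a unital object $M_L$ of $\mathcal L$, and there exist a free associative unital algebra $A_L=T_1(M_L)$ and a free commutative unital algebra $C_L=S_1(M_L)$ in $\mathcal L$ on the unital object $M_L$; that is, unital morphisms from $M_L$ to an associative (resp. commutative) algebra $B$ of $\mathcal L$ extend uniquely to algebra morphisms from $A_L$ (resp. $C_L$) to $B$. (ii) For any such objects, the natural algebra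 morphism $A_L\to C_L$, the unique one extending the canonical morphism $M_L\to C_L$, is a quasi-isomorphism. -/

import Mathlib

open CategoryTheory MonoidalCategory Limits
open scoped MonObj

universe v u

set_option linter.unusedSectionVars false
set_option linter.flexible false

noncomputable section

namespace SuperWeil

section Swap
variable {C : Type u} [Category.{v} C] [MonoidalCategory C] [SymmetricCategory C]

/-- The symmetry `X ⊗ (Y ⊗ Z) ⟶ Y ⊗ (X ⊗ Z)` exchanging the first two factors. -/
def swapLeft (X Y Z : C) : X ⊗ (Y ⊗ Z) ⟶ Y ⊗ (X ⊗ Z) :=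
  (α_ X Y Z).inv ≫ (β_ X Y).hom ▷ Z ≫ (α_ Y X Z).hom

theorem swapLeft_swapLeft (X Y Z : C) : swapLeft X Y Z ≫ swapLeft Y X Z = 𝟙 _ := by
  simp only [swapLeft, Category.assoc, Iso.hom_inv_id_assoc, ← comp_whiskerRight_assoc,
    SymmetricCategory.symmetry]
  simp

theorem swapLeft_nat₁ {X X' : C} (f : X ⟶ X') (Y Z : C) :
    f ▷ (Y ⊗ Z) ≫ swapLeft X' Y Z = swapLeft X Y Z ≫ Y ◁ f ▷ Z := by
  simp only [swapLeft, associator_inv_naturality_left_assoc, Category.assoc]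
  rw [← comp_whiskerRight_assoc, BraidedCategory.braiding_naturality_left]
  simp

theorem swapLeft_nat₂ (X : C) {Y Y' : C} (f : Y ⟶ Y') (Z : C) :
    X ◁ f ▷ Z ≫ swapLeft X Y' Z = swapLeft X Y Z ≫ f ▷ (X ⊗ Z) := by
  simp only [swapLeft, associator_inv_naturality_middle_assoc, Category.assoc]
  rw [← comp_whiskerRight_assoc, BraidedCategory.braiding_naturality_right]
  simp

theorem swapLeft_nat₃ (X Y : C) {Z Z' : C} (f : Z ⟶ Z') :
    X ◁ Y ◁ f ≫ swapLeft X Y Z' = swapLeft X Y Z ≫ Y ◁ X ◁ f := by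
  have h := congrArg (fun t => (α_ X Y Z).inv ≫ t ≫ (α_ Y X Z').hom)
    (whisker_exchange (β_ X Y).hom f)
  simpa [swapLeft] using h

theorem swapLeft_hex₁ (X Y Z W : C) :
    (α_ X Y (Z ⊗ W)).inv ≫ swapLeft (X ⊗ Y) Z W =
      X ◁ swapLeft Y Z W ≫ swapLeft X Z (Y ⊗ W) ≫ Z ◁ (α_ X Y W).inv := by
  simp [swapLeft, BraidedCategory.braiding_tensor_left_hom]

theorem swapLeft_hex₂ (X Y Z W : C) :
    X ◁ (α_ Y Z W).inv ≫ swapLeft X (Y ⊗ Z) W =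
      swapLeft X Y (Z ⊗ W) ≫ Y ◁ swapLeft X Z W ≫ (α_ Y Z (X ⊗ W)).inv := by
  simp [swapLeft, BraidedCategory.braiding_tensor_right_hom]

theorem swapLeft_yb (X Y Z W : C) :
    swapLeft X Y (Z ⊗ W) ≫ Y ◁ swapLeft X Z W ≫ swapLeft Y Z (X ⊗ W) =
      X ◁ swapLeft Y Z W ≫ swapLeft X Z (Y ⊗ W) ≫ Z ◁ swapLeft X Y W := by
  have h := congrArg (fun t : X ⊗ Y ⊗ Z ⟶ Z ⊗ Y ⊗ X => X ◁ (α_ Y Z W).inv ≫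
    (α_ X (Y ⊗ Z) W).inv ≫ t ▷ W ≫ (α_ Z (Y ⊗ X) W).hom ≫ Z ◁ (α_ Y X W).hom)
    (BraidedCategory.yang_baxter X Y Z)
  simp [swapLeft] at h ⊢
  exact h
theorem tensorμ_tensorμ (A L : C) : tensorμ A L A L ≫ tensorμ A A L L = 𝟙 _ := by
  have h := tensorμ_tensorδ A L A L
  simpa only [tensorδ, tensorμ, ← SymmetricCategory.braiding_swap_eq_inv_braiding] using h

theorem braiding_tensorμ (A L : C) : (β_ (A ⊗ L) (A ⊗ L)).hom ≫ tensorμ A L A L =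
    tensorμ A L A L ≫ ((β_ A A).hom ⊗ₘ (β_ L L).hom) := by
  have h2 : tensorμ A A L L ≫ tensorμ A L A L = 𝟙 _ := by
    have h := tensorμ_tensorδ A A L L
    simpa only [tensorδ, tensorμ, ← SymmetricCategory.braiding_swap_eq_inv_braiding] using h
  have h := congrArg (fun t => tensorμ A L A L ≫ t ≫ tensorμ A L A L)
    (SymmetricCategory.tensorμ_braid_swap A L)
  have h1 := tensorμ_tensorμ A L
  simpa only [Category.assoc, reassoc_of% h1, h2, Category.comp_id] using h

/-- The shuffle regrouping the three factors `A` and the three factors `L`. -/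
def regroup (A L : C) : (A ⊗ L) ⊗ (A ⊗ L) ⊗ (A ⊗ L) ⟶ (A ⊗ A ⊗ A) ⊗ (L ⊗ L ⊗ L) :=
  (A ⊗ L) ◁ tensorμ A L A L ≫ tensorμ A L (A ⊗ A) (L ⊗ L)

theorem regroup_right {A L : C} (m : A ⊗ A ⟶ A) (b : L ⊗ L ⟶ L) :
    (A ⊗ L) ◁ (tensorμ A L A L ≫ (m ⊗ₘ b)) ≫ tensorμ A L A L ≫ (m ⊗ₘ b) =
      regroup A L ≫ ((A ◁ m ≫ m) ⊗ₘ (L ◁ b ≫ b)) := by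
  have h := tensorμ_natural_right A L m b
  simp only [regroup, whiskerLeft_comp, Category.assoc, reassoc_of% h, tensorHom_comp_tensorHom]

theorem associator_inv_regroup (A L : C) :
   (α_ (A ⊗ L) (A ⊗ L) (A ⊗ L)).inv ≫ tensorμ A L A L ▷ (A ⊗ L) ≫ tensorμ (A ⊗ A) (L ⊗ L) A L =
    regroup A L ≫ ((α_ A A A).inv ⊗ₘ (α_ L L L).inv) := by
  have h := tensor_associativity A L A L A L
  rw [Iso.inv_comp_eq, regroup, Category.assoc, ← reassoc_of% h, tensorHom_comp_tensorHom]
  simp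

theorem regroup_left {A L : C} (m : A ⊗ A ⟶ A) (b : L ⊗ L ⟶ L) :
    (α_ (A ⊗ L) (A ⊗ L) (A ⊗ L)).inv ≫
      (tensorμ A L A L ≫ (m ⊗ₘ b)) ▷ (A ⊗ L) ≫ tensorμ A L A L ≫ (m ⊗ₘ b) =
      regroup A L ≫ (((α_ A A A).inv ≫ m ▷ A ≫ m) ⊗ₘ ((α_ L L L).inv ≫ b ▷ L ≫ b)) := by
  have h := tensorμ_natural_left m b A L
  have h1 := associator_inv_regroup A L
  simp only [comp_whiskerRight, Category.assoc, reassoc_of% h, reassoc_of% h1, tensorHom_comp_tensorHom]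

theorem swapLeft_regroup (A L : C) : swapLeft (A ⊗ L) (A ⊗ L) (A ⊗ L) ≫ regroup A L =
    regroup A L ≫ (swapLeft A A A ⊗ₘ swapLeft L L L) := by
  have h := tensor_associativity A L A L A L
  have h1 := associator_inv_regroup A L
  have h2 := congrArg (fun t => t ▷ (A ⊗ L)) (braiding_tensorμ A L)
  simp only [comp_whiskerRight] at h2
  have h3 := tensorμ_natural_left (β_ A A).hom (β_ L L).hom A L
  unfold regroup at h1 ⊢
  simp only [Category.assoc] at h1
  simp only [swapLeft, Category.assoc]
  rw [← h, reassoc_of% h2, reassoc_of% h3, reassoc_of% h1]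
  simp only [tensorHom_comp_tensorHom]

end Swap

section LieTheory

variable {C : Type u} [Category.{v} C] [Preadditive C] [MonoidalCategory C]
  [MonoidalPreadditive C] [SymmetricCategory C]

/-- `x (m ⊗ n) = x m ⊗ n + m ⊗ x n`. -/
def leibnizAct {L M N : C} (a : L ⊗ M ⟶ M) (c : L ⊗ N ⟶ N) : L ⊗ (M ⊗ N) ⟶ M ⊗ N :=
  (α_ L M N).inv ≫ a ▷ N + swapLeft L M N ≫ M ◁ c

theorem leibnizAct_bracket {L M N : C} (b : L ⊗ L ⟶ L) (a : L ⊗ M ⟶ M) (c : L ⊗ N ⟶ N)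
    (ha : (α_ L L M).inv ≫ b ▷ M ≫ a = L ◁ a ≫ a - swapLeft L L M ≫ L ◁ a ≫ a)
    (hc : (α_ L L N).inv ≫ b ▷ N ≫ c = L ◁ c ≫ c - swapLeft L L N ≫ L ◁ c ≫ c) :
    (α_ L L (M ⊗ N)).inv ≫ b ▷ (M ⊗ N) ≫ leibnizAct a c =
      L ◁ leibnizAct a c ≫ leibnizAct a c -
        swapLeft L L (M ⊗ N) ≫ L ◁ leibnizAct a c ≫ leibnizAct a c := by
  simp only [leibnizAct]
  set A := (α_ L M N).inv ≫ a ▷ N with hA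
  set B := swapLeft L M N ≫ M ◁ c with hB
  let T := (α_ L L (M ⊗ N)).inv ≫ (α_ (L ⊗ L) M N).inv ≫ (α_ L L M).hom ▷ N
  let X := L ◁ swapLeft L M N ≫ swapLeft L M (L ⊗ N)
  have hAA : L ◁ A ≫ A = T ≫ (L ◁ a ≫ a) ▷ N := by
    simp [hA, T]
  have hsT : swapLeft L L (M ⊗ N) ≫ T = T ≫ swapLeft L L M ▷ N := by
    simp [T, swapLeft]
  have hbA : (α_ L L (M ⊗ N)).inv ≫ b ▷ (M ⊗ N) ≫ A = T ≫ ((α_ L L M).inv ≫ b ▷ M ≫ a) ▷ N := by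
    simp [hA, T]
  have hBB : L ◁ B ≫ B = X ≫ M ◁ (L ◁ c ≫ c) := by
    have := swapLeft_nat₃ L M c
    simp only [hB, X, whiskerLeft_comp, Category.assoc, reassoc_of% this]
  have hsX : swapLeft L L (M ⊗ N) ≫ X = X ≫ M ◁ swapLeft L L N := by
    simpa [X] using swapLeft_yb L L M N
  have hbB : (α_ L L (M ⊗ N)).inv ≫ b ▷ (M ⊗ N) ≫ B = X ≫ M ◁ ((α_ L L N).inv ≫ b ▷ N ≫ c) := by
    have h1 := swapLeft_nat₁ b M N
    have h2 := swapLeft_hex₁ L L M N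
    simp only [hB, X, whiskerLeft_comp, Category.assoc, reassoc_of% h1, reassoc_of% h2]
  have hAB : L ◁ A ≫ B = swapLeft L L (M ⊗ N) ≫ L ◁ B ≫ A := by
    have h1 := swapLeft_nat₂ L a N
    have h2 := swapLeft_hex₂ L L M N
    simp only [hA, hB, whiskerLeft_comp, Category.assoc, reassoc_of% h1, reassoc_of% h2]
    rw [← whisker_exchange]
    simp
  have hBA : L ◁ B ≫ A = swapLeft L L (M ⊗ N) ≫ L ◁ A ≫ B := by
    have h := swapLeft_swapLeft L L (M ⊗ N)
    rw [hAB, reassoc_of% h]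
  simp only [MonoidalPreadditive.whiskerLeft_add, Preadditive.add_comp, Preadditive.comp_add,
    hAA, hBB, hbA, hbB, ← hAB, ← hBA, ha, hc]
  have hw (f g : L ⊗ (L ⊗ M) ⟶ M) : (f - g) ▷ N = f ▷ N - g ▷ N := (tensorRight N).map_sub
  have hw' (f g : L ⊗ (L ⊗ N) ⟶ N) : M ◁ (f - g) = M ◁ f - M ◁ g := (tensorLeft M).map_sub
  rw [hw, hw']
  simp only [Preadditive.comp_sub, reassoc_of% hsT, reassoc_of% hsX, comp_whiskerRight, whiskerLeft_comp]
  abel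


theorem tensorHom_neg {X X' Y Y' : C} (f : X ⟶ X') (g : Y ⟶ Y') : f ⊗ₘ (-g) = -(f ⊗ₘ g) := by
  have h : X' ◁ (-g) = -(X' ◁ g) := (tensorLeft X').map_neg
  rw [MonoidalCategory.tensorHom_def, h, Preadditive.comp_neg, MonoidalCategory.tensorHom_def]

theorem leibnizAct_whiskerLeft {L M N N' : C} (a : L ⊗ M ⟶ M) (c : L ⊗ N ⟶ N) (c' : L ⊗ N' ⟶ N')
    (f : N ⟶ N') (hf : L ◁ f ≫ c' = c ≫ f) :
    L ◁ M ◁ f ≫ leibnizAct a c' = leibnizAct a c ≫ M ◁ f := by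
  have h1 := swapLeft_nat₃ L M f
  simp only [leibnizAct, Preadditive.comp_add, Preadditive.add_comp, Category.assoc,
    reassoc_of% h1, ← whiskerLeft_comp, hf]
  congr 1
  rw [← whisker_exchange]
  simp

theorem leibnizAct_whiskerRight {L M M' N : C} (a : L ⊗ M ⟶ M) (a' : L ⊗ M' ⟶ M') (c : L ⊗ N ⟶ N)
    (f : M ⟶ M') (hf : L ◁ f ≫ a' = a ≫ f) :
    L ◁ f ▷ N ≫ leibnizAct a' c = leibnizAct a c ≫ f ▷ N := by
  have h1 := swapLeft_nat₂ L f N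
  simp only [leibnizAct, Preadditive.comp_add, Preadditive.add_comp, Category.assoc,
    reassoc_of% h1, ← whisker_exchange, associator_inv_naturality_middle_assoc]
  simp only [← comp_whiskerRight, hf]

theorem leibnizAct_leftUnitor {L M : C} (a : L ⊗ M ⟶ M) :
    L ◁ (λ_ M).hom ≫ a = leibnizAct (0 : L ⊗ 𝟙_ C ⟶ 𝟙_ C) a ≫ (λ_ M).hom := by
  simp [leibnizAct, swapLeft]

theorem leibnizAct_rightUnitor {L M : C} (a : L ⊗ M ⟶ M) :
    L ◁ (ρ_ M).hom ≫ a = leibnizAct a (0 : L ⊗ 𝟙_ C ⟶ 𝟙_ C) ≫ (ρ_ M).hom := by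
  simp [leibnizAct]

theorem leibnizAct_braiding {L M N : C} (a : L ⊗ M ⟶ M) (c : L ⊗ N ⟶ N) :
    L ◁ (β_ M N).hom ≫ leibnizAct c a = leibnizAct a c ≫ (β_ M N).hom := by
  have h1 : L ◁ (β_ M N).hom ≫ (α_ L N M).inv ≫ c ▷ M =
      swapLeft L M N ≫ M ◁ c ≫ (β_ M N).hom := by
    rw [BraidedCategory.braiding_naturality_right]
    simp [swapLeft]
    rw [← comp_whiskerRight_assoc]
    simp
  have h2 : L ◁ (β_ M N).hom ≫ swapLeft L N M ≫ N ◁ a =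
      (α_ L M N).inv ≫ a ▷ N ≫ (β_ M N).hom := by
    rw [BraidedCategory.braiding_naturality_left]
    simp [swapLeft]
  simp only [leibnizAct, Preadditive.comp_add, Preadditive.add_comp, Category.assoc, h1, h2]
  abel

theorem leibnizAct_associator {L M N K : C} (a : L ⊗ M ⟶ M) (c : L ⊗ N ⟶ N) (d : L ⊗ K ⟶ K) :
    L ◁ (α_ M N K).hom ≫ leibnizAct a (leibnizAct c d) =
      leibnizAct (leibnizAct a c) d ≫ (α_ M N K).hom := by
  simp only [leibnizAct, Preadditive.comp_add, Preadditive.add_comp, Category.assoc,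
    MonoidalPreadditive.whiskerLeft_add, MonoidalPreadditive.add_whiskerRight, add_assoc]
  congr 1
  · simp
  congr 1
  · simp [swapLeft]
  · simp [swapLeft]

section SquareZero
variable {D P : C} {i : 𝟙_ C ⟶ D} {p : D ⟶ 𝟙_ C} {q : D ⟶ P} {m : D ⊗ D ⟶ D}

theorem sqZero_one_mul (ext : ∀ {X : C} {f g : X ⟶ D}, f ≫ p = g ≫ p → f ≫ q = g ≫ q → f = g)
    (hp : m ≫ p = (p ⊗ₘ p) ≫ (λ_ _).hom)
    (hq : m ≫ q = (p ⊗ₘ q) ≫ (λ_ _).hom + (q ⊗ₘ p) ≫ (ρ_ _).hom)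
    (ip : i ≫ p = 𝟙 _) (iq : i ≫ q = 0) : i ▷ D ≫ m = (λ_ D).hom := by
  apply ext
  · rw [Category.assoc, hp, MonoidalCategory.tensorHom_def, Category.assoc, ← comp_whiskerRight_assoc, ip]
    simp
  · rw [Category.assoc, hq, MonoidalCategory.tensorHom_def, MonoidalCategory.tensorHom_def,
      Preadditive.comp_add, Category.assoc, Category.assoc, ← comp_whiskerRight_assoc,
      ← comp_whiskerRight_assoc, ip, iq]
    simp

theorem sqZero_mul_one (ext : ∀ {X : C} {f g : X ⟶ D}, f ≫ p = g ≫ p → f ≫ q = g ≫ q → f = g)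
    (hp : m ≫ p = (p ⊗ₘ p) ≫ (λ_ _).hom)
    (hq : m ≫ q = (p ⊗ₘ q) ≫ (λ_ _).hom + (q ⊗ₘ p) ≫ (ρ_ _).hom)
    (ip : i ≫ p = 𝟙 _) (iq : i ≫ q = 0) : D ◁ i ≫ m = (ρ_ D).hom := by
  apply ext
  · rw [Category.assoc, hp, MonoidalCategory.tensorHom_def', Category.assoc, ← whiskerLeft_comp_assoc, ip]
    simp [unitors_equal]
  · rw [Category.assoc, hq, MonoidalCategory.tensorHom_def', MonoidalCategory.tensorHom_def',
      Preadditive.comp_add, Category.assoc, Category.assoc, ← whiskerLeft_comp_assoc,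
      ← whiskerLeft_comp_assoc, ip, iq]
    simp

theorem sqZero_assoc (ext : ∀ {X : C} {f g : X ⟶ D}, f ≫ p = g ≫ p → f ≫ q = g ≫ q → f = g)
    (hp : m ≫ p = (p ⊗ₘ p) ≫ (λ_ _).hom)
    (hq : m ≫ q = (p ⊗ₘ q) ≫ (λ_ _).hom + (q ⊗ₘ p) ≫ (ρ_ _).hom) :
    m ▷ D ≫ m = (α_ D D D).hom ≫ D ◁ m ≫ m := by
  have e1 {Y : C} (f : D ⟶ Y) : m ▷ D ≫ (p ⊗ₘ f) = ((p ⊗ₘ p) ⊗ₘ f) ≫ (λ_ _).hom ▷ Y := by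
    simp [MonoidalCategory.tensorHom_def, ← comp_whiskerRight_assoc, hp]
  have e2 {Y : C} (f : D ⟶ Y) : m ▷ D ≫ (q ⊗ₘ f) =
      ((p ⊗ₘ q) ⊗ₘ f) ≫ (λ_ _).hom ▷ Y + ((q ⊗ₘ p) ⊗ₘ f) ≫ (ρ_ _).hom ▷ Y := by
    simp [MonoidalCategory.tensorHom_def, ← comp_whiskerRight_assoc, hq,
      MonoidalPreadditive.add_whiskerRight, Preadditive.add_comp]
  have e3 {Y : C} (f : D ⟶ Y) : D ◁ m ≫ (f ⊗ₘ p) = (f ⊗ₘ (p ⊗ₘ p)) ≫ Y ◁ (λ_ _).hom := by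
    simp only [← id_tensorHom, tensorHom_comp_tensorHom, Category.id_comp, Category.comp_id, hp]
  have e4 {Y : C} (f : D ⟶ Y) : D ◁ m ≫ (f ⊗ₘ q) =
      (f ⊗ₘ (p ⊗ₘ q)) ≫ Y ◁ (λ_ _).hom + (f ⊗ₘ (q ⊗ₘ p)) ≫ Y ◁ (ρ_ _).hom := by
    simp only [← id_tensorHom, tensorHom_comp_tensorHom, Category.id_comp, Category.comp_id, hq,
      MonoidalPreadditive.tensor_add]
  apply ext
  · simp only [Category.assoc, hp, reassoc_of% e1, reassoc_of% e3, ← associator_naturality_assoc]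
    simp [unitors_equal]
  · simp only [Category.assoc, hq, Preadditive.comp_add, reassoc_of% e1, reassoc_of% e2, reassoc_of% e3, reassoc_of% e4, ← associator_naturality_assoc, Preadditive.add_comp]
    simp [unitors_equal, add_assoc]

theorem sqZero_comm (ext : ∀ {X : C} {f g : X ⟶ D}, f ≫ p = g ≫ p → f ≫ q = g ≫ q → f = g)
    (hp : m ≫ p = (p ⊗ₘ p) ≫ (λ_ _).hom)
    (hq : m ≫ q = (p ⊗ₘ q) ≫ (λ_ _).hom + (q ⊗ₘ p) ≫ (ρ_ _).hom) :
    (β_ D D).hom ≫ m = m := by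
  apply ext
  · rw [Category.assoc, hp, ← BraidedCategory.braiding_naturality_assoc,
      braiding_leftUnitor, unitors_equal]
  · rw [Category.assoc, hq, Preadditive.comp_add, ← BraidedCategory.braiding_naturality_assoc,
      ← BraidedCategory.braiding_naturality_assoc]
    simp [add_comm]

theorem sqZero_derivation (ext : ∀ {X : C} {f g : X ⟶ D}, f ≫ p = g ≫ p → f ≫ q = g ≫ q → f = g)
    (hp : m ≫ p = (p ⊗ₘ p) ≫ (λ_ _).hom)
    (hq : m ≫ q = (p ⊗ₘ q) ≫ (λ_ _).hom + (q ⊗ₘ p) ≫ (ρ_ _).hom)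
    (ip : i ≫ p = 𝟙 _) (iq : i ≫ q = 0) (e : P ⊗ P ⟶ 𝟙_ C)
    (he : (α_ P P P).inv ≫ e ▷ P ≫ (λ_ P).hom = P ◁ e ≫ (ρ_ P).hom)
    (hb : swapLeft P P P = -𝟙 _) :
    P ◁ m ≫ P ◁ q ≫ e ≫ i =
      leibnizAct (P ◁ q ≫ e ≫ i) (P ◁ q ≫ e ≫ i) ≫ m := by
  have r1 {Y : C} (f : D ⟶ Y) :
      (P ◁ q ≫ e ≫ i) ▷ D ≫ (p ⊗ₘ f) = (P ◁ q ⊗ₘ f) ≫ e ▷ Y := by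
    simp only [← tensorHom_id, tensorHom_comp_tensorHom, Category.assoc, ip]
    simp
  have r2 {Y : C} (f : D ⟶ Y) : (P ◁ q ≫ e ≫ i) ▷ D ≫ (q ⊗ₘ f) = 0 := by
    simp only [← tensorHom_id, tensorHom_comp_tensorHom, Category.assoc, iq]
    simp
  have r3 {Y : C} (f : D ⟶ Y) :
      D ◁ (P ◁ q ≫ e ≫ i) ≫ (f ⊗ₘ p) = (f ⊗ₘ P ◁ q) ≫ Y ◁ e := by
    simp only [← id_tensorHom, tensorHom_comp_tensorHom, Category.assoc, ip]
    simp
  have r4 {Y : C} (f : D ⟶ Y) : D ◁ (P ◁ q ≫ e ≫ i) ≫ (f ⊗ₘ q) = 0 := by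
    simp only [← id_tensorHom, tensorHom_comp_tensorHom, Category.assoc, iq]
    simp
  have r5 {Y Z : C} (f : D ⟶ Y) (g : D ⟶ Z) : (α_ P D D).inv ≫ (P ◁ f ⊗ₘ g) =
      P ◁ (f ⊗ₘ g) ≫ (α_ P Y Z).inv := by
    simp [MonoidalCategory.tensorHom_def]
  have r6 {Y Z : C} (f : D ⟶ Y) (g : D ⟶ Z) : swapLeft P D D ≫ (f ⊗ₘ P ◁ g) =
      P ◁ (f ⊗ₘ g) ≫ swapLeft P Y Z := by
    rw [MonoidalCategory.tensorHom_def, MonoidalCategory.tensorHom_def, whiskerLeft_comp,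
      Category.assoc, swapLeft_nat₃, ← reassoc_of% (swapLeft_nat₂ P f D)]
  have u1 : swapLeft P (𝟙_ C) P ≫ 𝟙_ C ◁ e ≫ (λ_ _).hom = P ◁ (λ_ _).hom ≫ e := by
    simp [swapLeft]
  have u2 : (α_ P P (𝟙_ C)).inv ≫ e ▷ 𝟙_ C ≫ (λ_ _).hom = P ◁ (ρ_ _).hom ≫ e := by
    rw [unitors_equal]
    simp
  apply ext
  · simp only [leibnizAct, Category.assoc, Preadditive.add_comp, hp, ip, Category.comp_id,
      reassoc_of% r1, reassoc_of% r3, reassoc_of% r5, reassoc_of% r6, u1, u2]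
    rw [← whiskerLeft_comp_assoc, hq]
    simp only [MonoidalPreadditive.whiskerLeft_add, Preadditive.add_comp, whiskerLeft_comp,
      Category.assoc]
    rw [add_comm]
  · simp only [leibnizAct, Category.assoc, Preadditive.add_comp, hq, iq, comp_zero,
      Preadditive.comp_add, reassoc_of% r1, reassoc_of% r2, reassoc_of% r3, reassoc_of% r4,
      reassoc_of% r5, reassoc_of% r6, zero_comp, he, hb]
    simp
end SquareZero

variable (C) in
/-- A Lie algebra object: antisymmetric bracket with the Jacobi identity
`[x, [y, z]] = [[x, y], z] + [y, [x, z]]`. -/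
structure LieObj where
  X : C
  bracket : X ⊗ X ⟶ X
  skew : (β_ X X).hom ≫ bracket = -bracket
  jacobi : X ◁ bracket ≫ bracket =
    (α_ X X X).inv ≫ bracket ▷ X ≫ bracket + swapLeft X X X ≫ X ◁ bracket ≫ bracket

/-- A module over a Lie algebra object: `[x, y] m = x (y m) - y (x m)`. -/
structure LieMod (L : LieObj C) where
  M : C
  act : L.X ⊗ M ⟶ M
  act_bracket : (α_ L.X L.X M).inv ≫ L.bracket ▷ M ≫ act =
    L.X ◁ act ≫ act - swapLeft L.X L.X M ≫ L.X ◁ act ≫ act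

namespace LieMod
variable {L : LieObj C}

/-- Morphisms of modules: morphisms commuting with the actions. -/
@[ext]
structure Hom (M N : LieMod L) where
  f : M.M ⟶ N.M
  comm : L.X ◁ f ≫ N.act = M.act ≫ f

instance : Category (LieMod L) where
  Hom := Hom
  id M := ⟨𝟙 _, by simp⟩
  comp f g := ⟨f.f ≫ g.f, by
    rw [whiskerLeft_comp, Category.assoc, g.comm, ← Category.assoc, f.comm, Category.assoc]⟩
  id_comp _ := Hom.ext (Category.id_comp _)
  comp_id _ := Hom.ext (Category.comp_id _)
  assoc _ _ _ := Hom.ext (Category.assoc _ _ _)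

@[ext] theorem hom_ext {M N : LieMod L} {f g : M ⟶ N} (h : f.f = g.f) : f = g := Hom.ext h
@[simp] theorem id_f (M : LieMod L) : Hom.f (𝟙 M) = 𝟙 M.M := rfl
@[simp] theorem comp_f {M N K : LieMod L} (f : M ⟶ N) (g : N ⟶ K) : (f ≫ g).f = f.f ≫ g.f := rfl

instance (M N : LieMod L) : Zero (M ⟶ N) := ⟨⟨0, by simp⟩⟩
instance (M N : LieMod L) : Add (M ⟶ N) :=
  ⟨fun f g => ⟨f.f + g.f, by
    rw [MonoidalPreadditive.whiskerLeft_add, Preadditive.add_comp, f.comm, g.comm, Preadditive.comp_add]⟩⟩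
instance (M N : LieMod L) : Neg (M ⟶ N) :=
  ⟨fun f => ⟨-f.f, by
    have h : L.X ◁ (-f.f) = -(L.X ◁ f.f) := (tensorLeft L.X).map_neg
    rw [h, Preadditive.neg_comp, f.comm, Preadditive.comp_neg]⟩⟩
@[simp] theorem zero_f (M N : LieMod L) : (0 : M ⟶ N).f = 0 := rfl
@[simp] theorem add_f {M N : LieMod L} (f g : M ⟶ N) : (f + g).f = f.f + g.f := rfl
@[simp] theorem neg_f {M N : LieMod L} (f : M ⟶ N) : (-f).f = -f.f := rfl

instance (M N : LieMod L) : AddCommGroup (M ⟶ N) where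
  add_assoc _ _ _ := hom_ext (add_assoc _ _ _)
  zero_add _ := hom_ext (zero_add _)
  add_zero _ := hom_ext (add_zero _)
  add_comm _ _ := hom_ext (add_comm _ _)
  neg_add_cancel _ := hom_ext (neg_add_cancel _)
  nsmul := nsmulRec
  zsmul := zsmulRec

instance : Preadditive (LieMod L) where
  add_comp _ _ _ _ _ _ := hom_ext (Preadditive.add_comp _ _ _ _ _ _)
  comp_add _ _ _ _ _ _ := hom_ext (Preadditive.comp_add _ _ _ _ _ _)


/-- An isomorphism of the underlying objects that commutes with the actions. -/
def isoMk {M N : LieMod L} (e : M.M ≅ N.M) (h : L.X ◁ e.hom ≫ N.act = M.act ≫ e.hom) : M ≅ N where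
  hom := ⟨e.hom, h⟩
  inv := ⟨e.inv, by rw [← cancel_mono e.hom, Category.assoc, ← h]; simp⟩
  hom_inv_id := hom_ext e.hom_inv_id
  inv_hom_id := hom_ext e.inv_hom_id

/-- The tensor product of modules, with the Leibniz action; the unit has the zero action. -/
instance : MonoidalCategoryStruct (LieMod L) where
  tensorObj M N := ⟨M.M ⊗ N.M, leibnizAct M.act N.act,
    leibnizAct_bracket _ _ _ M.act_bracket N.act_bracket⟩
  whiskerLeft M _ _ f := ⟨M.M ◁ f.f, leibnizAct_whiskerLeft _ _ _ _ f.comm⟩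
  whiskerRight f N := ⟨f.f ▷ N.M, leibnizAct_whiskerRight _ _ _ _ f.comm⟩
  tensorUnit := ⟨𝟙_ C, 0, by simp⟩
  associator M N K := isoMk (α_ M.M N.M K.M) (leibnizAct_associator _ _ _)
  leftUnitor M := isoMk (λ_ M.M) (leibnizAct_leftUnitor _)
  rightUnitor M := isoMk (ρ_ M.M) (leibnizAct_rightUnitor _)

@[simp] theorem tensorObj_M (M N : LieMod L) : (M ⊗ N).M = M.M ⊗ N.M := rfl
@[simp] theorem tensorObj_act (M N : LieMod L) : (M ⊗ N).act = leibnizAct M.act N.act := rfl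
@[simp] theorem tensorUnit_M : (𝟙_ (LieMod L)).M = 𝟙_ C := rfl
@[simp] theorem tensorUnit_act : (𝟙_ (LieMod L)).act = 0 := rfl
@[simp] theorem whiskerLeft_f (M : LieMod L) {N K : LieMod L} (f : N ⟶ K) :
    (M ◁ f).f = M.M ◁ f.f := rfl
@[simp] theorem whiskerRight_f {N K : LieMod L} (f : N ⟶ K) (M : LieMod L) :
    (f ▷ M).f = f.f ▷ M.M := rfl
@[simp] theorem associator_hom_f (M N K : LieMod L) : (α_ M N K).hom.f = (α_ M.M N.M K.M).hom := rfl
@[simp] theorem associator_inv_f (M N K : LieMod L) : (α_ M N K).inv.f = (α_ M.M N.M K.M).inv := rfl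
@[simp] theorem leftUnitor_hom_f (M : LieMod L) : (λ_ M).hom.f = (λ_ M.M).hom := rfl
@[simp] theorem leftUnitor_inv_f (M : LieMod L) : (λ_ M).inv.f = (λ_ M.M).inv := rfl
@[simp] theorem rightUnitor_hom_f (M : LieMod L) : (ρ_ M).hom.f = (ρ_ M.M).hom := rfl
@[simp] theorem rightUnitor_inv_f (M : LieMod L) : (ρ_ M).inv.f = (ρ_ M.M).inv := rfl

@[simp] theorem tensorHom_f {M N K J : LieMod L} (f : M ⟶ N) (g : K ⟶ J) :
    (f ⊗ₘ g).f = f.f ⊗ₘ g.f := (tensorHom_def f.f g.f).symm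

instance : MonoidalCategory (LieMod L) where
  tensorHom_def _ _ := rfl
  id_tensorHom_id _ _ := by ext; simp
  tensorHom_comp_tensorHom _ _ _ _ := by ext; simp
  whiskerLeft_id _ _ := by ext; simp
  id_whiskerRight _ _ := by ext; simp
  associator_naturality _ _ _ := by ext; simp
  leftUnitor_naturality _ := by ext; simp
  rightUnitor_naturality _ := by ext; simp
  pentagon _ _ _ _ := by ext; simp
  triangle _ _ := by ext; simp

instance : BraidedCategory (LieMod L) where
  braiding M N := isoMk (β_ M.M N.M) (leibnizAct_braiding _ _)
  braiding_naturality_right _ _ _ _ := hom_ext (BraidedCategory.braiding_naturality_right _ _)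
  braiding_naturality_left _ _ := hom_ext (BraidedCategory.braiding_naturality_left _ _)
  hexagon_forward _ _ _ := hom_ext (BraidedCategory.hexagon_forward _ _ _)
  hexagon_reverse _ _ _ := hom_ext (BraidedCategory.hexagon_reverse _ _ _)

@[simp] theorem braiding_hom_f (M N : LieMod L) : (β_ M N).hom.f = (β_ M.M N.M).hom := rfl

instance : SymmetricCategory (LieMod L) where
  symmetry _ _ := by ext; simp

instance : MonoidalPreadditive (LieMod L) where
  whiskerLeft_zero := by intros; ext; simp
  zero_whiskerRight := by intros; ext; simp
  whiskerLeft_add _ _ := by ext; simp [MonoidalPreadditive.whiskerLeft_add]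
  add_whiskerRight _ _ := by ext; simp [MonoidalPreadditive.add_whiskerRight]

end LieMod

/-- For a commutative algebra `A` and a Lie algebra `L`, the Lie algebra `A ⊗ L` with
`[a x, a' y] = a a' [x, y]`. -/
def LieObj.baseChange (A : C) [MonObj A] [IsCommMonObj A] (L : LieObj C) : LieObj C where
  X := A ⊗ L.X
  bracket := tensorμ A L.X A L.X ≫ (μ[A] ⊗ₘ L.bracket)
  skew := by
    have h := braiding_tensorμ A L.X
    rw [reassoc_of% h, tensorHom_comp_tensorHom, L.skew, IsCommMonObj.mul_comm, tensorHom_neg,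
      Preadditive.comp_neg]
  jacobi := by
    have hA : (α_ A A A).inv ≫ μ[A] ▷ A ≫ μ[A] = A ◁ μ[A] ≫ μ[A] := by
      rw [MonObj.mul_assoc]; simp
    have hs : swapLeft A A A ≫ A ◁ μ[A] ≫ μ[A] = A ◁ μ[A] ≫ μ[A] := by
      rw [← hA]
      simp only [swapLeft, Category.assoc, Iso.hom_inv_id_assoc]
      rw [← comp_whiskerRight_assoc, IsCommMonObj.mul_comm]
    have h := swapLeft_regroup A L.X
    rw [regroup_right, regroup_left, reassoc_of% h, tensorHom_comp_tensorHom, hA, hs,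
      ← Preadditive.comp_add, ← MonoidalPreadditive.tensor_add, ← L.jacobi]

/-- A Lie algebra, seen as a Lie algebra in `Q`-modules through the zero action of `Q`. -/
def LieObj.trivialExt (Q L : LieObj C) : LieObj (LieMod Q) where
  X := ⟨L.X, 0, by simp⟩
  bracket := ⟨L.bracket, by simp [leibnizAct]⟩
  skew := LieMod.hom_ext L.skew
  jacobi := LieMod.hom_ext L.jacobi

end LieTheory

section Super
variable (S : Type u) [Category.{v} S] [Abelian S] [MonoidalCategory S] [SymmetricCategory S]

/-- The symmetric square: coinvariants of the symmetric group on `X ⊗ X`. -/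
abbrev symSquare (X : S) : S := coequalizer (β_ X X).hom (𝟙 (X ⊗ X))

/-- The exterior square: coinvariants of the sign-twisted action on `X ⊗ X`. -/
abbrev extSquare (X : S) : S := coequalizer (β_ X X).hom (-𝟙 (X ⊗ X))

/-- A supercategory: a well-powered and complete `ℚ`-linear tensor category (symmetric monoidal
abelian category with bilinear tensor product) with the choice of an object `P` such that
`Λ² P ≅ I` and `S² P ≅ 0`. -/
class Supercategory [MonoidalPreadditive S] [Linear ℚ S] [MonoidalLinear ℚ S] [HasLimits S]
    [WellPowered.{v} S] where
  P : S
  extIso : extSquare S P ≅ 𝟙_ S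
  symZero : IsZero (symSquare S P)

end Super

section WeilTheory

open Supercategory

variable {S : Type u} [Category.{v} S] [Abelian S] [MonoidalCategory S] [SymmetricCategory S]
  [MonoidalPreadditive S] [Linear ℚ S] [MonoidalLinear ℚ S] [HasLimits S] [WellPowered.{v} S]
  [Supercategory S]

theorem braiding_P : (β_ (P : S) P).hom = -𝟙 _ := by
  let π := coequalizer.π (β_ (P : S) P).hom (𝟙 (P ⊗ P))
  let g := coequalizer.desc (f := (β_ (P : S) P).hom) (g := 𝟙 (P ⊗ P)) ((β_ (P : S) P).hom + 𝟙 _) (by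
    simp [Preadditive.comp_add, add_comm])
  have h : π ≫ g = (β_ (P : S) P).hom + 𝟙 _ := coequalizer.π_desc _ _
  have h0 : g = 0 := symZero.eq_of_src _ _
  rw [h0, comp_zero] at h
  exact eq_neg_of_add_eq_zero_left h.symm

/-- The isomorphism `P ⊗ P ≅ Λ² P ≅ I`. -/
def pairing : (P : S) ⊗ P ⟶ 𝟙_ S :=
  coequalizer.π (β_ (P : S) P).hom (-𝟙 (P ⊗ P)) ≫ extIso.hom

instance : IsIso (pairing (S := S)) := by
  have : IsIso (coequalizer.π (β_ (P : S) P).hom (-𝟙 (P ⊗ P))) := by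
    apply coequalizer.π_of_eq braiding_P
  have : IsIso (extIso (S := S)).hom := (extIso (S := S)).isIso_hom
  unfold pairing
  exact IsIso.comp_isIso

variable (S) in
/-- The abelian Lie algebra `Q` with underlying object `P`. -/
def oddLie : LieObj S where
  X := P
  bracket := 0
  skew := by simp
  jacobi := by simp

variable (S) in
/-- The category of supercomplexes: modules over the abelian Lie algebra `P`, i.e. objects `X`
with an odd differential `P ⊗ X ⟶ X` of square zero. -/
abbrev Cpx := LieMod (oddLie S)

variable (S) in
/-- The symmetric algebra `D = S(P) = I ⊞ P`, as a supercomplex: the differential vanishes on `I`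
and `P ⊗ P ⟶ I` is the canonical pairing. -/
def doubling : Cpx S where
  M := 𝟙_ S ⊞ P
  act := P ◁ biprod.snd ≫ pairing ≫ biprod.inl
  act_bracket := by
    have h : ((P : S) ◁ (P ◁ (biprod.snd : 𝟙_ S ⊞ P ⟶ P) ≫ pairing ≫ biprod.inl)) ≫
      P ◁ (biprod.snd : 𝟙_ S ⊞ P ⟶ P) = 0 := by
      rw [← whiskerLeft_comp]; simp
    have h0 : (oddLie S).bracket = 0 := rfl
    simp only [oddLie, reassoc_of% h]
    simp only [MonoidalPreadditive.zero_whiskerRight, zero_comp, comp_zero]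
    exact (sub_zero _).symm

/-- The product of `D`, with `P · P = 0`. -/
def doublingMul : (𝟙_ S ⊞ P) ⊗ (𝟙_ S ⊞ P) ⟶ (𝟙_ S ⊞ (P : S)) :=
  biprod.lift ((biprod.fst ⊗ₘ biprod.fst) ≫ (λ_ _).hom)
    ((biprod.fst ⊗ₘ biprod.snd) ≫ (λ_ _).hom + (biprod.snd ⊗ₘ biprod.fst) ≫ (ρ_ _).hom)

@[simp] theorem doublingMul_fst : doublingMul (S := S) ≫ biprod.fst =
    (biprod.fst ⊗ₘ biprod.fst) ≫ (λ_ _).hom := biprod.lift_fst _ _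

@[simp] theorem doublingMul_snd : doublingMul (S := S) ≫ biprod.snd =
    (biprod.fst ⊗ₘ biprod.snd) ≫ (λ_ _).hom + (biprod.snd ⊗ₘ biprod.fst) ≫ (ρ_ _).hom :=
  biprod.lift_snd _ _

theorem pairing_assoc : (α_ (P : S) P P).inv ≫ pairing ▷ P ≫ (λ_ P).hom = P ◁ pairing ≫ (ρ_ P).hom := by
  have h := BraidedCategory.braiding_naturality_right (P : S) (pairing (S := S))
  have h2 := BraidedCategory.hexagon_forward (P : S) P P
  have hw : (-𝟙 ((P : S) ⊗ P)) ▷ (P : S) = -𝟙 _ := by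
    have := (tensorRight (P : S)).map_neg (f := 𝟙 ((P : S) ⊗ P))
    rwa [CategoryTheory.Functor.map_id] at this
  have hw' : (P : S) ◁ (-𝟙 ((P : S) ⊗ P)) = -𝟙 _ := by
    have := (tensorLeft (P : S)).map_neg (f := 𝟙 ((P : S) ⊗ P))
    rwa [CategoryTheory.Functor.map_id] at this
  rw [braiding_P, hw, hw'] at h2
  have h3 : (β_ (P : S) (P ⊗ P)).hom = (α_ (P : S) P P).inv := by
    rw [← cancel_mono (α_ (P : S) P P).hom, ← cancel_epi (α_ (P : S) P P).hom, h2]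
    simp
  rw [← h3, ← reassoc_of% h]
  simp

theorem swapLeft_P : swapLeft (P : S) P P = -𝟙 _ := by
  have hw : (-𝟙 ((P : S) ⊗ P)) ▷ (P : S) = -𝟙 _ := by
    have := (tensorRight (P : S)).map_neg (f := 𝟙 ((P : S) ⊗ P))
    rwa [CategoryTheory.Functor.map_id] at this
  rw [swapLeft, braiding_P, hw]
  simp

theorem doubling_ext {X : S} {f g : X ⟶ 𝟙_ S ⊞ (P : S)} (h : f ≫ biprod.fst = g ≫ biprod.fst)
    (h' : f ≫ biprod.snd = g ≫ biprod.snd) : f = g := biprod.hom_ext _ _ h h'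

instance : MonObj (doubling S) where
  one := ⟨biprod.inl, by
    have h : (P : S) ◁ (biprod.inl : 𝟙_ S ⟶ 𝟙_ S ⊞ P) ≫
        P ◁ (biprod.snd : 𝟙_ S ⊞ P ⟶ P) = 0 := by
      rw [← whiskerLeft_comp]; simp
    refine (reassoc_of% h) (pairing ≫ biprod.inl) |>.trans ?_
    rw [zero_comp, LieMod.tensorUnit_act]
    exact zero_comp.symm⟩
  mul := ⟨doublingMul, sqZero_derivation doubling_ext doublingMul_fst doublingMul_snd
    biprod.inl_fst biprod.inl_snd pairing pairing_assoc swapLeft_P⟩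
  one_mul := LieMod.hom_ext (sqZero_one_mul doubling_ext doublingMul_fst doublingMul_snd
    biprod.inl_fst biprod.inl_snd)
  mul_one := LieMod.hom_ext (sqZero_mul_one doubling_ext doublingMul_fst doublingMul_snd
    biprod.inl_fst biprod.inl_snd)
  mul_assoc := LieMod.hom_ext (sqZero_assoc doubling_ext doublingMul_fst doublingMul_snd)

instance : IsCommMonObj (doubling S) where
  mul_comm := LieMod.hom_ext (sqZero_comm doubling_ext doublingMul_fst doublingMul_snd)

/-- The Lie algebra `L = D ⊗ L₀` in supercomplexes. -/
def doubleLie (L₀ : LieObj S) : LieObj (Cpx S) :=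
  LieObj.baseChange (doubling S) (LieObj.trivialExt _ L₀)

/-- The category `𝓛` of modules, in supercomplexes, over `L = D ⊗ L₀`. -/
abbrev LMod (L₀ : LieObj S) := LieMod (doubleLie L₀)

namespace LMod
variable {L₀ : LieObj S}

/-- The underlying object of `S`. -/
abbrev obj (X : LMod L₀) : S := X.M.M

/-- The underlying morphism of `S`. -/
abbrev mor {X Y : LMod L₀} (f : X ⟶ Y) : X.obj ⟶ Y.obj := f.f.f

/-- The odd differential. -/
def d (X : LMod L₀) : P ⊗ X.obj ⟶ X.obj := X.M.act

/-- The action of `L`, as a morphism of `S`. -/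
def action (X : LMod L₀) : ((𝟙_ S ⊞ P) ⊗ L₀.X) ⊗ X.obj ⟶ X.obj := X.act.f

/-- The action of the even part `L₀` of `L`. -/
def evenAction (X : LMod L₀) : L₀.X ⊗ X.obj ⟶ X.obj :=
  ((λ_ L₀.X).inv ≫ biprod.inl ▷ L₀.X) ▷ X.obj ≫ X.action

/-- The action of the odd part `P ⊗ L₀` of `L` (the contractions). -/
def oddAction (X : LMod L₀) : (P ⊗ L₀.X) ⊗ X.obj ⟶ X.obj :=
  (biprod.inr ▷ L₀.X) ▷ X.obj ≫ X.action

theorem mor_action {X Y : LMod L₀} (f : X ⟶ Y) :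
    ((𝟙_ S ⊞ P) ⊗ L₀.X) ◁ mor f ≫ Y.action = X.action ≫ mor f :=
  congrArg LieMod.Hom.f f.comm

theorem mor_evenAction {X Y : LMod L₀} (f : X ⟶ Y) :
    L₀.X ◁ mor f ≫ Y.evenAction = X.evenAction ≫ mor f := by
  unfold evenAction
  rw [whisker_exchange_assoc, mor_action, Category.assoc]

theorem mor_oddAction {X Y : LMod L₀} (f : X ⟶ Y) :
    (P ⊗ L₀.X) ◁ mor f ≫ Y.oddAction = X.oddAction ≫ mor f := by
  unfold oddAction
  rw [whisker_exchange_assoc, mor_action, Category.assoc]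

end LMod

/-- A homotopy between two `𝓛`-morphisms: an odd morphism `h` of `S` which commutes with the
action of `L` (which moves past the odd symbol by the symmetry) and satisfies
`d h + h d = f - g`, where `P ⊗ P` is identified with `I`. -/
structure OddHomotopy {L₀ : LieObj S} {X Y : LMod L₀} (f g : X ⟶ Y) where
  h : P ⊗ X.obj ⟶ Y.obj
  comm : ((𝟙_ S ⊞ P) ⊗ L₀.X) ◁ h ≫ Y.action =
    swapLeft ((𝟙_ S ⊞ P) ⊗ L₀.X) P X.obj ≫ P ◁ X.action ≫ h
  eq : P ◁ h ≫ Y.d + P ◁ X.d ≫ h =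
    (α_ P P X.obj).inv ≫ pairing ▷ X.obj ≫ (λ_ X.obj).hom ≫ (LMod.mor f - LMod.mor g)

/-- An algebra morphism in `𝓛` is a quasi-isomorphism if it has a homotopy inverse as an
`𝓛`-morphism. -/
def IsQuasiIsomorphism {L₀ : LieObj S} {A B : Mon (LMod L₀)} (f : A ⟶ B) : Prop :=
  ∃ g : B.X ⟶ A.X, Nonempty (OddHomotopy (g ≫ f.hom) (𝟙 B.X)) ∧
    Nonempty (OddHomotopy (f.hom ≫ g) (𝟙 A.X))

/-- The category of unital objects of `𝓛`. -/
abbrev UnitalObj (L₀ : LieObj S) := Under (𝟙_ (LMod L₀))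

/-- The underlying morphism of `S` of the distinguished morphism of a unital object. -/
def UnitalObj.unit {L₀ : LieObj S} (X : UnitalObj L₀) : 𝟙_ S ⟶ X.right.obj := LMod.mor X.hom

/-- The forgetful functor from associative algebras to unital objects. -/
def forgetUnital (L₀ : LieObj S) : Mon (LMod L₀) ⥤ UnitalObj L₀ where
  obj A := Under.mk η[A.X]
  map f := Under.homMk f.hom (by simp)

section Connection

variable (L₀ : LieObj S) (Ld : S) [ExactPairing L₀.X Ld]

/-- The coadjoint action on the dual `Ld` of `L₀`: `⟨y ξ, x⟩ = -⟨ξ, [y, x]⟩`. -/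
def coadjoint : L₀.X ⊗ Ld ⟶ Ld :=
  tensorRightHomEquiv (L₀.X ⊗ Ld) L₀.X Ld (𝟙_ S)
    (-((β_ L₀.X Ld).hom ▷ L₀.X ≫ (α_ Ld L₀.X L₀.X).hom ≫ Ld ◁ L₀.bracket ≫ ε_ L₀.X Ld)) ≫
      (λ_ Ld).hom

/-- The evaluation `P L₀ ⊗ P L₀* ⟶ P P L₀ L₀* ⟶ I`. -/
def oddEvaluation : (P ⊗ L₀.X) ⊗ (P ⊗ Ld) ⟶ 𝟙_ S :=
  tensorμ P L₀.X P Ld ≫ (pairing ⊗ₘ ((β_ L₀.X Ld).hom ≫ ε_ L₀.X Ld)) ≫ (λ_ (𝟙_ S)).hom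

theorem coadjoint_evaluation : coadjoint L₀ Ld ▷ L₀.X ≫ ε_ L₀.X Ld =
    -((β_ L₀.X Ld).hom ▷ L₀.X ≫ (α_ Ld L₀.X L₀.X).hom ≫ Ld ◁ L₀.bracket ≫ ε_ L₀.X Ld) := by
  rw [← (tensorRightHomEquiv (L₀.X ⊗ Ld) L₀.X Ld (𝟙_ S)).symm_apply_apply (-_), coadjoint]
  simp [tensorRightHomEquiv]
  rw [← unitors_equal]
  simp

variable {L₀} in
/-- A connection on a unital object: an odd morphism from `L₀*` which is `L₀`-equivariant and
whose contraction with `P L₀` is the evaluation followed by the unit. -/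
@[ext]
structure Connection (X : UnitalObj L₀) where
  θ : P ⊗ Ld ⟶ X.right.obj
  equivariant : L₀.X ◁ θ ≫ X.right.evenAction =
    swapLeft L₀.X P Ld ≫ P ◁ coadjoint L₀ Ld ≫ θ
  contraction : (P ⊗ L₀.X) ◁ θ ≫ X.right.oddAction = oddEvaluation L₀ Ld ≫ X.unit

variable {L₀ Ld} in
/-- The image of a connection under a morphism of unital objects. -/
def Connection.map {X Y : UnitalObj L₀} (c : Connection Ld X) (f : X ⟶ Y) : Connection Ld Y where
  θ := c.θ ≫ LMod.mor f.right
  equivariant := by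
    rw [whiskerLeft_comp, Category.assoc, LMod.mor_evenAction, reassoc_of% c.equivariant]
  contraction := by
    have h : X.unit ≫ LMod.mor f.right = Y.unit := congrArg LMod.mor (Under.w f)
    rw [whiskerLeft_comp, Category.assoc, LMod.mor_oddAction, reassoc_of% c.contraction, h]

/-- The functor `Θ` of connections. -/
def connectionFunctor : UnitalObj L₀ ⥤ Type v where
  obj X := Connection Ld X
  map {X Y} f := TypeCat.ofHom fun c => c.map f
  map_id X := by
    ext c
    exact Category.comp_id c.θ
  map_comp f g := by
    ext c
    exact (Category.assoc c.θ _ _).symm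

/-- The value `T₁(M)`: `A` is the free associative algebra of `𝓛` on the
unital object `M`. -/
abbrev IsFreeAsso {L₀ : LieObj S} (M : UnitalObj L₀) (A : Mon (LMod L₀)) : Type _ :=
  (forgetUnital L₀ ⋙ coyoneda.obj (Opposite.op M)).CorepresentableBy A

/-- The value `S₁(M)`: `C` is the free commutative algebra of `𝓛` on the unital object `M`. -/
abbrev IsFreeComm {L₀ : LieObj S} (M : UnitalObj L₀) (C : CommMon (LMod L₀)) : Type _ :=
  (CommMon.forget₂Mon _ ⋙ forgetUnital L₀ ⋙ coyoneda.obj (Opposite.op M)).CorepresentableBy C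

/-- The Weil objects of `L₀`: the unital object `M_L` representing the functor of connections, and
the free algebras `A_L = T₁(M_L)` and `C_L = S₁(M_L)`; they are determined up to unique
isomorphism. -/
structure WeilObjects where
  M : UnitalObj L₀
  repM : (connectionFunctor L₀ Ld).CorepresentableBy M
  A : Mon (LMod L₀)
  freeA : IsFreeAsso M A
  C : CommMon (LMod L₀)
  freeC : IsFreeComm M C

variable {L₀ Ld} in
/-- The natural algebra morphism `A_L ⟶ C_L`: the one that restricts to the canonical morphism
`M_L ⟶ C_L`. -/
def WeilObjects.naturalMap (W : WeilObjects L₀ Ld) : W.A ⟶ W.C.toMon :=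
  W.freeA.homEquiv.symm (W.freeC.homEquiv (𝟙 W.C))

end Connection

end WeilTheory

end SuperWeil

end

noncomputable section

namespace SuperWeil

/-! ### Additivity of whiskering. -/

section PreadditiveMonoidal

variable {C : Type u} [Category.{v} C] [Preadditive C] [MonoidalCategory C]
  [MonoidalPreadditive C]

/-! An odd morphism from L₀* extends uniquely to a morphism of supercomplexes from D ⊗ L₀*, and the
two axioms of a connection say that this extension is L-linear up to a multiple of the unit. Hence M
is the extension of the L-module D ⊗ L₀* by I whose cocycle pairs P ⊗ L₀ with P ⊗ L₀*
(`connectionCocycle`, `universalRep`).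

The unit of M splits in supercomplexes, M = I ⊕ N, though the cocycle obstructs the obvious
splitting over L. In S the free associative algebra is A = ⊕ Nⁿ, with the unit of M acting as 1, and
L acts on it by derivations. Such a derivation sends Nⁿ⁺¹ to Nⁿ⁺¹ ⊕ Nⁿ: a derivation of degree 0
plus a contraction of degree -1. Both commute with symmetrizers (`UnitSplitting.e_deriv`), so the
symmetrization operator e of A is L-linear. Its kernel is an ideal containing the commutators, and
every algebra morphism from A to a commutative algebra absorbs e (`SymTensor.e_monHom`). The image
of e is therefore the free commutative algebra C, with projection p : A ⟶ C, section i, and p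
followed by i equal to e.

It remains to see that e is homotopic to 1. A morphism of L-modules D ⊗ X ⟶ Y, with L acting
trivially on D, is a null homotopy of its restriction to I ⊗ X (`OddHomotopy.ofHom`). Since D
multiplies D ⊗ L₀*, every L-morphism from M that kills the unit has such an extension
(`exists_contraction`). This applies to m ↦ m ⊗ 1 - 1 ⊗ m from M to A ⊗ A. Extending by the Leibniz
rule gives D ⊗ A ⟶ A ⊗ A, which over I is the universal derivation t ↦ t ⊗ 1 - 1 ⊗ t; followed by x
⊗ y ↦ x e(y) it becomes t ↦ t - e(t) (`SymTensor.exists_homotopy`). This last argument uses only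
that e is L-linear and fixes 1. -/

theorem whiskerLeft_sub (X : C) {Y Z : C} (f g : Y ⟶ Z) : X ◁ (f - g) = X ◁ f - X ◁ g :=
  (tensorLeft X).map_sub

theorem sub_whiskerRight (X : C) {Y Z : C} (f g : Y ⟶ Z) : (f - g) ▷ X = f ▷ X - g ▷ X :=
  (tensorRight X).map_sub

theorem whiskerLeft_neg (X : C) {Y Z : C} (f : Y ⟶ Z) : X ◁ (-f) = -(X ◁ f) :=
  (tensorLeft X).map_neg

theorem neg_whiskerRight (X : C) {Y Z : C} (f : Y ⟶ Z) : (-f) ▷ X = -(f ▷ X) :=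
  (tensorRight X).map_neg

end PreadditiveMonoidal

/-! ### Modules over a Lie algebra: defect of an action, biproducts, retracts. -/

section LieModules

variable {C : Type u} [Category.{v} C] [Preadditive C] [MonoidalCategory C]
  [MonoidalPreadditive C] [SymmetricCategory C]

/-- The failure of `a` to be an action of the Lie algebra with bracket `b`. -/
def lieDefect {L M : C} (b : L ⊗ L ⟶ L) (a : L ⊗ M ⟶ M) : L ⊗ (L ⊗ M) ⟶ M :=
  (α_ L L M).inv ≫ b ▷ M ≫ a - (L ◁ a ≫ a - swapLeft L L M ≫ L ◁ a ≫ a)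

theorem lieDefect_eq_zero_iff {L M : C} (b : L ⊗ L ⟶ L) (a : L ⊗ M ⟶ M) :
    lieDefect b a = 0 ↔
      (α_ L L M).inv ≫ b ▷ M ≫ a = L ◁ a ≫ a - swapLeft L L M ≫ L ◁ a ≫ a :=
  sub_eq_zero

/-- Serves to establish the action axiom for an object not yet known to be a module: through
monomorphisms into known modules (biproducts, retracts), or on generators (derivations). -/
theorem lieDefect_naturality {L M M' : C} (b : L ⊗ L ⟶ L) (a : L ⊗ M ⟶ M) (a' : L ⊗ M' ⟶ M')
    (f : M ⟶ M') (hf : L ◁ f ≫ a' = a ≫ f) :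
    L ◁ L ◁ f ≫ lieDefect b a' = lieDefect b a ≫ f := by
  have h1 : L ◁ L ◁ f ≫ L ◁ a' ≫ a' = L ◁ a ≫ a ≫ f := by
    rw [← whiskerLeft_comp_assoc, hf, whiskerLeft_comp_assoc, hf]
  have h2 : L ◁ L ◁ f ≫ (α_ L L M').inv ≫ b ▷ M' ≫ a' = (α_ L L M).inv ≫ b ▷ M ≫ a ≫ f := by
    rw [← hf, ← whisker_exchange_assoc]
    simp
  simp only [lieDefect, Preadditive.comp_sub, Preadditive.sub_comp, Category.assoc, h1, h2,
    reassoc_of% (swapLeft_nat₃ L L f)]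

/-- The defect of a Leibniz action is the sum of the defects of the factors. -/
theorem lieDefect_leibnizAct {L M N : C} (b : L ⊗ L ⟶ L) (a : L ⊗ M ⟶ M) (c : L ⊗ N ⟶ N) :
    lieDefect b (leibnizAct a c) =
      (α_ L L (M ⊗ N)).inv ≫ (α_ (L ⊗ L) M N).inv ≫ (α_ L L M).hom ▷ N ≫ lieDefect b a ▷ N +
        L ◁ swapLeft L M N ≫ swapLeft L M (L ⊗ N) ≫ M ◁ lieDefect b c := by
  simp only [lieDefect, leibnizAct]
  set A := (α_ L M N).inv ≫ a ▷ N with hA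
  set B := swapLeft L M N ≫ M ◁ c with hB
  let T := (α_ L L (M ⊗ N)).inv ≫ (α_ (L ⊗ L) M N).inv ≫ (α_ L L M).hom ▷ N
  let X := L ◁ swapLeft L M N ≫ swapLeft L M (L ⊗ N)
  have hAA : L ◁ A ≫ A = T ≫ (L ◁ a ≫ a) ▷ N := by
    simp [hA, T]
  have hsT : swapLeft L L (M ⊗ N) ≫ T = T ≫ swapLeft L L M ▷ N := by
    simp [T, swapLeft]
  have hbA : (α_ L L (M ⊗ N)).inv ≫ b ▷ (M ⊗ N) ≫ A = T ≫ ((α_ L L M).inv ≫ b ▷ M ≫ a) ▷ N := by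
    simp [hA, T]
  have hBB : L ◁ B ≫ B = X ≫ M ◁ (L ◁ c ≫ c) := by
    have := swapLeft_nat₃ L M c
    simp only [hB, X, whiskerLeft_comp, Category.assoc, reassoc_of% this]
  have hsX : swapLeft L L (M ⊗ N) ≫ X = X ≫ M ◁ swapLeft L L N := by
    simpa [X] using swapLeft_yb L L M N
  have hbB : (α_ L L (M ⊗ N)).inv ≫ b ▷ (M ⊗ N) ≫ B = X ≫ M ◁ ((α_ L L N).inv ≫ b ▷ N ≫ c) := by
    have h1 := swapLeft_nat₁ b M N
    have h2 := swapLeft_hex₁ L L M N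
    simp only [hB, X, whiskerLeft_comp, Category.assoc, reassoc_of% h1, reassoc_of% h2]
  have hAB : L ◁ A ≫ B = swapLeft L L (M ⊗ N) ≫ L ◁ B ≫ A := by
    have h1 := swapLeft_nat₂ L a N
    have h2 := swapLeft_hex₂ L L M N
    simp only [hA, hB, whiskerLeft_comp, Category.assoc, reassoc_of% h1, reassoc_of% h2]
    rw [← whisker_exchange]
    simp
  have hBA : L ◁ B ≫ A = swapLeft L L (M ⊗ N) ≫ L ◁ A ≫ B := by
    have h := swapLeft_swapLeft L L (M ⊗ N)
    rw [hAB, reassoc_of% h]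
  simp only [MonoidalPreadditive.whiskerLeft_add, Preadditive.add_comp, Preadditive.comp_add,
    hAA, hBB, hbA, hbB, ← hAB, ← hBA]
  have e1 : (α_ L L (M ⊗ N)).inv ≫ (α_ (L ⊗ L) M N).inv ≫ (α_ L L M).hom ▷ N = T := rfl
  have e2 : L ◁ swapLeft L M N ≫ swapLeft L M (L ⊗ N) = X := rfl
  simp only [sub_whiskerRight, whiskerLeft_sub, Preadditive.comp_sub, reassoc_of% e1,
    reassoc_of% e2]
  simp only [comp_whiskerRight, whiskerLeft_comp, reassoc_of% hsT, reassoc_of% hsX]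
  abel

instance (X Y Z : C) : IsIso (swapLeft X Y Z) :=
  ⟨swapLeft Y X Z, swapLeft_swapLeft X Y Z, swapLeft_swapLeft Y X Z⟩

namespace LieMod

variable {L : LieObj C}

/-- The trivial module. -/
def trivial (L : LieObj C) (V : C) : LieMod L := ⟨V, 0, by simp⟩

/-- The direct sum of two modules. -/
def directSum [HasBinaryBiproducts C] (M N : LieMod L) : BinaryBicone M N where
  pt := ⟨M.M ⊞ N.M, L.X ◁ biprod.fst ≫ M.act ≫ biprod.inl +
      L.X ◁ biprod.snd ≫ N.act ≫ biprod.inr, by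
    rw [← lieDefect_eq_zero_iff]
    set a := L.X ◁ (biprod.fst : M.M ⊞ N.M ⟶ _) ≫ M.act ≫ biprod.inl +
      L.X ◁ biprod.snd ≫ N.act ≫ biprod.inr
    have h1 : L.X ◁ biprod.fst ≫ M.act = a ≫ biprod.fst := by simp [a]
    have h2 : L.X ◁ biprod.snd ≫ N.act = a ≫ biprod.snd := by simp [a]
    -- Both projections are equivariant onto modules, so the defect dies after each of them.
    apply biprod.hom_ext
    · rw [← lieDefect_naturality _ _ _ _ h1, (lieDefect_eq_zero_iff _ _).2 M.act_bracket]
      simp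
    · rw [← lieDefect_naturality _ _ _ _ h2, (lieDefect_eq_zero_iff _ _).2 N.act_bracket]
      simp⟩
  fst := ⟨biprod.fst, by simp⟩
  snd := ⟨biprod.snd, by simp⟩
  inl := ⟨biprod.inl, by simp [← whiskerLeft_comp_assoc]⟩
  inr := ⟨biprod.inr, by simp [← whiskerLeft_comp_assoc]⟩
  inl_fst := hom_ext (by simp)
  inl_snd := hom_ext (by simp)
  inr_fst := hom_ext (by simp)
  inr_snd := hom_ext (by simp)

instance [HasBinaryBiproducts C] : HasBinaryBiproducts (LieMod L) where
  has_binary_biproduct M N := hasBinaryBiproduct_of_total (directSum M N)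
    (hom_ext (biprod.total (X := M.M) (Y := N.M)))

/-- The image carries the action of `M` compressed by `i` and `e`. Equivariance of `p` makes `i`
equivariant, and a split monomorphism reflects the vanishing of the defect. The free commutative
algebra will be such an image. -/
instance [IsIdempotentComplete C] : IsIdempotentComplete (LieMod L) where
  idempotents_split M p hp := by
    obtain ⟨Y, i, e, h1, h2⟩ := IsIdempotentComplete.idempotents_split M.M p.f
      (congrArg Hom.f hp)
    have hi : L.X ◁ i ≫ M.act = (L.X ◁ i ≫ M.act ≫ e) ≫ i := by
      simp only [Category.assoc, h2]
      rw [← p.comm, ← whiskerLeft_comp_assoc, ← h2, reassoc_of% h1]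
    have hd : lieDefect L.bracket (L.X ◁ i ≫ M.act ≫ e) = 0 := by
      have h := lieDefect_naturality L.bracket _ _ i hi
      rw [(lieDefect_eq_zero_iff _ _).2 M.act_bracket, comp_zero] at h
      rw [← Category.comp_id (lieDefect _ _), ← h1, ← Category.assoc, ← h, zero_comp]
    have he : L.X ◁ e ≫ L.X ◁ i ≫ M.act ≫ e = M.act ≫ e := by
      rw [← whiskerLeft_comp_assoc, h2, reassoc_of% p.comm]
      rw [← h2, Category.assoc, h1, Category.comp_id]
    exact ⟨⟨Y, L.X ◁ i ≫ M.act ≫ e, (lieDefect_eq_zero_iff _ _).1 hd⟩, ⟨i, hi⟩, ⟨e, he⟩,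
      hom_ext h1, hom_ext h2⟩

end LieMod

end LieModules

/-! ### The reduced tensor algebra through its recursion, and its lift to modules. -/

section SymmetrizedTensor

variable {C : Type u} [Category.{v} C] [Preadditive C] [MonoidalCategory C]
  [MonoidalPreadditive C] [SymmetricCategory C]

/-- The reduced tensor algebra of a unital object `u : 𝟙_ C ⟶ M`, characterized by recursion on the
last tensor factor, together with its symmetrization operator `e`. -/
structure SymTensor {M : C} (u : 𝟙_ C ⟶ M) where
  T : C
  o : 𝟙_ C ⟶ T
  s : T ⊗ M ⟶ T
  s_unit : T ◁ u ≫ s = (ρ_ T).hom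
  -- `f` plays the role of right multiplication by generators, and `G` is the inhomogeneous term
  -- that derivations need; `hf` and `hG` make the recursion consistent with `s_unit`. No coproduct
  -- is mentioned, so the characterization can be carried to module categories.
  exists_rec {X Z : C} (f₀ : X ⟶ Z) (f : Z ⊗ M ⟶ Z) (G : X ⊗ (T ⊗ M) ⟶ Z)
    (hf : Z ◁ u ≫ f = (ρ_ Z).hom) (hG : X ◁ T ◁ u ≫ G = 0) :
    ∃ r : X ⊗ T ⟶ Z, X ◁ o ≫ r = (ρ_ X).hom ≫ f₀ ∧
      X ◁ s ≫ r = (α_ X T M).inv ≫ r ▷ M ≫ f + G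
  rec_unique {X Z : C} (f : Z ⊗ M ⟶ Z) (G : X ⊗ (T ⊗ M) ⟶ Z) {r r' : X ⊗ T ⟶ Z}
    (h₀ : X ◁ o ≫ r = X ◁ o ≫ r') (h : X ◁ s ≫ r = (α_ X T M).inv ≫ r ▷ M ≫ f + G)
    (h' : X ◁ s ≫ r' = (α_ X T M).inv ≫ r' ▷ M ≫ f + G) : r = r'
  e : T ⟶ T
  o_e : o ≫ e = o
  s_e : s ≫ e = e ▷ M ≫ s ≫ e
  s_s_e : (α_ T M M).hom ≫ T ◁ (β_ M M).hom ≫ (α_ T M M).inv ≫ s ▷ M ≫ s ≫ e = s ▷ M ≫ s ≫ e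
  e_comp {Z : C} (φ : T ⟶ Z) (f : Z ⊗ M ⟶ Z) (hφ : s ≫ φ = φ ▷ M ≫ f)
    (hf : (α_ Z M M).hom ≫ Z ◁ (β_ M M).hom ≫ (α_ Z M M).inv ≫ f ▷ M ≫ f = f ▷ M ≫ f) :
    e ≫ φ = φ
  -- This is what makes `e` equivariant when a Lie algebra acts by derivations.
  e_deriv {X : C} (δ₀ : X ⊗ M ⟶ M) (δ : X ⊗ T ⟶ T) (hu : X ◁ u ≫ δ₀ = 0) (ho : X ◁ o ≫ δ = 0)
    (hs : X ◁ s ≫ δ = leibnizAct δ δ₀ ≫ s) : X ◁ e ≫ δ = δ ≫ e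

namespace SymTensor

section Lift

variable {L : LieObj C} {M : LieMod L} {u : 𝟙_ (LieMod L) ⟶ M}

theorem unit_act (u : 𝟙_ (LieMod L) ⟶ M) : L.X ◁ u.f ≫ M.act = 0 := by
  rw [u.comm, LieMod.tensorUnit_act]
  exact zero_comp

/-- The Leibniz rule on tm is a recursion with inhomogeneous term t·δ₀(m), consistent at the unit
because δ₀ kills it. -/
theorem exists_deriv {M : C} {u : 𝟙_ C ⟶ M} (A : SymTensor u) {X : C} (δ₀ : X ⊗ M ⟶ M)
    (hu : X ◁ u ≫ δ₀ = 0) :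
    ∃ δ : X ⊗ A.T ⟶ A.T, X ◁ A.o ≫ δ = 0 ∧ X ◁ A.s ≫ δ = leibnizAct δ δ₀ ≫ A.s := by
  obtain ⟨δ, h1, h2⟩ := A.exists_rec (X := X) 0 A.s (swapLeft X A.T M ≫ A.T ◁ δ₀ ≫ A.s) A.s_unit (by
    rw [reassoc_of% (swapLeft_nat₃ X A.T u), ← whiskerLeft_comp_assoc, hu]
    simp)
  exact ⟨δ, by simpa using h1, by simpa [leibnizAct] using h2⟩

/-- The action of `L` on the reduced tensor algebra, by derivations. -/
def liftAct (A : SymTensor u.f) : L.X ⊗ A.T ⟶ A.T := (A.exists_deriv M.act (unit_act u)).choose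

variable (A : SymTensor u.f)

theorem o_liftAct : L.X ◁ A.o ≫ liftAct A = 0 :=
  (A.exists_deriv M.act (unit_act u)).choose_spec.1

theorem s_liftAct : L.X ◁ A.s ≫ liftAct A = leibnizAct (liftAct A) M.act ≫ A.s :=
  (A.exists_deriv M.act (unit_act u)).choose_spec.2

/-- The reduced tensor algebra as an `L`-module. -/
def liftT : LieMod L where
  M := A.T
  act := liftAct A
  act_bracket := by
    -- The defect of an action by derivations is again a derivation, with parameter L ⊗ L
    -- (`lieDefect_leibnizAct`). It kills 1, and on generators it is the defect of `M`, which is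
    -- zero; so it solves the same recursion as 0.
    rw [← lieDefect_eq_zero_iff, ← cancel_epi (α_ L.X L.X A.T).hom, comp_zero]
    refine A.rec_unique A.s 0 ?_ ?_ ?_
    · have h := lieDefect_naturality L.bracket 0 (liftAct A) A.o (by simp [o_liftAct])
      have h0 : lieDefect L.bracket (0 : L.X ⊗ 𝟙_ C ⟶ 𝟙_ C) = 0 := by simp [lieDefect]
      rw [h0, zero_comp] at h
      simp [h]
    · have h := lieDefect_naturality L.bracket _ _ A.s (s_liftAct A)
      rw [lieDefect_leibnizAct, (lieDefect_eq_zero_iff _ _).2 M.act_bracket] at h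
      simp only [associator_naturality_right_assoc, h]
      simp
    · simp

/-- Acting on the value of `r` and acting on its argument both solve one recursion with parameter L
⊗ X, hence agree. This keeps morphisms defined by recursion inside the module category. -/
theorem rec_equivariant {X Z : LieMod L} (f : Z.M ⊗ M.M ⟶ Z.M) (G : X.M ⊗ (A.T ⊗ M.M) ⟶ Z.M)
    (f₀ : X ⟶ Z) (r : X.M ⊗ A.T ⟶ Z.M) (h₀ : X.M ◁ A.o ≫ r = (ρ_ X.M).hom ≫ f₀.f)
    (hf : L.X ◁ f ≫ Z.act = leibnizAct Z.act M.act ≫ f)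
    (hG : L.X ◁ G ≫ Z.act = leibnizAct X.act (leibnizAct (liftAct A) M.act) ≫ G)
    (h : X.M ◁ A.s ≫ r = (α_ X.M A.T M.M).inv ≫ r ▷ M.M ≫ f + G) :
    L.X ◁ r ≫ Z.act = leibnizAct X.act (liftAct A) ≫ r := by
  have hsw : L.X ◁ (α_ X.M A.T M.M).inv ≫ leibnizAct (leibnizAct X.act (liftAct A)) M.act =
      leibnizAct X.act (leibnizAct (liftAct A) M.act) ≫ (α_ X.M A.T M.M).inv := by
    rw [← cancel_mono (α_ X.M A.T M.M).hom, Category.assoc, ← leibnizAct_associator]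
    simp
  rw [← cancel_epi (α_ L.X X.M A.T).hom]
  -- The term shared by both sides: L acts on the last generator before `r` and `f` are applied.
  let sw := L.X ◁ (α_ X.M A.T M.M).inv ≫ swapLeft L.X (X.M ⊗ A.T) M.M ≫ (X.M ⊗ A.T) ◁ M.act ≫
    r ▷ M.M ≫ f
  refine A.rec_unique f ((α_ L.X X.M _).hom ≫ (sw + L.X ◁ G ≫ Z.act)) ?_ ?_ ?_
  · have h1 := leibnizAct_whiskerLeft X.act 0 (liftAct A) A.o (by simp [o_liftAct])
    have h2 := leibnizAct_rightUnitor X.act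
    simp only [associator_naturality_right_assoc, ← whiskerLeft_comp_assoc, h₀, reassoc_of% h1]
    simp only [whiskerLeft_comp, Category.assoc, f₀.comm, reassoc_of% h2]
  · simp only [associator_naturality_right_assoc, ← whiskerLeft_comp_assoc, h]
    simp only [MonoidalPreadditive.whiskerLeft_add, Preadditive.add_comp, Preadditive.comp_add,
      whiskerLeft_comp, Category.assoc, hf, sw, ← add_assoc]
    congr 1
    simp only [leibnizAct, Preadditive.add_comp, Preadditive.comp_add, Category.assoc]
    congr 1
    · simp
    · rw [reassoc_of% (swapLeft_nat₂ L.X r M.M), ← whisker_exchange_assoc]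
  · have h1 := leibnizAct_whiskerLeft X.act _ (liftAct A) A.s (s_liftAct A)
    simp only [associator_naturality_right_assoc, reassoc_of% h1, h]
    simp only [Preadditive.comp_add, ← reassoc_of% hsw, hG, sw, ← add_assoc]
    congr 1
    simp only [leibnizAct, Preadditive.add_comp, Preadditive.comp_add, Category.assoc]
    congr 1
    simp

/-- The reduced tensor algebra of a unital `L`-module is that of the underlying unital object. -/
def lift : SymTensor u where
  T := liftT A
  o := ⟨A.o, (o_liftAct A).trans zero_comp.symm⟩
  s := ⟨A.s, s_liftAct A⟩
  s_unit := LieMod.hom_ext A.s_unit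
  exists_rec {X Z} f₀ f G hf hG := by
    obtain ⟨r, h1, h2⟩ := A.exists_rec f₀.f f.f G.f (congrArg LieMod.Hom.f hf)
      (congrArg LieMod.Hom.f hG)
    exact ⟨⟨r, rec_equivariant A f.f G.f f₀ r h1 f.comm G.comm h2⟩, LieMod.hom_ext h1, LieMod.hom_ext h2⟩
  rec_unique f G _ _ h₀ h h' := LieMod.hom_ext (A.rec_unique f.f G.f (congrArg LieMod.Hom.f h₀)
    (congrArg LieMod.Hom.f h) (congrArg LieMod.Hom.f h'))
  e := ⟨A.e, A.e_deriv M.act (liftAct A) (unit_act u) (o_liftAct A) (s_liftAct A)⟩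
  o_e := LieMod.hom_ext A.o_e
  s_e := LieMod.hom_ext A.s_e
  s_s_e := LieMod.hom_ext A.s_s_e
  e_comp φ f hφ hf := LieMod.hom_ext (A.e_comp φ.f f.f (congrArg LieMod.Hom.f hφ)
    (congrArg LieMod.Hom.f hf))
  e_deriv δ₀ δ hu ho hs := LieMod.hom_ext (A.e_deriv δ₀.f δ.f (congrArg LieMod.Hom.f hu)
    (congrArg LieMod.Hom.f ho) (congrArg LieMod.Hom.f hs))

end Lift

end SymTensor

end SymmetrizedTensor

/-! ### Symmetrizers of tensor powers. -/

/-- The identity behind the recursion for symmetrizers: `s` and `t` are neighbouring transpositions,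
`E'` and `E` consecutive symmetrizers. -/
theorem symmetrizer_step {R : Type*} [Ring R] {E E' s t : R} (k : ℕ)
    (hE : (k + 1) • E = E' + k • (E' * t * E')) (h₁ : E' * E = E) (h₂ : E * E' = E)
    (h₃ : t * E = E) (h₄ : E * t = E) (h₅ : s * E' = E' * s) (h₆ : s * s = 1)
    (h₇ : s * t * s = t * s * t) :
    s * (E + (k + 1) • (E * s * E)) = E + (k + 1) • (E * s * E) ∧
      (E + (k + 1) • (E * s * E)) * s = E + (k + 1) • (E * s * E) := by
  -- Expanding only the left factor E by `hE` yields sE and E'tsE. Left multiplication by s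
  -- exchanges E and sE, and fixes E'tsE by the braid relation together with tE = E. `a₂` is the
  -- mirror image.
  have a₁ : (k + 1) • (E * s * E) = s * E + k • (E' * t * s * E) := by
    have h : E' * s * E = s * E := by rw [← h₅, mul_assoc, h₁]
    have h' : E' * t * E' * s * E = E' * t * s * E := by
      rw [mul_assoc _ E' s, ← h₅, ← mul_assoc, mul_assoc _ E' E, h₁]
    rw [← smul_mul_assoc, ← smul_mul_assoc, hE, add_mul, add_mul, smul_mul_assoc, smul_mul_assoc,
      h, h']
  have a₂ : (k + 1) • (E * s * E) = E * s + k • (E * s * t * E') := by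
    have h : E * s * E' = E * s := by rw [mul_assoc, h₅, ← mul_assoc, h₂]
    have h' : E * s * (E' * t * E') = E * s * t * E' := by
      rw [← mul_assoc, ← mul_assoc, h]
    rw [← mul_smul_comm, hE, mul_add, mul_smul_comm, h, h']
  constructor
  · have h : s * (E' * t * s * E) = E' * t * s * E := by
      rw [← mul_assoc, ← mul_assoc, ← mul_assoc, h₅, mul_assoc E' s t, mul_assoc E' _ s, h₇,
        ← mul_assoc, ← mul_assoc, mul_assoc _ t E, h₃]
    rw [a₁, mul_add, mul_add, mul_smul_comm, h, ← mul_assoc, h₆, one_mul]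
    abel
  · have h : E * s * t * E' * s = E * s * t * E' := by
      rw [mul_assoc _ E' s, ← h₅, ← mul_assoc, mul_assoc E s t, mul_assoc E _ s, h₇, ← mul_assoc,
        ← mul_assoc, h₄, ← mul_assoc]
    rw [a₂, add_mul, add_mul, smul_mul_assoc, h, mul_assoc, h₆, mul_one]
    abel

section TensorPowers

variable {C : Type u} [Category.{v} C] [MonoidalCategory C] [SymmetricCategory C]

/-- The exchange of the last two factors. -/
def swapRight (A N : C) : (A ⊗ N) ⊗ N ⟶ (A ⊗ N) ⊗ N :=
  (α_ A N N).hom ≫ A ◁ (β_ N N).hom ≫ (α_ A N N).inv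

theorem swapRight_swapRight (A N : C) : swapRight A N ≫ swapRight A N = 𝟙 _ := by
  simp only [swapRight, Category.assoc, Iso.inv_hom_id_assoc, ← whiskerLeft_comp_assoc,
    SymmetricCategory.symmetry]
  simp

theorem swapRight_naturality {A B : C} (f : A ⟶ B) (N : C) :
    f ▷ N ▷ N ≫ swapRight B N = swapRight A N ≫ f ▷ N ▷ N := by
  simp only [swapRight, Category.assoc, associator_naturality_left_assoc,
    ← whisker_exchange_assoc]
  simp

theorem swapRight_naturality_right (A : C) {N K : C} (f : N ⟶ K) :
    ((A ◁ f) ▷ N ≫ (A ⊗ K) ◁ f) ≫ swapRight A K = swapRight A N ≫ (A ◁ f) ▷ N ≫ (A ⊗ K) ◁ f := by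
  have h : (f ▷ N ≫ K ◁ f) ≫ (β_ K K).hom = (β_ N N).hom ≫ f ▷ N ≫ K ◁ f := by
    simp [whisker_exchange]
  have h' := congrArg (fun t => A ◁ t ≫ (α_ A K K).inv) h
  simp only [whiskerLeft_comp, Category.assoc] at h'
  simp only [swapRight, Category.assoc, associator_naturality_middle_assoc,
    associator_naturality_right_assoc, h']
  simp

theorem whiskerLeft_unit_swapRight (A : C) {M : C} (u : 𝟙_ C ⟶ M) :
    (A ⊗ M) ◁ u ≫ swapRight A M = (ρ_ _).hom ≫ (ρ_ A).inv ▷ M ≫ (A ◁ u) ▷ M := by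
  simp only [swapRight, associator_naturality_right_assoc, ← whiskerLeft_comp_assoc,
    BraidedCategory.braiding_naturality_right]
  simp

theorem whiskerRight_unit_swapRight (A : C) {M : C} (u : 𝟙_ C ⟶ M) :
    (A ◁ u) ▷ M ≫ swapRight A M = (ρ_ A).hom ▷ M ≫ (ρ_ _).inv ≫ (A ⊗ M) ◁ u := by
  simp only [swapRight, associator_naturality_middle_assoc, ← whiskerLeft_comp_assoc,
    BraidedCategory.braiding_naturality_left]
  simp

theorem swapRight_braid (A N : C) :
    swapRight (A ⊗ N) N ≫ swapRight A N ▷ N ≫ swapRight (A ⊗ N) N =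
      swapRight A N ▷ N ≫ swapRight (A ⊗ N) N ≫ swapRight A N ▷ N := by
  have h := congrArg (fun t : N ⊗ N ⊗ N ⟶ N ⊗ N ⊗ N => (α_ A N N).hom ▷ N ≫
    (α_ A (N ⊗ N) N).hom ≫ A ◁ (α_ N N N).hom ≫ A ◁ t ≫ A ◁ (α_ N N N).inv ≫
    (α_ A (N ⊗ N) N).inv ≫ (α_ A N N).inv ▷ N) (BraidedCategory.yang_baxter N N N)
  simp [swapRight] at h ⊢
  first | exact h | exact h.symm

/-- The tensor powers of an object. -/
@[reducible] def tensorPow (N : C) : ℕ → C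
  | 0 => 𝟙_ C
  | n + 1 => tensorPow N n ⊗ N

variable [Preadditive C] [MonoidalPreadditive C] [Linear ℚ C]

/-- The symmetrizer of a tensor power. -/
def symmetrizer (N : C) : (n : ℕ) → (tensorPow N n ⟶ tensorPow N n)
  | 0 => 𝟙 _
  | 1 => 𝟙 _
  -- The symmetric group on n + 2 letters is the disjoint union of the subgroup on n + 1 letters and
  -- its double coset through the last transposition, which is n + 1 times as large; the terms are
  -- the two averages. Length 1 is separate because the transposition needs two factors.
  | n + 2 => ((n + 2 : ℕ) : ℚ)⁻¹ • (symmetrizer N (n + 1) ▷ N +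
      (n + 1) • (symmetrizer N (n + 1) ▷ N ≫ swapRight (tensorPow N n) N ≫
        symmetrizer N (n + 1) ▷ N))

theorem symmetrizer_succ (N : C) (n : ℕ) :
    (n + 2) • symmetrizer N (n + 2) = (symmetrizer N (n + 1) ▷ N +
      (n + 1) • (symmetrizer N (n + 1) ▷ N ≫ swapRight (tensorPow N n) N ≫
        symmetrizer N (n + 1) ▷ N)) := by
  rw [symmetrizer, ← Nat.cast_smul_eq_nsmul ℚ (n + 2), smul_smul, mul_inv_cancel₀, one_smul]
  positivity

theorem hom_nsmul_cancel {X Y : C} {f g : X ⟶ Y} {n : ℕ} (hn : n ≠ 0) (h : n • f = n • g) :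
    f = g := by
  rw [← Nat.cast_smul_eq_nsmul ℚ, ← Nat.cast_smul_eq_nsmul ℚ n g] at h
  exact smul_right_injective _ (Nat.cast_ne_zero.2 hn : (n : ℚ) ≠ 0) h

theorem symmetrizer_absorb_aux (N : C) {n : ℕ}
    (h : symmetrizer N (n + 1) ≫ symmetrizer N (n + 1) = symmetrizer N (n + 1)) :
    symmetrizer N (n + 1) ▷ N ≫ symmetrizer N (n + 2) = symmetrizer N (n + 2) ∧
      symmetrizer N (n + 2) ≫ symmetrizer N (n + 1) ▷ N = symmetrizer N (n + 2) := by
  have hE : symmetrizer N (n + 1) ▷ N ≫ symmetrizer N (n + 1) ▷ N = symmetrizer N (n + 1) ▷ N := by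
    rw [← comp_whiskerRight, h]
  constructor <;> apply hom_nsmul_cancel (n := n + 2) (by positivity)
  · rw [← Preadditive.comp_nsmul, symmetrizer_succ]
    simp only [Preadditive.comp_add, Preadditive.comp_nsmul, reassoc_of% hE, hE]
  · rw [← Preadditive.nsmul_comp, symmetrizer_succ]
    simp only [Preadditive.add_comp, Preadditive.nsmul_comp, Category.assoc, hE]

/-- The claims need one another: absorption of the smaller symmetrizer needs idempotency,
idempotency in the next degree needs absorption and invariance, and invariance one degree higher is
`symmetrizer_step`. -/
theorem symmetrizer_swap_aux (N : C) (n : ℕ) :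
    symmetrizer N (n + 1) ≫ symmetrizer N (n + 1) = symmetrizer N (n + 1) ∧
    swapRight (tensorPow N n) N ≫ symmetrizer N (n + 2) = symmetrizer N (n + 2) ∧
    symmetrizer N (n + 2) ≫ swapRight (tensorPow N n) N = symmetrizer N (n + 2) := by
  induction n with
  | zero =>
    refine ⟨Category.id_comp _, ?_, ?_⟩ <;> apply hom_nsmul_cancel (n := 2) (by positivity)
    · rw [← Preadditive.comp_nsmul, symmetrizer_succ N 0]
      simp [symmetrizer, swapRight_swapRight, add_comm]
    · rw [← Preadditive.nsmul_comp, symmetrizer_succ N 0]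
      simp [symmetrizer, swapRight_swapRight, add_comm]
  | succ n ih =>
    obtain ⟨h₁, h₂, h₃⟩ := ih
    obtain ⟨h₄, h₅⟩ := symmetrizer_absorb_aux N h₁
    have hid : symmetrizer N (n + 2) ≫ symmetrizer N (n + 2) = symmetrizer N (n + 2) := by
      apply hom_nsmul_cancel (n := n + 2) (by positivity)
      rw [← Preadditive.nsmul_comp]
      nth_rewrite 1 [symmetrizer_succ N n]
      simp only [Preadditive.add_comp, Preadditive.nsmul_comp, Category.assoc, h₄, h₂]
      simp only [add_smul, one_smul, two_smul]
      abel
    -- The product of `End` composes in the order opposite to `≫`, so left and right absorption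
    -- trade places in the arguments and in the conclusion.
    have key := symmetrizer_step (R := End ((tensorPow N (n + 1) ⊗ N) ⊗ N))
      (E := symmetrizer N (n + 2) ▷ N) (E' := symmetrizer N (n + 1) ▷ N ▷ N)
      (s := swapRight (tensorPow N (n + 1)) N) (t := swapRight (tensorPow N n) N ▷ N) (n + 1)
      (by
        have h := congrArg (fun t => t ▷ N) (symmetrizer_succ N n)
        simp only [MonoidalPreadditive.add_whiskerRight] at h
        have hn {X Y : C} (k : ℕ) (f : X ⟶ Y) : (k • f) ▷ N = k • (f ▷ N) :=
          (tensorRight N).map_nsmul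
        simp only [hn, comp_whiskerRight] at h
        simp only [End.mul_def]
        exact h)
      (by rw [End.mul_def, ← comp_whiskerRight, h₅])
      (by rw [End.mul_def, ← comp_whiskerRight, h₄])
      (by rw [End.mul_def, ← comp_whiskerRight, h₃])
      (by rw [End.mul_def, ← comp_whiskerRight, h₂])
      (swapRight_naturality (symmetrizer N (n + 1)) N)
      (swapRight_swapRight _ _)
      (swapRight_braid _ _)
    rw [End.mul_def, End.mul_def, End.mul_def, End.mul_def, ← symmetrizer_succ N (n + 1)] at key
    refine ⟨hid, ?_, ?_⟩ <;> apply hom_nsmul_cancel (n := n + 3) (by positivity)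
    · rw [← Preadditive.comp_nsmul]
      exact key.2
    · rw [← Preadditive.nsmul_comp]
      exact key.1

theorem symmetrizer_idem (N : C) (n : ℕ) :
    symmetrizer N n ≫ symmetrizer N n = symmetrizer N n := by
  cases n with
  | zero => exact Category.id_comp _
  | succ n => exact (symmetrizer_swap_aux N n).1

theorem whiskerRight_symmetrizer (N : C) (n : ℕ) :
    symmetrizer N n ▷ N ≫ symmetrizer N (n + 1) = symmetrizer N (n + 1) := by
  cases n with
  | zero => simp [symmetrizer]
  | succ n => exact (symmetrizer_absorb_aux N (symmetrizer_idem N (n + 1))).1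

theorem symmetrizer_whiskerRight (N : C) (n : ℕ) :
    symmetrizer N (n + 1) ≫ symmetrizer N n ▷ N = symmetrizer N (n + 1) := by
  cases n with
  | zero => simp [symmetrizer]
  | succ n => exact (symmetrizer_absorb_aux N (symmetrizer_idem N (n + 1))).2

theorem swapRight_symmetrizer (N : C) (n : ℕ) :
    swapRight (tensorPow N n) N ≫ symmetrizer N (n + 2) = symmetrizer N (n + 2) :=
  (symmetrizer_swap_aux N n).2.1

theorem symmetrizer_swapRight (N : C) (n : ℕ) :
    symmetrizer N (n + 2) ≫ swapRight (tensorPow N n) N = symmetrizer N (n + 2) :=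
  (symmetrizer_swap_aux N n).2.2

end TensorPowers

/-! ### Unital objects with a split unit. -/

section Splitting

variable {C : Type u} [Category.{v} C] [Preadditive C] [MonoidalCategory C]
  [MonoidalPreadditive C] [SymmetricCategory C]

/-- A decomposition of a unital object as `𝟙_ C ⊞ N`. -/
structure UnitSplitting {M : C} (u : 𝟙_ C ⟶ M) where
  N : C
  v : M ⟶ 𝟙_ C
  i : N ⟶ M
  q : M ⟶ N
  u_v : u ≫ v = 𝟙 _
  i_q : i ≫ q = 𝟙 _
  u_q : u ≫ q = 0
  i_v : i ≫ v = 0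
  total : v ≫ u + q ≫ i = 𝟙 _

namespace UnitSplitting

variable {M : C} {u : 𝟙_ C ⟶ M} (D : UnitSplitting u)

theorem hom_ext {A Z : C} {f g : A ⊗ M ⟶ Z} (hu : A ◁ u ≫ f = A ◁ u ≫ g)
    (hi : A ◁ D.i ≫ f = A ◁ D.i ≫ g) : f = g := by
  rw [← Category.id_comp f, ← Category.id_comp g, ← whiskerLeft_id, ← D.total,
    MonoidalPreadditive.whiskerLeft_add, Preadditive.add_comp, Preadditive.add_comp,
    whiskerLeft_comp, whiskerLeft_comp, Category.assoc, Category.assoc, Category.assoc,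
    Category.assoc, hu, hi]

theorem hom_ext' {X A Z : C} {f g : X ⊗ (A ⊗ M) ⟶ Z} (hu : X ◁ A ◁ u ≫ f = X ◁ A ◁ u ≫ g)
    (hi : X ◁ A ◁ D.i ≫ f = X ◁ A ◁ D.i ≫ g) : f = g := by
  rw [← cancel_epi (α_ _ _ _).hom]
  apply D.hom_ext
  · rw [associator_naturality_right_assoc, hu, associator_naturality_right_assoc]
  · rw [associator_naturality_right_assoc, hi, associator_naturality_right_assoc]

theorem hom_ext_whiskerRight {A B Z : C} {f g : (A ⊗ M) ⊗ B ⟶ Z}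
    (hu : (A ◁ u) ▷ B ≫ f = (A ◁ u) ▷ B ≫ g) (hi : (A ◁ D.i) ▷ B ≫ f = (A ◁ D.i) ▷ B ≫ g) :
    f = g := by
  rw [← cancel_epi (α_ A M B).inv, ← cancel_epi (A ◁ (β_ B M).hom), ← cancel_epi (α_ A B M).hom]
  have h {K : C} (k : K ⟶ M) (t : (A ⊗ M) ⊗ B ⟶ Z) :
      (A ⊗ B) ◁ k ≫ (α_ A B M).hom ≫ A ◁ (β_ B M).hom ≫ (α_ A M B).inv ≫ t =
        (α_ A B K).hom ≫ A ◁ (β_ B K).hom ≫ (α_ A K B).inv ≫ (A ◁ k) ▷ B ≫ t := by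
    rw [associator_naturality_right_assoc, ← whiskerLeft_comp_assoc,
      BraidedCategory.braiding_naturality_right, whiskerLeft_comp_assoc,
      associator_inv_naturality_middle_assoc]
  apply D.hom_ext
  · rw [h, h, hu]
  · rw [h, h, hi]

end UnitSplitting

end Splitting

/-! ### Construction of the reduced tensor algebra as a coproduct of tensor powers. -/

section TensorAlgebra

variable {C : Type u} [Category.{v} C] [Preadditive C] [MonoidalCategory C]
  [MonoidalPreadditive C] [SymmetricCategory C] [HasColimitsOfShape (Discrete ℕ) C]

/-- The underlying object of the tensor algebra. -/
def tensorSum (N : C) : C := ∐ tensorPow N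

/-- The inclusion of a tensor power. -/
def tensorι (N : C) (n : ℕ) : tensorPow N n ⟶ tensorSum N := Sigma.ι (tensorPow N) n

theorem tensorSum_ext {N Z : C} {f g : tensorSum N ⟶ Z}
    (h : ∀ n, tensorι N n ≫ f = tensorι N n ≫ g) : f = g := Sigma.hom_ext _ _ h

/-- A morphism out of the tensor algebra. -/
def tensorDesc {N Z : C} (g : ∀ n, tensorPow N n ⟶ Z) : tensorSum N ⟶ Z := Sigma.desc g

@[simp]
theorem tensorι_desc {N Z : C} (g : ∀ n, tensorPow N n ⟶ Z) (n : ℕ) :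
    tensorι N n ≫ tensorDesc g = g n := Sigma.ι_desc _ _

variable [∀ X : C, PreservesColimitsOfShape (Discrete ℕ) (tensorLeft X)]

/-- `X ⊗ -` of the tensor algebra is the coproduct of the `X ⊗ N^n`. -/
def isColimitWhiskerTensorι (X N : C) : IsColimit (Cofan.mk (X ⊗ tensorSum N)
    fun n => X ◁ tensorι N n : Cofan fun n => X ⊗ tensorPow N n) :=
  isColimitOfHasCoproductOfPreservesColimit (tensorLeft X) (tensorPow N)

theorem whisker_tensorSum_ext {X N Z : C} {f g : X ⊗ tensorSum N ⟶ Z}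
    (h : ∀ n, X ◁ tensorι N n ≫ f = X ◁ tensorι N n ≫ g) : f = g :=
  Cofan.IsColimit.hom_ext (isColimitWhiskerTensorι X N) _ _ h

/-- A morphism out of `X ⊗ -` of the tensor algebra. -/
def whiskerTensorDesc {X N Z : C} (g : ∀ n, X ⊗ tensorPow N n ⟶ Z) : X ⊗ tensorSum N ⟶ Z :=
  Cofan.IsColimit.desc (isColimitWhiskerTensorι X N) g

theorem whiskerTensorι_desc {X N Z : C} (g : ∀ n, X ⊗ tensorPow N n ⟶ Z) (n : ℕ) :
    X ◁ tensorι N n ≫ whiskerTensorDesc g = g n :=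
  Cofan.IsColimit.fac (isColimitWhiskerTensorι X N) g n

/-- Only left tensoring is assumed to preserve the coproduct; the braiding moves it to the other
side. -/
theorem tensorSum_whisker_ext {Y N Z : C} {f g : tensorSum N ⊗ Y ⟶ Z}
    (h : ∀ n, tensorι N n ▷ Y ≫ f = tensorι N n ▷ Y ≫ g) : f = g := by
  rw [← cancel_epi (β_ Y (tensorSum N)).hom]
  refine whisker_tensorSum_ext fun n => ?_
  rw [BraidedCategory.braiding_naturality_right_assoc,
    BraidedCategory.braiding_naturality_right_assoc, h]

theorem whisker_tensorSum_whisker_ext {X Y N Z : C} {f g : X ⊗ (tensorSum N ⊗ Y) ⟶ Z}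
    (h : ∀ n, X ◁ tensorι N n ▷ Y ≫ f = X ◁ tensorι N n ▷ Y ≫ g) : f = g := by
  rw [← cancel_epi (swapLeft (tensorSum N) X Y)]
  refine tensorSum_whisker_ext fun n => ?_
  rw [reassoc_of% (swapLeft_nat₁ (tensorι N n) X Y), h,
    reassoc_of% (swapLeft_nat₁ (tensorι N n) X Y)]

theorem tensorSum_whisker_whisker_ext {Y W N Z : C} {f g : (tensorSum N ⊗ Y) ⊗ W ⟶ Z}
    (h : ∀ n, tensorι N n ▷ Y ▷ W ≫ f = tensorι N n ▷ Y ▷ W ≫ g) : f = g := by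
  rw [← cancel_epi (α_ _ _ _).inv]
  refine tensorSum_whisker_ext fun n => ?_
  rw [associator_inv_naturality_left_assoc, h, associator_inv_naturality_left_assoc]

/-- Appending a factor. -/
def tensorSnoc (N : C) : tensorSum N ⊗ N ⟶ tensorSum N :=
  (β_ (tensorSum N) N).hom ≫ whiskerTensorDesc fun n =>
    (β_ N (tensorPow N n)).hom ≫ tensorι N (n + 1)

theorem tensorι_snoc (N : C) (n : ℕ) : tensorι N n ▷ N ≫ tensorSnoc N = tensorι N (n + 1) := by
  rw [tensorSnoc, BraidedCategory.braiding_naturality_left_assoc, whiskerTensorι_desc]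
  simp

namespace UnitSplitting

variable {M : C} {u : 𝟙_ C ⟶ M} (D : UnitSplitting u)

/-- The right multiplication by elements of `M`. -/
def s : tensorSum D.N ⊗ M ⟶ tensorSum D.N :=
  tensorSum D.N ◁ D.v ≫ (ρ_ _).hom + tensorSum D.N ◁ D.q ≫ tensorSnoc D.N

theorem unit_s : tensorSum D.N ◁ u ≫ D.s = (ρ_ _).hom := by
  simp only [s, Preadditive.comp_add, ← whiskerLeft_comp_assoc, u_v, u_q]
  simp

theorem i_s : tensorSum D.N ◁ D.i ≫ D.s = tensorSnoc D.N := by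
  simp only [s, Preadditive.comp_add, ← whiskerLeft_comp_assoc, i_v, i_q]
  simp

variable {X Z : C} (f₀ : X ⟶ Z) (f : Z ⊗ M ⟶ Z) (G : X ⊗ (tensorSum D.N ⊗ M) ⟶ Z)

/-- The components of the morphism defined by recursion. -/
def recPow : (n : ℕ) → (X ⊗ tensorPow D.N n ⟶ Z)
  | 0 => (ρ_ X).hom ≫ f₀
  | n + 1 => (α_ _ _ _).inv ≫ recPow n ▷ D.N ≫ Z ◁ D.i ≫ f +
      X ◁ tensorι D.N n ▷ D.N ≫ X ◁ tensorSum D.N ◁ D.i ≫ G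

/-- On the summand N of M the recursion is the definition of `recPow`; on the summand I it reduces
to the consistency conditions `hf` and `hG`. -/
theorem exists_rec (hf : Z ◁ u ≫ f = (ρ_ Z).hom) (hG : X ◁ tensorSum D.N ◁ u ≫ G = 0) :
    ∃ r : X ⊗ tensorSum D.N ⟶ Z, X ◁ tensorι D.N 0 ≫ r = (ρ_ X).hom ≫ f₀ ∧
      X ◁ D.s ≫ r = (α_ X (tensorSum D.N) M).inv ≫ r ▷ M ≫ f + G := by
  refine ⟨whiskerTensorDesc (D.recPow f₀ f G), whiskerTensorι_desc _ 0, ?_⟩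
  set r := whiskerTensorDesc (D.recPow f₀ f G) with hr
  have h (n : ℕ) : X ◁ tensorι D.N n ≫ r = D.recPow f₀ f G n := whiskerTensorι_desc _ n
  apply D.hom_ext'
  · rw [Preadditive.comp_add, hG, ← whiskerLeft_comp_assoc, unit_s,
      associator_inv_naturality_right_assoc, whisker_exchange_assoc, hf]
    simp
  · refine whisker_tensorSum_whisker_ext fun n => ?_
    rw [← whiskerLeft_comp_assoc X (_ ◁ _), i_s, ← whiskerLeft_comp_assoc, tensorι_snoc, h, recPow,
      Preadditive.comp_add, Preadditive.comp_add, associator_inv_naturality_right_assoc,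
      associator_inv_naturality_middle_assoc, whisker_exchange_assoc, ← comp_whiskerRight_assoc,
      h]

theorem rec_unique {r r' : X ⊗ tensorSum D.N ⟶ Z}
    (h₀ : X ◁ tensorι D.N 0 ≫ r = X ◁ tensorι D.N 0 ≫ r')
    (h : X ◁ D.s ≫ r = (α_ X _ M).inv ≫ r ▷ M ≫ f + G)
    (h' : X ◁ D.s ≫ r' = (α_ X _ M).inv ≫ r' ▷ M ≫ f + G) : r = r' := by
  refine whisker_tensorSum_ext fun n => ?_
  induction n with
  | zero => exact h₀
  | succ n ih =>
    have e (t : X ⊗ tensorSum D.N ⟶ Z) (ht : X ◁ D.s ≫ t = (α_ X _ M).inv ≫ t ▷ M ≫ f + G) :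
        X ◁ tensorι D.N (n + 1) ≫ t = (α_ _ _ _).inv ≫ (X ◁ tensorι D.N n ≫ t) ▷ D.N ≫
          Z ◁ D.i ≫ f + X ◁ tensorι D.N n ▷ D.N ≫ X ◁ tensorSum D.N ◁ D.i ≫ G := by
      rw [← tensorι_snoc, ← i_s, whiskerLeft_comp, whiskerLeft_comp, Category.assoc,
        Category.assoc, ht, Preadditive.comp_add, Preadditive.comp_add,
        associator_inv_naturality_right_assoc, associator_inv_naturality_middle_assoc,
        whisker_exchange_assoc, ← comp_whiskerRight_assoc]
    rw [e r h, e r' h', ih]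

variable [Linear ℚ C]

/-- The symmetrization operator. -/
def e : tensorSum D.N ⟶ tensorSum D.N := tensorDesc fun n => symmetrizer D.N n ≫ tensorι D.N n

theorem ι_e (n : ℕ) : tensorι D.N n ≫ D.e = symmetrizer D.N n ≫ tensorι D.N n :=
  tensorι_desc _ n

theorem e_e : D.e ≫ D.e = D.e := by
  refine tensorSum_ext fun n => ?_
  rw [reassoc_of% D.ι_e, ι_e, ← Category.assoc, symmetrizer_idem]

/-- On the summand I this is idempotency of `e`; on N it is absorption of a symmetrizer by the next
one. -/
theorem s_e : D.s ≫ D.e = D.e ▷ M ≫ D.s ≫ D.e := by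
  apply D.hom_ext
  · rw [reassoc_of% D.unit_s, whisker_exchange_assoc, reassoc_of% D.unit_s,
      ← rightUnitor_naturality, ← comp_whiskerRight_assoc, e_e]
  · refine tensorSum_whisker_ext fun n => ?_
    rw [whisker_exchange_assoc, reassoc_of% D.i_s, ← comp_whiskerRight_assoc, ι_e, reassoc_of% (tensorι_snoc D.N n),
      comp_whiskerRight_assoc, reassoc_of% (tensorι_snoc D.N n), ι_e, ← Category.assoc (_ ▷ _),
      whiskerRight_symmetrizer]

/-- M ⊗ M is split by M = I ⊕ N in both factors. If one of them is the unit, both sides are a single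
multiplication; on N ⊗ N the symmetrizer absorbs the last transposition. -/
theorem s_s_e : (α_ _ M M).hom ≫ _ ◁ (β_ M M).hom ≫ (α_ _ M M).inv ≫ D.s ▷ M ≫ D.s ≫ D.e =
    D.s ▷ M ≫ D.s ≫ D.e := by
  have key : swapRight (tensorSum D.N) M ≫ D.s ▷ M ≫ D.s ≫ D.e = D.s ▷ M ≫ D.s ≫ D.e := by
    have h₁ : (tensorSum D.N ⊗ M) ◁ u ≫ D.s ▷ M ≫ D.s ≫ D.e = (ρ_ _).hom ≫ D.s ≫ D.e := by
      rw [whisker_exchange_assoc, reassoc_of% D.unit_s, rightUnitor_naturality_assoc]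
    have h₂ : (tensorSum D.N ◁ u) ▷ M ≫ D.s ▷ M ≫ D.s ≫ D.e = (ρ_ _).hom ▷ M ≫ D.s ≫ D.e := by
      rw [← comp_whiskerRight_assoc, unit_s]
    apply D.hom_ext
    · rw [reassoc_of% (whiskerLeft_unit_swapRight (tensorSum D.N) u), h₁, h₂]
      simp [← comp_whiskerRight_assoc]
    apply D.hom_ext_whiskerRight
    · rw [← whisker_exchange_assoc, ← whisker_exchange_assoc,
        reassoc_of% (whiskerRight_unit_swapRight (tensorSum D.N) u), h₁, h₂]
      simp
    · have h := reassoc_of% (swapRight_naturality_right (tensorSum D.N) D.i)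
      have h₃ : (tensorSum D.N ◁ D.i) ▷ D.N ≫ (tensorSum D.N ⊗ M) ◁ D.i ≫ D.s ▷ M ≫ D.s ≫ D.e =
          tensorSnoc D.N ▷ D.N ≫ tensorSnoc D.N ≫ D.e := by
        rw [whisker_exchange_assoc, reassoc_of% D.i_s, ← comp_whiskerRight_assoc, i_s]
      rw [h, h₃]
      refine tensorSum_whisker_whisker_ext fun n => ?_
      have h₄ : tensorι D.N n ▷ D.N ▷ D.N ≫ tensorSnoc D.N ▷ D.N ≫ tensorSnoc D.N ≫ D.e =
          symmetrizer D.N (n + 2) ≫ tensorι D.N (n + 2) := by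
        rw [← comp_whiskerRight_assoc, tensorι_snoc, reassoc_of% (tensorι_snoc D.N (n + 1)), ι_e]
      rw [reassoc_of% (swapRight_naturality (tensorι D.N n) D.N), h₄,
        reassoc_of% (swapRight_symmetrizer D.N n)]
  simpa only [swapRight, Category.assoc] using key

/-- By `hf`, `φ` is invariant under the transposition of the last two factors of each Nⁿ⁺². The
recursion for symmetrizers then gives invariance under all of them, the weights 1 and n + 1 adding
up to n + 2. -/
theorem e_comp {Z : C} (φ : tensorSum D.N ⟶ Z) (f : Z ⊗ M ⟶ Z) (hφ : D.s ≫ φ = φ ▷ M ≫ f)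
    (hf : (α_ Z M M).hom ≫ Z ◁ (β_ M M).hom ≫ (α_ Z M M).inv ≫ f ▷ M ≫ f = f ▷ M ≫ f) :
    D.e ≫ φ = φ := by
  have hs (n : ℕ) : tensorι D.N (n + 1) ≫ φ = (tensorι D.N n ≫ φ) ▷ D.N ≫ Z ◁ D.i ≫ f := by
    rw [← tensorι_snoc, ← i_s, Category.assoc, Category.assoc, hφ, whisker_exchange_assoc,
      comp_whiskerRight_assoc]
  have hswap (n : ℕ) : swapRight (tensorPow D.N n) D.N ≫ tensorι D.N (n + 2) ≫ φ =
      tensorι D.N (n + 2) ≫ φ := by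
    rw [hs, hs, comp_whiskerRight_assoc, comp_whiskerRight_assoc, ← whisker_exchange_assoc]
    have h := reassoc_of% (swapRight_naturality_right Z D.i)
    rw [← reassoc_of% (swapRight_naturality (tensorι D.N n ≫ φ) D.N), ← h]
    simp only [swapRight, Category.assoc, hf]
  have hn (n : ℕ) : symmetrizer D.N n ≫ tensorι D.N n ≫ φ = tensorι D.N n ≫ φ ∧
      symmetrizer D.N (n + 1) ≫ tensorι D.N (n + 1) ≫ φ = tensorι D.N (n + 1) ≫ φ := by
    induction n with
    | zero => exact ⟨Category.id_comp _, Category.id_comp _⟩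
    | succ n ih =>
      refine ⟨ih.2, hom_nsmul_cancel (n := n + 2) (by positivity) ?_⟩
      have hE : symmetrizer D.N (n + 1) ▷ D.N ≫ tensorι D.N (n + 2) ≫ φ =
          tensorι D.N (n + 2) ≫ φ := by
        rw [hs, ← comp_whiskerRight_assoc, ih.2]
      rw [← Preadditive.nsmul_comp, symmetrizer_succ]
      simp only [Preadditive.add_comp, Preadditive.nsmul_comp, Category.assoc, hE, hswap]
      simp only [add_smul, one_smul, two_smul]
      abel
  refine tensorSum_ext fun n => ?_
  rw [reassoc_of% D.ι_e, (hn n).1]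

end UnitSplitting

end TensorAlgebra

/-! ### Derivations commute with symmetrization. -/

section Derivations

variable {C : Type u} [Category.{v} C] [Preadditive C] [MonoidalCategory C]
  [MonoidalPreadditive C] [SymmetricCategory C]

theorem leibnizAct_swapRight {X A N : C} (d : X ⊗ A ⟶ A) (a : X ⊗ N ⟶ N) :
    X ◁ swapRight A N ≫ leibnizAct (leibnizAct d a) a =
      leibnizAct (leibnizAct d a) a ≫ swapRight A N := by
  have h₁ := leibnizAct_associator d a a
  have h₂ := leibnizAct_whiskerLeft d (leibnizAct a a) (leibnizAct a a) (β_ N N).hom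
    (leibnizAct_braiding a a)
  have h₃ : X ◁ (α_ A N N).inv ≫ leibnizAct (leibnizAct d a) a =
      leibnizAct d (leibnizAct a a) ≫ (α_ A N N).inv := by
    rw [← cancel_mono (α_ A N N).hom, Category.assoc, ← leibnizAct_associator]
    simp
  simp only [swapRight, whiskerLeft_comp, Category.assoc, h₃, reassoc_of% h₂, reassoc_of% h₁]

/-- The contraction of `X` with the last factor. -/
def contractLast {X N : C} (A : C) (c : X ⊗ N ⟶ 𝟙_ C) : X ⊗ (A ⊗ N) ⟶ A :=
  swapLeft X A N ≫ A ◁ c ≫ (ρ_ A).hom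

theorem contractLast_naturality {X N A B : C} (f : A ⟶ B) (c : X ⊗ N ⟶ 𝟙_ C) :
    X ◁ f ▷ N ≫ contractLast B c = contractLast A c ≫ f := by
  simp only [contractLast, reassoc_of% (swapLeft_nat₂ X f N), Category.assoc,
    ← whisker_exchange_assoc, rightUnitor_naturality]

/-- Moves a contraction from the last factor to the one before it; this drives both comparisons of
contractions with symmetrizers. -/
theorem swapRight_contractLast {X N : C} (A : C) (c : X ⊗ N ⟶ 𝟙_ C) :
    X ◁ swapRight A N ≫ contractLast (A ⊗ N) c = (α_ X (A ⊗ N) N).inv ≫ contractLast A c ▷ N := by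
  have h₁ := reassoc_of% (swapLeft_hex₂ X A N N)
  have h₂ := reassoc_of% (swapLeft_nat₃ X A (β_ N N).hom)
  have h₃ : X ◁ (β_ N N).hom ≫ swapLeft X N N ≫ N ◁ c ≫ (ρ_ N).hom =
      (α_ X N N).inv ≫ c ▷ N ≫ (λ_ N).hom := by
    have h := BraidedCategory.braiding_naturality_left c N
    have h' := congrArg (fun t => (α_ X N N).inv ≫ t ≫ (ρ_ N).hom) h
    simp at h'
    rw [h']
    simp [swapLeft]
  have h₄ : (α_ A N (X ⊗ N)).inv ≫ (A ⊗ N) ◁ c ≫ (ρ_ (A ⊗ N)).hom = A ◁ (N ◁ c ≫ (ρ_ N).hom) := by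
    simp
  simp only [swapRight, contractLast, whiskerLeft_comp, Category.assoc, h₁, h₂]
  rw [h₄, ← whiskerLeft_comp, ← whiskerLeft_comp, h₃]
  simp [swapLeft]

variable [Linear ℚ C]

theorem whiskerLeft_nsmul (X : C) {Y Z : C} (k : ℕ) (f : Y ⟶ Z) : X ◁ (k • f) = k • (X ◁ f) :=
  (tensorLeft X).map_nsmul

theorem nsmul_whiskerRight (X : C) {Y Z : C} (k : ℕ) (f : Y ⟶ Z) : (k • f) ▷ X = k • (f ▷ X) :=
  (tensorRight X).map_nsmul

section Components

variable {X N : C} (a : X ⊗ N ⟶ N) (c : X ⊗ N ⟶ 𝟙_ C)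

/-- The action on tensor powers by derivations of degree zero. -/
def powAct : (n : ℕ) → (X ⊗ tensorPow N n ⟶ tensorPow N n)
  | 0 => 0
  | n + 1 => leibnizAct (powAct n) a

/-- The contraction of tensor powers, the derivation of degree minus one. -/
def powContract : (n : ℕ) → (X ⊗ tensorPow N (n + 1) ⟶ tensorPow N n)
  | 0 => contractLast (𝟙_ C) c
  | n + 1 => (α_ _ _ _).inv ≫ powContract n ▷ N + contractLast (tensorPow N (n + 1)) c

theorem symmetrizer_powAct (n : ℕ) :
    X ◁ symmetrizer N n ≫ powAct a n = powAct a n ≫ symmetrizer N n ∧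
    X ◁ symmetrizer N (n + 1) ≫ powAct a (n + 1) = powAct a (n + 1) ≫ symmetrizer N (n + 1) := by
  induction n with
  | zero => simp [symmetrizer]
  | succ n ih =>
    refine ⟨ih.2, hom_nsmul_cancel (n := n + 2) (by positivity) ?_⟩
    have hE : X ◁ symmetrizer N (n + 1) ▷ N ≫ powAct a (n + 2) =
        powAct a (n + 2) ≫ symmetrizer N (n + 1) ▷ N :=
      leibnizAct_whiskerRight _ _ a _ ih.2
    have hs : X ◁ swapRight (tensorPow N n) N ≫ powAct a (n + 2) =
        powAct a (n + 2) ≫ swapRight (tensorPow N n) N := leibnizAct_swapRight (powAct a n) a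
    rw [← Preadditive.nsmul_comp, ← Preadditive.comp_nsmul, ← whiskerLeft_nsmul, symmetrizer_succ]
    simp only [MonoidalPreadditive.whiskerLeft_add, whiskerLeft_nsmul, whiskerLeft_comp,
      Preadditive.add_comp, Preadditive.comp_add, Preadditive.nsmul_comp, Preadditive.comp_nsmul,
      Category.assoc, hE, reassoc_of% hs, reassoc_of% hE]

theorem whiskerLeft_symmetrizer_succ_comp {Y : C} (n : ℕ) (f : X ⊗ tensorPow N (n + 2) ⟶ Y) :
    (n + 2) • (X ◁ symmetrizer N (n + 2) ≫ f) = X ◁ symmetrizer N (n + 1) ▷ N ≫ f +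
      (n + 1) • (X ◁ symmetrizer N (n + 1) ▷ N ≫ X ◁ swapRight (tensorPow N n) N ≫
        X ◁ symmetrizer N (n + 1) ▷ N ≫ f) := by
  rw [← Preadditive.nsmul_comp, ← whiskerLeft_nsmul, symmetrizer_succ]
  simp only [MonoidalPreadditive.whiskerLeft_add, whiskerLeft_nsmul, whiskerLeft_comp,
      Preadditive.add_comp, Preadditive.nsmul_comp, Category.assoc]

/-- The two recursions match term by term: the plain summand of the symmetrizer gives the
contraction of the last slot, and the double coset summand gives, by induction, those of the earlier
slots. -/
theorem powContract_symmetrizer (n : ℕ) : powContract c n ≫ symmetrizer N n =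
    (n + 1) • (X ◁ symmetrizer N (n + 1) ≫ contractLast (tensorPow N n) c) := by
  induction n with
  | zero => simp [powContract, symmetrizer]
  | succ n ih =>
    rw [whiskerLeft_symmetrizer_succ_comp, powContract, Preadditive.add_comp]
    refine (add_comm _ _).trans ?_
    congr 1
    · exact (contractLast_naturality (symmetrizer N (n + 1)) c).symm
    · have h := swapRight_contractLast (tensorPow N n) c
      rw [contractLast_naturality, reassoc_of% h, Category.assoc]
      conv_lhs => rw [← whiskerRight_symmetrizer]
      rw [← comp_whiskerRight_assoc, ih, nsmul_whiskerRight, Preadditive.nsmul_comp,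
        Preadditive.comp_nsmul, comp_whiskerRight_assoc,
        associator_inv_naturality_middle_assoc]

/-- A symmetrized tensor is invariant under transpositions, so each of its n + 1 slots contributes
the same as the last. With `powContract_symmetrizer`, contraction commutes with symmetrization. -/
theorem symmetrizer_powContract (n : ℕ) : X ◁ symmetrizer N (n + 1) ≫ powContract c n =
    (n + 1) • (X ◁ symmetrizer N (n + 1) ≫ contractLast (tensorPow N n) c) := by
  induction n with
  | zero => simp [powContract, symmetrizer]
  | succ n ih =>
    rw [powContract, Preadditive.comp_add, succ_nsmul]
    congr 1
    have h := swapRight_contractLast (tensorPow N n) c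
    have e₁ : X ◁ symmetrizer N (n + 2) = X ◁ symmetrizer N (n + 2) ≫
        X ◁ symmetrizer N (n + 1) ▷ N := by
      rw [← whiskerLeft_comp, symmetrizer_whiskerRight]
    nth_rewrite 1 [e₁]
    rw [Category.assoc, associator_inv_naturality_middle_assoc,
      ← comp_whiskerRight, ih, nsmul_whiskerRight, comp_whiskerRight, Preadditive.comp_nsmul,
      Preadditive.comp_nsmul, ← associator_inv_naturality_middle_assoc, ← h, ← whiskerLeft_comp_assoc,
      ← whiskerLeft_comp_assoc, symmetrizer_whiskerRight,
      symmetrizer_swapRight]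

end Components

variable [HasColimitsOfShape (Discrete ℕ) C]
  [∀ X : C, PreservesColimitsOfShape (Discrete ℕ) (tensorLeft X)]

namespace UnitSplitting

variable {M : C} {u : 𝟙_ C ⟶ M} (D : UnitSplitting u)

theorem e_deriv {X : C} (δ₀ : X ⊗ M ⟶ M) (δ : X ⊗ tensorSum D.N ⟶ tensorSum D.N)
    (ho : X ◁ tensorι D.N 0 ≫ δ = 0) (hs : X ◁ D.s ≫ δ = leibnizAct δ δ₀ ≫ D.s) :
    X ◁ D.e ≫ δ = δ ≫ D.e := by
  set a := X ◁ D.i ≫ δ₀ ≫ D.q with ha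
  set c := X ◁ D.i ≫ δ₀ ≫ D.v with hc
  have hδ₀ : X ◁ D.i ≫ δ₀ = c ≫ u + a ≫ D.i := by
    rw [ha, hc, Category.assoc, Category.assoc, Category.assoc, Category.assoc,
      ← Preadditive.comp_add, ← Preadditive.comp_add, D.total, Category.comp_id]
  -- As `δ₀` on N is c·u + a and the unit acts as 1, the part c lowers the degree by one and becomes
  -- the contraction, while a preserves the degree.
  have hι (n : ℕ) : X ◁ tensorι D.N (n + 1) ≫ δ =
      powAct a (n + 1) ≫ tensorι D.N (n + 1) + powContract c n ≫ tensorι D.N n := by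
    have step (n : ℕ) : X ◁ tensorι D.N (n + 1) ≫ δ =
        (α_ _ _ _).inv ≫ (X ◁ tensorι D.N n ≫ δ) ▷ D.N ≫ tensorSnoc D.N +
          (contractLast (tensorPow D.N n) c ≫ tensorι D.N n +
            swapLeft X (tensorPow D.N n) D.N ≫ tensorPow D.N n ◁ a ≫ tensorι D.N (n + 1)) := by
      rw [← tensorι_snoc, ← D.i_s, whiskerLeft_comp, whiskerLeft_comp, Category.assoc,
        Category.assoc, hs, leibnizAct, Preadditive.add_comp, Preadditive.comp_add,
        Preadditive.comp_add]
      congr 1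
      · simp only [Category.assoc, associator_inv_naturality_right_assoc, whisker_exchange_assoc,
          associator_inv_naturality_middle_assoc, comp_whiskerRight]
      · simp only [Category.assoc, reassoc_of% (swapLeft_nat₃ X (tensorSum D.N) D.i),
          ← whiskerLeft_comp_assoc, hδ₀, reassoc_of% (swapLeft_nat₂ X (tensorι D.N n) D.N)]
        rw [← whisker_exchange_assoc, MonoidalPreadditive.whiskerLeft_add, Preadditive.add_comp,
          Preadditive.comp_add]
        congr 1
        · rw [whiskerLeft_comp_assoc, whisker_exchange_assoc, D.unit_s, rightUnitor_naturality]
          simp [contractLast]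
        · rw [whiskerLeft_comp_assoc, whisker_exchange_assoc, D.i_s, tensorι_snoc]
    induction n with
    | zero =>
      rw [step 0, ho]
      simp [powAct, powContract, leibnizAct]
      abel
    | succ n ih =>
      rw [step (n + 1), ih]
      simp [powAct, powContract, leibnizAct, MonoidalPreadditive.add_whiskerRight, tensorι_snoc]
      abel
  refine whisker_tensorSum_ext fun n => ?_
  cases n with
  | zero =>
    have h : tensorι D.N 0 ≫ D.e = tensorι D.N 0 := by rw [ι_e]; exact Category.id_comp _
    rw [← whiskerLeft_comp_assoc, h, ho, reassoc_of% ho, zero_comp]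
  | succ n =>
    rw [← whiskerLeft_comp_assoc, ι_e, whiskerLeft_comp_assoc, reassoc_of% (hι n), hι]
    simp only [Preadditive.comp_add, Preadditive.add_comp, Category.assoc, ι_e]
    have h := (symmetrizer_powContract c n).trans (powContract_symmetrizer c n).symm
    rw [← reassoc_of% (symmetrizer_powAct a n).2, reassoc_of% h]

/-- The reduced tensor algebra of a split unital object. -/
def symTensor : SymTensor u where
  T := tensorSum D.N
  o := tensorι D.N 0
  s := D.s
  s_unit := D.unit_s
  exists_rec := D.exists_rec
  rec_unique := D.rec_unique
  e := D.e
  o_e := (D.ι_e 0).trans (Category.id_comp _)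
  s_e := D.s_e
  s_s_e := D.s_s_e
  e_comp := D.e_comp
  e_deriv δ₀ δ _ ho hs := D.e_deriv δ₀ δ ho hs

end UnitSplitting

end Derivations

/-! ### The algebra structure, its universal property, and symmetrization of products. -/

section FreeAlgebras

variable {C : Type u} [Category.{v} C] [Preadditive C] [MonoidalCategory C]
  [MonoidalPreadditive C] [SymmetricCategory C]

namespace SymTensor

variable {M : C} {u : 𝟙_ C ⟶ M} (A : SymTensor u)

theorem ext_of_rec {X Z : C} (f : Z ⊗ M ⟶ Z) {r r' : X ⊗ A.T ⟶ Z}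
    (h₀ : X ◁ A.o ≫ r = X ◁ A.o ≫ r') (h : X ◁ A.s ≫ r = (α_ X A.T M).inv ≫ r ▷ M ≫ f)
    (h' : X ◁ A.s ≫ r' = (α_ X A.T M).inv ≫ r' ▷ M ≫ f) : r = r' :=
  A.rec_unique f 0 h₀ (by rw [h, add_zero]) (by rw [h', add_zero])

theorem hom_ext_of_rec {Z : C} (f : Z ⊗ M ⟶ Z) {r r' : A.T ⟶ Z}
    (h₀ : A.o ≫ r = A.o ≫ r') (h : A.s ≫ r = r ▷ M ≫ f)
    (h' : A.s ≫ r' = r' ▷ M ≫ f) : r = r' := by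
  rw [← cancel_epi (λ_ A.T).hom]
  refine A.ext_of_rec f ?_ ?_ ?_
  · rw [leftUnitor_naturality_assoc, leftUnitor_naturality_assoc, h₀]
  · rw [leftUnitor_naturality_assoc, h]
    simp
  · rw [leftUnitor_naturality_assoc, h']
    simp

theorem exists_rec₀ {X Z : C} (f₀ : X ⟶ Z) (f : Z ⊗ M ⟶ Z) (hf : Z ◁ u ≫ f = (ρ_ Z).hom) :
    ∃ r : X ⊗ A.T ⟶ Z, X ◁ A.o ≫ r = (ρ_ X).hom ≫ f₀ ∧
      X ◁ A.s ≫ r = (α_ X A.T M).inv ≫ r ▷ M ≫ f := by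
  simpa using A.exists_rec f₀ f 0 hf comp_zero

/-- The product of the reduced tensor algebra. -/
def mul : A.T ⊗ A.T ⟶ A.T := (A.exists_rec₀ (𝟙 A.T) A.s A.s_unit).choose

theorem o_mul : A.T ◁ A.o ≫ A.mul = (ρ_ A.T).hom :=
  (A.exists_rec₀ (𝟙 A.T) A.s A.s_unit).choose_spec.1.trans (Category.comp_id _)

theorem s_mul : A.T ◁ A.s ≫ A.mul = (α_ A.T A.T M).inv ≫ A.mul ▷ M ≫ A.s :=
  (A.exists_rec₀ (𝟙 A.T) A.s A.s_unit).choose_spec.2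

/-- The product continues right multiplication by generators recursively in its second argument. As
functions of the last factor, both sides of the left unit law and of associativity solve the
recursion given by `s`. -/
instance monObj : MonObj A.T where
  one := A.o
  mul := A.mul
  one_mul := by
    refine A.ext_of_rec A.s ?_ ?_ ?_
    · rw [whisker_exchange_assoc, o_mul]
      simp [unitors_equal]
    · rw [whisker_exchange_assoc, s_mul, associator_inv_naturality_left_assoc,
        comp_whiskerRight_assoc]
    · simp
  mul_one := A.o_mul
  mul_assoc := by
    refine A.ext_of_rec A.s ?_ ?_ ?_
    · rw [whisker_exchange_assoc, o_mul, associator_naturality_right_assoc, ← whiskerLeft_comp_assoc,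
        o_mul]
      simp
    · rw [whisker_exchange_assoc, s_mul, associator_inv_naturality_left_assoc,
        comp_whiskerRight_assoc]
    · rw [associator_naturality_right_assoc, ← whiskerLeft_comp_assoc, s_mul]
      simp only [whiskerLeft_comp, Category.assoc, s_mul, comp_whiskerRight]
      simp

theorem mul_def : μ[A.T] = A.mul := rfl

theorem one_def : η[A.T] = A.o := rfl

/-- The inclusion of the generators. -/
def j : M ⟶ A.T := (λ_ M).inv ≫ A.o ▷ M ≫ A.s

theorem u_j : u ≫ A.j = A.o := by
  rw [j, leftUnitor_inv_naturality_assoc, whisker_exchange_assoc, s_unit, rightUnitor_naturality,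
    unitors_inv_equal, Iso.inv_hom_id_assoc]

theorem j_mul : A.T ◁ A.j ≫ A.mul = A.s := by
  simp only [j, whiskerLeft_comp, Category.assoc, s_mul, associator_inv_naturality_middle_assoc,
    ← comp_whiskerRight_assoc, o_mul]
  simp

section Lift

variable {B : C} [MonObj B]

theorem s_monHom (φ : A.T ⟶ B) [IsMonHom φ] : A.s ≫ φ = φ ▷ M ≫ B ◁ (A.j ≫ φ) ≫ μ[B] := by
  rw [← j_mul, Category.assoc, ← mul_def, IsMonHom.mul_hom, MonoidalCategory.tensorHom_def,
    Category.assoc, whisker_exchange_assoc, ← whiskerLeft_comp_assoc]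

theorem monHom_ext {φ ψ : A.T ⟶ B} [IsMonHom φ] [IsMonHom ψ] (h : A.j ≫ φ = A.j ≫ ψ) : φ = ψ := by
  refine A.hom_ext_of_rec _ ?_ (A.s_monHom φ) (h ▸ A.s_monHom ψ)
  rw [← one_def, IsMonHom.one_hom, IsMonHom.one_hom]

/-- The extension is defined by successive right multiplication by φ(m). It is multiplicative
because ψ(xy) and ψ(x)ψ(y) solve the same recursion in y. -/
theorem exists_liftMon (φ : M ⟶ B) (hφ : u ≫ φ = η[B]) :
    ∃ ψ : A.T ⟶ B, IsMonHom ψ ∧ A.j ≫ ψ = φ := by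
  have hf : B ◁ u ≫ B ◁ φ ≫ μ[B] = (ρ_ B).hom := by
    rw [← whiskerLeft_comp_assoc, hφ, MonObj.mul_one]
  obtain ⟨r, h₁, h₂⟩ := A.exists_rec₀ η[B] (B ◁ φ ≫ μ[B]) hf
  obtain ⟨ψ, hψ⟩ : ∃ ψ, ψ = (λ_ A.T).inv ≫ r := ⟨_, rfl⟩
  have ho : A.o ≫ ψ = η[B] := by
    rw [hψ, leftUnitor_inv_naturality_assoc, h₁, unitors_inv_equal, Iso.inv_hom_id_assoc]
  have hs : A.s ≫ ψ = ψ ▷ M ≫ B ◁ φ ≫ μ[B] := by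
    rw [hψ, leftUnitor_inv_naturality_assoc, h₂]
    simp
  refine ⟨ψ, ⟨ho, ?_⟩, ?_⟩
  · rw [mul_def]
    refine A.ext_of_rec (B ◁ φ ≫ μ[B]) ?_ ?_ ?_
    · rw [reassoc_of% A.o_mul, MonoidalCategory.tensorHom_def', Category.assoc,
        ← whiskerLeft_comp_assoc, ho, whisker_exchange_assoc, MonObj.mul_one,
        rightUnitor_naturality]
    · rw [reassoc_of% A.s_mul, hs, comp_whiskerRight_assoc]
    · rw [MonoidalCategory.tensorHom_def, Category.assoc, whisker_exchange_assoc,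
        ← whiskerLeft_comp_assoc, hs]
      simp only [comp_whiskerRight, Category.assoc]
      rw [← whisker_exchange_assoc μ[B]]
      simp
  · rw [j, Category.assoc, Category.assoc, hs, ← comp_whiskerRight_assoc, ho,
      ← whisker_exchange_assoc, MonObj.one_mul]
    simp

end Lift

/-- `e` itself satisfies the hypotheses of `e_comp`, with right multiplication followed by `e`. -/
theorem e_e : A.e ≫ A.e = A.e := by
  refine A.e_comp A.e (A.s ≫ A.e) A.s_e ?_
  simp only [comp_whiskerRight, Category.assoc, ← A.s_e, A.s_s_e]

theorem mul_e : A.mul ≫ A.e = A.e ▷ A.T ≫ A.mul ≫ A.e := by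
  refine A.ext_of_rec (A.s ≫ A.e) ?_ ?_ ?_
  · rw [reassoc_of% A.o_mul, whisker_exchange_assoc, reassoc_of% A.o_mul, rightUnitor_naturality_assoc,
      e_e]
  · rw [reassoc_of% A.s_mul, comp_whiskerRight_assoc, ← A.s_e]
  · rw [whisker_exchange_assoc, reassoc_of% A.s_mul, associator_inv_naturality_left_assoc,
      comp_whiskerRight_assoc, comp_whiskerRight_assoc, ← A.s_e]

/-- A generator m can be moved past y under `e`: (tm)y and (ty)m have the same image. The induction
on y moves m past one generator at a time by `s_s_e`. -/
theorem s_mul_e : A.s ▷ A.T ≫ A.mul ≫ A.e =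
    (α_ _ _ _).hom ≫ A.T ◁ (β_ M A.T).hom ≫ (α_ _ _ _).inv ≫ A.mul ▷ M ≫ A.s ≫ A.e := by
  refine A.ext_of_rec (A.s ≫ A.e) ?_ ?_ ?_
  · rw [whisker_exchange_assoc, reassoc_of% A.o_mul, associator_naturality_right_assoc,
      ← whiskerLeft_comp_assoc, BraidedCategory.braiding_naturality_right, whiskerLeft_comp_assoc,
      associator_inv_naturality_middle_assoc, ← comp_whiskerRight_assoc, o_mul]
    simp
  · rw [whisker_exchange_assoc, reassoc_of% A.s_mul, associator_inv_naturality_left_assoc,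
      comp_whiskerRight_assoc, comp_whiskerRight_assoc, ← A.s_e]
  · have hF : swapRight A.T M ≫ A.s ▷ M ≫ A.s ≫ A.e = A.s ▷ M ≫ A.s ≫ A.e := by
      simpa only [swapRight, Category.assoc] using A.s_s_e
    have h₁ : (A.T ⊗ M) ◁ A.s ≫ (α_ _ _ _).hom ≫ A.T ◁ (β_ M A.T).hom ≫ (α_ _ _ _).inv ≫
        A.mul ▷ M ≫ A.s ≫ A.e = (α_ _ _ _).hom ≫ A.T ◁ (β_ M (A.T ⊗ M)).hom ≫ (α_ _ _ _).inv ≫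
          (α_ _ _ _).inv ▷ M ≫ A.mul ▷ M ▷ M ≫ A.s ▷ M ≫ A.s ≫ A.e := by
      rw [associator_naturality_right_assoc, ← whiskerLeft_comp_assoc,
        BraidedCategory.braiding_naturality_right, whiskerLeft_comp_assoc,
        associator_inv_naturality_middle_assoc, ← comp_whiskerRight_assoc, s_mul]
      simp only [comp_whiskerRight, Category.assoc]
    rw [h₁]
    conv_rhs =>
      simp only [comp_whiskerRight, Category.assoc, ← A.s_e]
      rw [← hF, reassoc_of% (swapRight_naturality A.mul M)]
    simp [swapRight, BraidedCategory.braiding_tensor_right_hom]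

/-- The commutators lie in the kernel of `e`. By `s_mul_e`, both sides satisfy the same recursion in
the second factor. -/
theorem braiding_mul_e : (β_ A.T A.T).hom ≫ A.mul ≫ A.e = A.mul ≫ A.e := by
  refine A.ext_of_rec (A.s ≫ A.e) ?_ ?_ ?_
  · rw [BraidedCategory.braiding_naturality_right_assoc, ← mul_def, ← one_def,
      MonObj.one_mul_assoc, MonObj.mul_one_assoc]
    simp
  · rw [BraidedCategory.braiding_naturality_right_assoc, s_mul_e, comp_whiskerRight_assoc,
      comp_whiskerRight_assoc, ← A.s_e]
    simp [BraidedCategory.braiding_tensor_right_hom, ← whiskerLeft_comp_assoc]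
  · rw [reassoc_of% A.s_mul, comp_whiskerRight_assoc, ← A.s_e]

theorem mul_e' : A.mul ≫ A.e = A.T ◁ A.e ≫ A.mul ≫ A.e := by
  rw [← braiding_mul_e, BraidedCategory.braiding_naturality_right_assoc, ← mul_e]

theorem mul_e_e : A.mul ≫ A.e = (A.e ⊗ₘ A.e) ≫ A.mul ≫ A.e := by
  rw [MonoidalCategory.tensorHom_def, Category.assoc, ← mul_e', ← mul_e]

/-- Right multiplications in a commutative algebra commute, which is the hypothesis of `e_comp`. -/
theorem e_monHom {B : C} [MonObj B] [IsCommMonObj B] (φ : A.T ⟶ B) [IsMonHom φ] : A.e ≫ φ = φ := by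
  refine A.e_comp φ _ (A.s_monHom φ) ?_
  have h (f : M ⟶ B) : (B ◁ f ≫ μ[B]) ▷ M ≫ B ◁ f ≫ μ[B] =
      (α_ B M M).hom ≫ B ◁ ((f ⊗ₘ f) ≫ μ[B]) ≫ μ[B] := by
    rw [comp_whiskerRight_assoc, ← whisker_exchange_assoc, MonoidalCategory.tensorHom_def]
    simp
  rw [h, Iso.inv_hom_id_assoc, ← whiskerLeft_comp_assoc, ← BraidedCategory.braiding_naturality_assoc,
    IsCommMonObj.mul_comm]

end SymTensor

end FreeAlgebras

/-! ### The image of the symmetrization operator as a commutative algebra. -/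

section FreeCommutative

variable {C : Type u} [Category.{v} C] [Preadditive C] [MonoidalCategory C]
  [MonoidalPreadditive C] [SymmetricCategory C]

/-- The section makes p ⊗ p a split epimorphism, so multiplicativity can be tested after it. -/
theorem isMonHom_of_epi_comp {X Y Z : C} [MonObj X] [MonObj Y] [MonObj Z] {p : X ⟶ Y} {i : Y ⟶ X}
    (hi : i ≫ p = 𝟙 Y) [IsMonHom p] (ψ : Y ⟶ Z) (h : IsMonHom (p ≫ ψ)) : IsMonHom ψ where
  one_hom := by rw [← IsMonHom.one_hom p, Category.assoc, IsMonHom.one_hom]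
  mul_hom := by
    have h' : (i ⊗ₘ i) ≫ (p ⊗ₘ p) = 𝟙 _ := by
      rw [tensorHom_comp_tensorHom, hi]
      simp
    rw [← Category.id_comp (μ[Y] ≫ ψ), ← h', Category.assoc, ← reassoc_of% (IsMonHom.mul_hom p),
      IsMonHom.mul_hom (p ≫ ψ), tensorHom_comp_tensorHom_assoc, reassoc_of% hi]

/-- A retract of a commutative up to retraction algebra is a commutative algebra. -/
theorem exists_commMon_of_retract {X Y : C} [MonObj X] {p : X ⟶ Y} {i : Y ⟶ X}
    (hi : i ≫ p = 𝟙 Y) (h₁ : η[X] ≫ p ≫ i = η[X])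
    (h₂ : ((p ≫ i) ⊗ₘ (p ≫ i)) ≫ μ[X] ≫ p = μ[X] ≫ p)
    (h₃ : (β_ X X).hom ≫ μ[X] ≫ p = μ[X] ≫ p) :
    ∃ (_ : MonObj Y) (_ : IsCommMonObj Y), IsMonHom p := by
  have hp : (p ⊗ₘ p) ≫ (i ⊗ₘ i) ≫ μ[X] ≫ p = μ[X] ≫ p := by
    rw [tensorHom_comp_tensorHom_assoc, h₂]
  have hip : (i ⊗ₘ i) ≫ (p ⊗ₘ p) = 𝟙 _ := by
    rw [tensorHom_comp_tensorHom, hi]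
    simp
  have hip₃ : ((i ⊗ₘ i) ⊗ₘ i) ≫ ((p ⊗ₘ p) ⊗ₘ p) = 𝟙 _ := by
    rw [tensorHom_comp_tensorHom, hip, hi]
    simp
  have : Epi ((p ⊗ₘ p) ⊗ₘ p) := (IsSplitEpi.mk' ⟨_, hip₃⟩).epi
  obtain ⟨m, hm⟩ : ∃ m, m = (i ⊗ₘ i) ≫ μ[X] ≫ p := ⟨_, rfl⟩
  rw [← hm] at hp
  let mon : MonObj Y :=
    { one := η[X] ≫ p
      mul := m
      one_mul := by
        rw [hm, MonoidalCategory.tensorHom_def, Category.assoc, ← comp_whiskerRight_assoc,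
          Category.assoc, h₁, ← whisker_exchange_assoc, MonObj.one_mul_assoc,
          leftUnitor_naturality_assoc, hi, Category.comp_id]
      mul_one := by
        rw [hm, MonoidalCategory.tensorHom_def', Category.assoc, ← whiskerLeft_comp_assoc,
          Category.assoc, h₁, whisker_exchange_assoc, MonObj.mul_one_assoc,
          rightUnitor_naturality_assoc, hi, Category.comp_id]
      mul_assoc := by
        rw [← cancel_epi ((p ⊗ₘ p) ⊗ₘ p), associator_naturality_assoc, ← tensorHom_id,
          ← id_tensorHom, tensorHom_comp_tensorHom_assoc, tensorHom_comp_tensorHom_assoc, hp,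
          Category.comp_id, ← Category.id_comp p, ← tensorHom_comp_tensorHom_assoc,
          ← tensorHom_comp_tensorHom_assoc, Category.id_comp, hp, tensorHom_id, id_tensorHom]
        simp }
  refine ⟨mon, ⟨?_⟩, ⟨rfl, hp.symm⟩⟩
  change (β_ Y Y).hom ≫ m = m
  rw [hm, ← BraidedCategory.braiding_naturality_assoc, h₃]

namespace SymTensor

variable {M : C} {u : 𝟙_ C ⟶ M} (A : SymTensor u)

/-- The kernel of `e` is a two-sided ideal by `mul_e_e`, and it contains the commutators by
`braiding_mul_e`; so the splitting of `e` is a commutative quotient algebra. -/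
theorem exists_commMon [IsIdempotentComplete C] :
    ∃ (Y : CommMon C) (p : A.T ⟶ Y.X) (i : Y.X ⟶ A.T), IsMonHom p ∧ i ≫ p = 𝟙 _ ∧ p ≫ i = A.e := by
  obtain ⟨Y, i, p, h₁, h₂⟩ := IsIdempotentComplete.idempotents_split A.T A.e A.e_e
  have hep : A.e ≫ p = p := by rw [← h₂, Category.assoc, h₁, Category.comp_id]
  obtain ⟨_, _, _⟩ := exists_commMon_of_retract (X := A.T) h₁
    (by rw [h₂]; exact A.o_e)
    (by rw [h₂, mul_def, ← hep, ← reassoc_of% A.mul_e_e])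
    (by rw [mul_def, ← hep, reassoc_of% A.braiding_mul_e])
  exact ⟨⟨Y⟩, p, i, ‹_›, h₁, h₂⟩

end SymTensor

end FreeCommutative

/-! ### The universal properties of the two algebras. -/

section FreeObjects

open Supercategory

variable {S : Type u} [Category.{v} S] [Abelian S] [MonoidalCategory S] [SymmetricCategory S]
  [MonoidalPreadditive S] [Linear ℚ S] [MonoidalLinear ℚ S] [HasLimits S] [WellPowered.{v} S]
  [Supercategory S] {L₀ : LieObj S} {M : UnitalObj L₀}

/-- The unit of a unital object. -/
def UnitalObj.one (M : UnitalObj L₀) : 𝟙_ (LMod L₀) ⟶ M.right := M.hom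

variable (A : SymTensor M.one)

/-- The reduced tensor algebra is the free associative algebra. -/
def SymTensor.isFreeAsso : IsFreeAsso M ⟨A.T⟩ where
  homEquiv {B} := Equiv.ofBijective
    (fun f => (Under.homMk (A.j ≫ f.hom) (by
      have h := reassoc_of% A.u_j
      exact (h f.hom).trans (IsMonHom.one_hom f.hom)) : M ⟶ (forgetUnital L₀).obj B)) (by
    constructor
    · intro f g h
      exact Mon.Hom.ext (A.monHom_ext (congrArg (fun t => CommaMorphism.right t) h))
    · intro φ
      obtain ⟨ψ, h₁, h₂⟩ := A.exists_liftMon (B := B.X) φ.right (Under.w φ)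
      exact ⟨⟨ψ⟩, Under.UnderMorphism.ext h₂⟩)
  homEquiv_comp g f := Under.UnderMorphism.ext (Category.assoc _ _ _).symm

/-- The underlying morphism of a morphism of commutative algebras. -/
def commHom {Y B : CommMon (LMod L₀)} (f : Y ⟶ B) : Y.X ⟶ B.X := f.hom.hom

instance {Y B : CommMon (LMod L₀)} (f : Y ⟶ B) : IsMonHom (commHom f) := f.hom.isMonHom_hom

open SymTensor in
/-- The image of the symmetrization operator is the free commutative algebra. -/
def SymTensor.isFreeComm {Y : CommMon (LMod L₀)} {p : A.T ⟶ Y.X} {i : Y.X ⟶ A.T} [IsMonHom p]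
    (h₁ : i ≫ p = 𝟙 _) (h₂ : p ≫ i = A.e) : IsFreeComm M Y where
  homEquiv {B} := Equiv.ofBijective
    (fun f => (Under.homMk (A.j ≫ p ≫ commHom f) (by
      have h := reassoc_of% A.u_j
      exact (h _).trans (IsMonHom.one_hom (p ≫ commHom f))) :
        M ⟶ (forgetUnital L₀).obj B.toMon)) (by
    constructor
    · intro f g h
      have h' : p ≫ commHom f = p ≫ commHom g :=
        A.monHom_ext (congrArg (fun t => CommaMorphism.right t) h)
      apply CommMon.hom_ext
      change commHom f = commHom g
      rw [← Category.id_comp (commHom f), ← h₁, Category.assoc, h', reassoc_of% h₁]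
    · intro φ
      obtain ⟨ψ, h₃, h₄⟩ := A.exists_liftMon (B := B.X) φ.right (Under.w φ)
      -- A morphism to a commutative algebra absorbs `e`, hence factors through `p`; the factor is
      -- found by restricting along `i`.
      have h₅ : p ≫ i ≫ ψ = ψ := by rw [reassoc_of% h₂]; exact @e_monHom _ _ _ _ _ _ _ _ A B.X _ _ ψ h₃
      have h₆ := isMonHom_of_epi_comp (Z := B.X) h₁ (i ≫ ψ) (by rwa [h₅])
      exact ⟨CommMon.homMk (@Mon.Hom.mk _ _ _ Y.toMon B.toMon (i ≫ ψ) h₆),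
        Under.UnderMorphism.ext ((congrArg (fun t => A.j ≫ t) h₅).trans h₄)⟩)
  homEquiv_comp g f := Under.UnderMorphism.ext (by
    change A.j ≫ p ≫ commHom f ≫ commHom g = (A.j ≫ p ≫ commHom f) ≫ commHom g
    simp only [Category.assoc])

end FreeObjects

/-! ### Base change of modules, and extensions by the unit. -/

section BaseChange

section Regroup

variable {C : Type u} [Category.{v} C] [MonoidalCategory C] [SymmetricCategory C]

/-- The shuffle regrouping the three factors `A` and the remaining three factors. -/
def regroup₃ (A L L' V : C) :
    (A ⊗ L) ⊗ (A ⊗ L') ⊗ (A ⊗ V) ⟶ (A ⊗ A ⊗ A) ⊗ (L ⊗ L' ⊗ V) :=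
  (A ⊗ L) ◁ tensorμ A L' A V ≫ tensorμ A L (A ⊗ A) (L' ⊗ V)

theorem regroup₃_right {A B L L' V V' W : C} (m : A ⊗ A ⟶ A) (a : L' ⊗ V ⟶ V') (g : A ⊗ A ⟶ B)
    (h : L ⊗ V' ⟶ W) :
    (A ⊗ L) ◁ (tensorμ A L' A V ≫ (m ⊗ₘ a)) ≫ tensorμ A L A V' ≫ (g ⊗ₘ h) =
      regroup₃ A L L' V ≫ ((A ◁ m ≫ g) ⊗ₘ (L ◁ a ≫ h)) := by
  have h := tensorμ_natural_right A L m a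
  simp only [regroup₃, whiskerLeft_comp, Category.assoc, reassoc_of% h, tensorHom_comp_tensorHom]

theorem associator_inv_regroup₃ (A L L' V : C) :
   (α_ (A ⊗ L) (A ⊗ L') (A ⊗ V)).inv ≫ tensorμ A L A L' ▷ (A ⊗ V) ≫
      tensorμ (A ⊗ A) (L ⊗ L') A V =
    regroup₃ A L L' V ≫ ((α_ A A A).inv ⊗ₘ (α_ L L' V).inv) := by
  have h := tensor_associativity A L A L' A V
  rw [Iso.inv_comp_eq, regroup₃, Category.assoc, ← reassoc_of% h, tensorHom_comp_tensorHom]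
  simp

theorem regroup₃_left {A B L L' K V W : C} (m : A ⊗ A ⟶ A) (b : L ⊗ L' ⟶ K) (g : A ⊗ A ⟶ B)
    (h : K ⊗ V ⟶ W) :
    (α_ (A ⊗ L) (A ⊗ L') (A ⊗ V)).inv ≫
      (tensorμ A L A L' ≫ (m ⊗ₘ b)) ▷ (A ⊗ V) ≫ tensorμ A K A V ≫ (g ⊗ₘ h) =
      regroup₃ A L L' V ≫ (((α_ A A A).inv ≫ m ▷ A ≫ g) ⊗ₘ ((α_ L L' V).inv ≫ b ▷ V ≫ h)) := by
  have h := tensorμ_natural_left m b A V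
  have h1 := associator_inv_regroup₃ A L L' V
  simp only [comp_whiskerRight, Category.assoc, reassoc_of% h, reassoc_of% h1,
    tensorHom_comp_tensorHom]

theorem swapLeft_regroup₃ (A L V : C) : swapLeft (A ⊗ L) (A ⊗ L) (A ⊗ V) ≫ regroup₃ A L L V =
    regroup₃ A L L V ≫ (swapLeft A A A ⊗ₘ swapLeft L L V) := by
  have h := tensor_associativity A L A L A V
  have h1 := associator_inv_regroup₃ A L L V
  have h2 := congrArg (fun t => t ▷ (A ⊗ V)) (braiding_tensorμ A L)
  simp only [comp_whiskerRight] at h2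
  have h3 := tensorμ_natural_left (β_ A A).hom (β_ L L).hom A V
  unfold regroup₃ at h1 ⊢
  simp only [Category.assoc] at h1
  simp only [swapLeft, Category.assoc]
  rw [← h, reassoc_of% h2, reassoc_of% h3, reassoc_of% h1]
  simp only [tensorHom_comp_tensorHom]

theorem mul_assoc_inv (A : C) [MonObj A] :
    (α_ A A A).inv ≫ μ[A] ▷ A ≫ μ[A] = A ◁ μ[A] ≫ μ[A] := by
  rw [MonObj.mul_assoc, Iso.inv_hom_id_assoc]

theorem swapLeft_mul (A : C) [MonObj A] [IsCommMonObj A] :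
    swapLeft A A A ≫ A ◁ μ[A] ≫ μ[A] = A ◁ μ[A] ≫ μ[A] := by
  rw [← mul_assoc_inv]
  simp only [swapLeft, Category.assoc, Iso.hom_inv_id_assoc]
  rw [← comp_whiskerRight_assoc, IsCommMonObj.mul_comm]

end Regroup

variable {C : Type u} [Category.{v} C] [Preadditive C] [MonoidalCategory C]
  [MonoidalPreadditive C] [SymmetricCategory C]

theorem tensorHom_sub {X X' Y Y' : C} (f : X ⟶ X') (g g' : Y ⟶ Y') :
    f ⊗ₘ (g - g') = (f ⊗ₘ g) - (f ⊗ₘ g') := by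
  rw [sub_eq_add_neg, MonoidalPreadditive.tensor_add, tensorHom_neg, ← sub_eq_add_neg]

namespace LieMod

variable {L : LieObj C}

theorem baseChange_act_bracket (A : C) [MonObj A] [IsCommMonObj A] (V : LieMod L) :
    (α_ (A ⊗ L.X) (A ⊗ L.X) (A ⊗ V.M)).inv ≫
      (tensorμ A L.X A L.X ≫ (μ[A] ⊗ₘ L.bracket)) ▷ (A ⊗ V.M) ≫
        tensorμ A L.X A V.M ≫ (μ[A] ⊗ₘ V.act) =
      (A ⊗ L.X) ◁ (tensorμ A L.X A V.M ≫ (μ[A] ⊗ₘ V.act)) ≫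
        tensorμ A L.X A V.M ≫ (μ[A] ⊗ₘ V.act) -
      swapLeft (A ⊗ L.X) (A ⊗ L.X) (A ⊗ V.M) ≫
        (A ⊗ L.X) ◁ (tensorμ A L.X A V.M ≫ (μ[A] ⊗ₘ V.act)) ≫
          tensorμ A L.X A V.M ≫ (μ[A] ⊗ₘ V.act) := by
  rw [regroup₃_left, regroup₃_right, reassoc_of% (swapLeft_regroup₃ A L.X V.M),
    tensorHom_comp_tensorHom, swapLeft_mul, mul_assoc_inv, V.act_bracket, tensorHom_sub,
    Preadditive.comp_sub]

/-- The base change of a module to a commutative algebra `A`. -/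
def baseChange (A : C) [MonObj A] [IsCommMonObj A] (V : LieMod L) :
    LieMod (LieObj.baseChange A L) where
  M := A ⊗ V.M
  act := tensorμ A L.X A V.M ≫ (μ[A] ⊗ₘ V.act)
  act_bracket := baseChange_act_bracket A V

theorem sub_f {M N : LieMod L} (f g : M ⟶ N) : (f - g).f = f.f - g.f := by
  rw [sub_eq_add_neg, sub_eq_add_neg, add_f, neg_f]

/-- A module, seen in the category of `Q`-modules through the zero action. -/
def trivialExt (Q : LieObj C) (V : LieMod L) : LieMod (LieObj.trivialExt Q L) where
  M := trivial Q V.M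
  act := ⟨V.act, by simp [leibnizAct, LieObj.trivialExt, trivial]⟩
  act_bracket := hom_ext (by rw [sub_f]; exact V.act_bracket)

section Extension

variable [HasBinaryBiproducts C] (N : LieMod L) (κ : L.X ⊗ N.M ⟶ 𝟙_ C)
  (hκ : (α_ L.X L.X N.M).inv ≫ L.bracket ▷ N.M ≫ κ =
    L.X ◁ N.act ≫ κ - swapLeft L.X L.X N.M ≫ L.X ◁ N.act ≫ κ)

/-- The extension of a module by the unit, given by a cocycle. -/
def extension : LieMod L where
  M := 𝟙_ C ⊞ N.M
  act := L.X ◁ biprod.snd ≫ (κ ≫ biprod.inl + N.act ≫ biprod.inr)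
  act_bracket := by
    obtain ⟨a, ha⟩ : ∃ a, a = κ ≫ biprod.inl + N.act ≫ biprod.inr := ⟨_, rfl⟩
    rw [← ha]
    have h₁ : (L.X ◁ a) ≫ L.X ◁ (biprod.snd : 𝟙_ C ⊞ N.M ⟶ _) = L.X ◁ N.act := by
      rw [← whiskerLeft_comp, ha]
      simp
    have h₂ : (α_ L.X L.X (𝟙_ C ⊞ N.M)).inv ≫ L.bracket ▷ (𝟙_ C ⊞ N.M) ≫ L.X ◁ biprod.snd ≫ a =
        L.X ◁ L.X ◁ biprod.snd ≫ (α_ L.X L.X N.M).inv ≫ L.bracket ▷ N.M ≫ a := by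
      rw [← whisker_exchange_assoc]
      simp
    have h₃ : (α_ L.X L.X N.M).inv ≫ L.bracket ▷ N.M ≫ a =
        L.X ◁ N.act ≫ a - swapLeft L.X L.X N.M ≫ L.X ◁ N.act ≫ a := by
      simp only [ha, Preadditive.comp_add, reassoc_of% hκ, reassoc_of% N.act_bracket,
        Preadditive.sub_comp, Category.assoc]
      abel
    rw [h₂, h₃, whiskerLeft_comp, Category.assoc, reassoc_of% h₁, Preadditive.comp_sub,
      ← reassoc_of% (swapLeft_nat₃ L.X L.X (biprod.snd : 𝟙_ C ⊞ N.M ⟶ _))]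

/-- The unit of the extension. -/
def extensionUnit : 𝟙_ (LieMod L) ⟶ extension N κ hκ where
  f := biprod.inl
  comm := by
    have h : L.X ◁ (biprod.inl : 𝟙_ C ⟶ 𝟙_ C ⊞ N.M) ≫ L.X ◁ biprod.snd = 0 := by
      rw [← whiskerLeft_comp]
      simp
    change L.X ◁ biprod.inl ≫ L.X ◁ biprod.snd ≫ _ = (0 : L.X ⊗ 𝟙_ C ⟶ 𝟙_ C) ≫ biprod.inl
    rw [reassoc_of% h, zero_comp, zero_comp]

/-- The projection of the extension. -/
def extensionProj : extension N κ hκ ⟶ N where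
  f := biprod.snd
  comm := by simp [extension]

end Extension

end LieMod

/-! ### The coadjoint module and its pairing. -/

section Coadjoint

/-- `f` is recovered from its evaluation by means of the coevaluation. -/
theorem eq_zero_of_evaluation {L V X : C} [ExactPairing L V] {f : X ⟶ V}
    (h : f ▷ L ≫ ε_ L V = 0) : f = 0 := by
  have h₁ := ExactPairing.coevaluation_evaluation L V
  have h₂ : (ρ_ X).inv ≫ X ◁ η_ L V ≫ (α_ X L V).inv ≫ (f ▷ L ≫ ε_ L V) ▷ V ≫ (λ_ V).hom = f := by
    rw [comp_whiskerRight_assoc, ← associator_inv_naturality_left_assoc, whisker_exchange_assoc,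
      reassoc_of% h₁]
    simp
  rw [← h₂, h]
  simp

variable {S : Type u} [Category.{v} S] [Abelian S] [MonoidalCategory S] [SymmetricCategory S]
  [MonoidalPreadditive S] [Linear ℚ S] [MonoidalLinear ℚ S] [HasLimits S] [WellPowered.{v} S]
  [Supercategory S] (L : LieObj S) (V : S) [ExactPairing L.X V]

theorem coadjoint_invariant : leibnizAct (coadjoint L V) L.bracket ≫ ε_ L.X V = 0 := by
  rw [leibnizAct, Preadditive.add_comp, Category.assoc, coadjoint_evaluation]
  simp [swapLeft]

/-- The coadjoint module. -/
def coadjointMod : LieMod L where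
  M := V
  act := coadjoint L V
  act_bracket := by
    rw [← lieDefect_eq_zero_iff]
    -- By duality the defect can be tested after evaluation. The evaluation is invariant, so the
    -- defect of coadjoint ⊗ adjoint dies after it; the adjoint part is zero by the Jacobi identity,
    -- which leaves the coadjoint part.
    apply eq_zero_of_evaluation (L := L.X)
    have h := lieDefect_naturality L.bracket (leibnizAct (coadjoint L V) L.bracket) 0 (ε_ L.X V)
      (by rw [comp_zero, coadjoint_invariant])
    have h₀ : lieDefect L.bracket (0 : L.X ⊗ 𝟙_ S ⟶ 𝟙_ S) = 0 := by simp [lieDefect]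
    have h₁ : lieDefect L.bracket L.bracket = 0 := by
      rw [lieDefect_eq_zero_iff]
      exact eq_sub_of_add_eq L.jacobi.symm
    rw [lieDefect_leibnizAct, h₀, h₁] at h
    rw [← cancel_epi ((α_ L.X L.X V).hom ▷ L.X), ← cancel_epi (α_ (L.X ⊗ L.X) V L.X).inv,
      ← cancel_epi (α_ L.X L.X (V ⊗ L.X)).inv]
    simpa using h.symm

/-- The pairing of a Lie algebra with its dual. -/
def dualPairing : L.X ⊗ V ⟶ 𝟙_ S := (β_ L.X V).hom ≫ ε_ L.X V

/-- The sign in the definition of the coadjoint action cancels the one from skew symmetry: ⟨x, yξ⟩ =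
-⟨[y, x], ξ⟩ = ⟨[x, y], ξ⟩. -/
theorem coadjoint_dualPairing : L.X ◁ coadjoint L V ≫ dualPairing L V =
    (α_ L.X L.X V).inv ≫ L.bracket ▷ V ≫ dualPairing L V := by
  have hb : L.bracket = -((β_ L.X L.X).hom ≫ L.bracket) := by rw [L.skew, neg_neg]
  have hy := BraidedCategory.yang_baxter L.X L.X V
  rw [dualPairing, BraidedCategory.braiding_naturality_right_assoc, coadjoint_evaluation,
    BraidedCategory.braiding_naturality_left_assoc]
  nth_rewrite 2 [hb]
  rw [whiskerLeft_neg, Preadditive.neg_comp, Preadditive.comp_neg, Preadditive.comp_neg,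
    Preadditive.comp_neg]
  congr 1
  simp only [BraidedCategory.braiding_tensor_left_hom, BraidedCategory.braiding_tensor_right_hom,
    Category.assoc, Iso.inv_hom_id_assoc, whiskerLeft_comp, reassoc_of% hy]

theorem swapLeft_coadjoint_dualPairing :
    swapLeft L.X L.X V ≫ L.X ◁ coadjoint L V ≫ dualPairing L V =
      -((α_ L.X L.X V).inv ≫ L.bracket ▷ V ≫ dualPairing L V) := by
  rw [coadjoint_dualPairing]
  simp only [swapLeft, Category.assoc, Iso.hom_inv_id_assoc]
  rw [← comp_whiskerRight_assoc, L.skew, neg_whiskerRight]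
  simp

end Coadjoint

end BaseChange

/-! ### Multiplication of a base change by scalars. -/

section BaseChangeMul

section Braided

variable {C : Type u} [Category.{v} C] [MonoidalCategory C] [SymmetricCategory C]

theorem tensorμ_swapLeft (A L X Y V : C) :
    (A ⊗ L) ◁ (α_ X Y V).inv ≫ tensorμ A L (X ⊗ Y) V ≫ swapLeft A X Y ▷ (L ⊗ V) =
      swapLeft (A ⊗ L) X (Y ⊗ V) ≫ X ◁ tensorμ A L Y V ≫ (α_ X (A ⊗ Y) (L ⊗ V)).inv := by
  calc
    _ = 𝟙 _ ⊗≫ A ◁ (β_ L X).hom ▷ Y ▷ V ⊗≫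
        ((A ⊗ X) ◁ ((β_ L Y).hom ▷ V) ≫ (β_ A X).hom ▷ ((Y ⊗ L) ⊗ V)) ⊗≫ 𝟙 _ := by
      simp only [swapLeft, tensorμ, BraidedCategory.braiding_tensor_right_hom]
      monoidal
    _ = 𝟙 _ ⊗≫ A ◁ (β_ L X).hom ▷ Y ▷ V ⊗≫
        ((β_ A X).hom ▷ ((L ⊗ Y) ⊗ V) ≫ (X ⊗ A) ◁ ((β_ L Y).hom ▷ V)) ⊗≫ 𝟙 _ := by
      rw [whisker_exchange]
    _ = _ := by
      simp only [swapLeft, tensorμ, BraidedCategory.braiding_tensor_left_hom]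
      monoidal

/-- Commutativity of A lets a scalar pass the action of A ⊗ L; this makes scalar multiplication a
morphism of modules. -/
theorem whiskerLeft_mul_tensorμ {A L V W : C} [MonObj A] [IsCommMonObj A] (a : L ⊗ V ⟶ W) :
    (A ⊗ L) ◁ ((α_ A A V).inv ≫ μ[A] ▷ V) ≫ tensorμ A L A V ≫ (μ[A] ⊗ₘ a) =
      swapLeft (A ⊗ L) A (A ⊗ V) ≫ A ◁ (tensorμ A L A V ≫ (μ[A] ⊗ₘ a)) ≫
        (α_ A A W).inv ≫ μ[A] ▷ W := by
  have h : (A ⊗ L) ◁ (μ[A] ▷ V) ≫ tensorμ A L A V =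
      tensorμ A L (A ⊗ A) V ≫ (A ◁ μ[A]) ▷ (L ⊗ V) := by
    simpa using tensorμ_natural_right A L μ[A] (𝟙 V)
  have h₂ : A ◁ (μ[A] ⊗ₘ a) ≫ (α_ A A W).inv ≫ μ[A] ▷ W =
      (α_ A (A ⊗ A) (L ⊗ V)).inv ≫ ((A ◁ μ[A] ≫ μ[A]) ⊗ₘ a) := by
    rw [← id_tensorHom, associator_inv_naturality_assoc, ← tensorHom_id,
      tensorHom_comp_tensorHom, Category.comp_id, id_tensorHom]
  have h₁ : (A ◁ μ[A] ≫ μ[A]) ⊗ₘ a = swapLeft A A A ▷ (L ⊗ V) ≫ ((A ◁ μ[A] ≫ μ[A]) ⊗ₘ a) := by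
    rw [← tensorHom_id, tensorHom_comp_tensorHom, Category.id_comp, swapLeft_mul]
  rw [whiskerLeft_comp, Category.assoc, reassoc_of% h, ← tensorHom_id, tensorHom_comp_tensorHom,
    Category.id_comp, h₁, reassoc_of% (tensorμ_swapLeft A L A A V), whiskerLeft_comp,
    Category.assoc, h₂]

end Braided

variable {C : Type u} [Category.{v} C] [Preadditive C] [MonoidalCategory C]
  [MonoidalPreadditive C] [SymmetricCategory C] {L : LieObj C}

theorem leibnizAct_zero_left {L M N : C} (c : L ⊗ N ⟶ N) :
    leibnizAct (0 : L ⊗ M ⟶ M) c = swapLeft L M N ≫ M ◁ c := by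
  simp [leibnizAct]

theorem leftUnitor_inv_one_mul (A V : C) [MonObj A] :
    (λ_ (A ⊗ V)).inv ≫ η[A] ▷ (A ⊗ V) ≫ (α_ A A V).inv ≫ μ[A] ▷ V = 𝟙 _ := by
  rw [associator_inv_naturality_left_assoc, ← comp_whiskerRight, MonObj.one_mul]
  simp

namespace LieMod

/-- The multiplication of a base change by scalars, as a morphism of modules. -/
def baseChangeMul (A : C) [MonObj A] [IsCommMonObj A] (V : LieMod L) :
    trivial (LieObj.baseChange A L) A ⊗ baseChange A V ⟶ baseChange A V where
  f := (α_ A A V.M).inv ≫ μ[A] ▷ V.M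
  comm := by
    have h := leibnizAct_zero_left (M := A) (tensorμ A L.X A V.M ≫ (μ[A] ⊗ₘ V.act))
    refine ((whiskerLeft_mul_tensorμ V.act).trans ?_).trans
      (congrArg (· ≫ (α_ A A V.M).inv ≫ μ[A] ▷ V.M) h.symm)
    exact (Category.assoc _ _ _).symm

theorem one_baseChangeMul (A : C) [MonObj A] [IsCommMonObj A] (V : LieMod L) :
    (λ_ (A ⊗ V.M)).inv ≫ η[A] ▷ (A ⊗ V.M) ≫ (baseChangeMul A V).f = 𝟙 _ :=
  leftUnitor_inv_one_mul A V.M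

end LieMod

end BaseChangeMul

/-! ### The form on D and its cocycle identity. -/

section Universal

open Supercategory

theorem tensorHom_swapLeft {C : Type u} [Category.{v} C] [MonoidalCategory C]
    [SymmetricCategory C] {X X' Y Y' Z Z' : C} (f : X ⟶ X') (g : Y ⟶ Y') (h : Z ⟶ Z') :
    (f ⊗ₘ (g ⊗ₘ h)) ≫ swapLeft X' Y' Z' = swapLeft X Y Z ≫ (g ⊗ₘ (f ⊗ₘ h)) := by
  simp only [swapLeft, Category.assoc]
  rw [associator_inv_naturality_assoc, ← tensorHom_id, tensorHom_comp_tensorHom_assoc,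
    Category.comp_id, BraidedCategory.braiding_naturality, ← associator_naturality,
    ← tensorHom_id, tensorHom_comp_tensorHom_assoc, Category.id_comp]

variable {S : Type u} [Category.{v} S] [Abelian S] [MonoidalCategory S] [SymmetricCategory S]
  [MonoidalPreadditive S] [Linear ℚ S] [MonoidalLinear ℚ S] [HasLimits S] [WellPowered.{v} S]
  [Supercategory S]

theorem swapLeft_odd (X : S) : swapLeft (P : S) P X = -𝟙 _ := by
  rw [swapLeft, braiding_P, neg_whiskerRight]
  simp

theorem leibnizAct_tensorHom_eq_zero {C : Type u} [Category.{v} C] [Preadditive C]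
    [MonoidalCategory C] [MonoidalPreadditive C] [SymmetricCategory C] {L M N M' N' : C}
    (a : L ⊗ M ⟶ M) (c : L ⊗ N ⟶ N) {f : M ⟶ M'} {g : N ⟶ N'} (hf : a ≫ f = 0)
    (hg : c ≫ g = 0) : leibnizAct a c ≫ (f ⊗ₘ g) = 0 := by
  rw [leibnizAct, Preadditive.add_comp, Category.assoc, Category.assoc, ← tensorHom_id,
    ← id_tensorHom, tensorHom_comp_tensorHom, tensorHom_comp_tensorHom, hf, hg]
  simp

theorem doubling_act_snd : ((P : S) ◁ (biprod.snd : 𝟙_ S ⊞ P ⟶ P) ≫ pairing ≫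
    (biprod.inl : 𝟙_ S ⟶ 𝟙_ S ⊞ P)) ≫ biprod.snd = 0 := by
  simp

/-- The pairing of the odd components of `D`. -/
def doublingForm : doubling S ⊗ doubling S ⟶ 𝟙_ (Cpx S) where
  f := (biprod.snd ⊗ₘ biprod.snd) ≫ pairing
  comm := by
    have h := leibnizAct_tensorHom_eq_zero _ _ (doubling_act_snd (S := S)) doubling_act_snd
    exact comp_zero.trans (((reassoc_of% h) pairing).trans zero_comp).symm

/-- The form sees only triples with two odd entries. The odd-odd-even triple occurs twice on the
right, with opposite signs because exchanging two copies of P is -1; the other two types match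
directly. -/
theorem doublingForm_cocycle :
    (α_ (doubling S) (doubling S) (doubling S)).inv ≫ μ[doubling S] ▷ doubling S ≫
        doublingForm =
      doubling S ◁ μ[doubling S] ≫ doublingForm +
        swapLeft (doubling S) (doubling S) (doubling S) ≫ doubling S ◁ μ[doubling S] ≫
          doublingForm := by
  apply LieMod.hom_ext
  change (α_ (𝟙_ S ⊞ P) (𝟙_ S ⊞ P) (𝟙_ S ⊞ P)).inv ≫ doublingMul ▷ (𝟙_ S ⊞ P) ≫
    (biprod.snd ⊗ₘ biprod.snd) ≫ pairing = (𝟙_ S ⊞ P) ◁ doublingMul ≫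
    (biprod.snd ⊗ₘ biprod.snd) ≫ pairing + swapLeft (𝟙_ S ⊞ P) (𝟙_ S ⊞ P) (𝟙_ S ⊞ P) ≫
    (𝟙_ S ⊞ P) ◁ doublingMul ≫ (biprod.snd ⊗ₘ biprod.snd) ≫ pairing
  have h₁ : doublingMul (S := S) ▷ (𝟙_ S ⊞ P) ≫ (biprod.snd ⊗ₘ biprod.snd) =
      ((biprod.fst ⊗ₘ biprod.snd) ⊗ₘ biprod.snd) ≫ (λ_ P).hom ▷ P +
        ((biprod.snd ⊗ₘ biprod.fst) ⊗ₘ biprod.snd) ≫ (ρ_ P).hom ▷ P := by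
    simp only [← tensorHom_id, tensorHom_comp_tensorHom, Category.id_comp, Category.comp_id,
      doublingMul_snd, MonoidalPreadditive.add_tensor]
  have h₂ : (𝟙_ S ⊞ P) ◁ doublingMul (S := S) ≫ (biprod.snd ⊗ₘ biprod.snd) =
      (biprod.snd ⊗ₘ (biprod.fst ⊗ₘ biprod.snd)) ≫ P ◁ (λ_ P).hom +
        (biprod.snd ⊗ₘ (biprod.snd ⊗ₘ biprod.fst)) ≫ P ◁ (ρ_ P).hom := by
    simp only [← id_tensorHom, tensorHom_comp_tensorHom, Category.id_comp, Category.comp_id,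
      doublingMul_snd, MonoidalPreadditive.tensor_add]
  have h₃ : swapLeft (𝟙_ S) P P ≫ P ◁ (λ_ P).hom = (λ_ (P ⊗ P)).hom := by
    simp [swapLeft]
  rw [reassoc_of% h₁, reassoc_of% h₂]
  simp only [Preadditive.add_comp, Preadditive.comp_add, Category.assoc,
    ← reassoc_of% @tensorHom_swapLeft, reassoc_of% h₃, swapLeft_odd,
    ← associator_inv_naturality_assoc]
  simp
  abel

end Universal

/-! ### The cocycle on a base change. -/

section BaseChangeCocycle

variable {C : Type u} [Category.{v} C] [Preadditive C] [MonoidalCategory C]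
  [MonoidalPreadditive C] [SymmetricCategory C] {L : LieObj C}

theorem add_tensorHom {X X' Y Y' : C} (f f' : X ⟶ X') (g : Y ⟶ Y') :
    (f + f') ⊗ₘ g = (f ⊗ₘ g) + (f' ⊗ₘ g) :=
  MonoidalPreadditive.add_tensor f f' g

/-- Exchanging the Lie arguments changes the sign of `t` by `ht'`, which turns the difference in the
cocycle condition into the sum in `hb`. -/
theorem LieMod.baseChange_cocycle (A : C) [MonObj A] [IsCommMonObj A] (V : LieMod L)
    (b : A ⊗ A ⟶ 𝟙_ C) (t : L.X ⊗ V.M ⟶ 𝟙_ C)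
    (hb : (α_ A A A).inv ≫ μ[A] ▷ A ≫ b = A ◁ μ[A] ≫ b + swapLeft A A A ≫ A ◁ μ[A] ≫ b)
    (ht : L.X ◁ V.act ≫ t = (α_ L.X L.X V.M).inv ≫ L.bracket ▷ V.M ≫ t)
    (ht' : swapLeft L.X L.X V.M ≫ L.X ◁ V.act ≫ t =
      -((α_ L.X L.X V.M).inv ≫ L.bracket ▷ V.M ≫ t)) :
    (α_ (A ⊗ L.X) (A ⊗ L.X) (A ⊗ V.M)).inv ≫
      (tensorμ A L.X A L.X ≫ (μ[A] ⊗ₘ L.bracket)) ▷ (A ⊗ V.M) ≫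
        tensorμ A L.X A V.M ≫ (b ⊗ₘ t) ≫ (λ_ (𝟙_ C)).hom =
      (A ⊗ L.X) ◁ (tensorμ A L.X A V.M ≫ (μ[A] ⊗ₘ V.act)) ≫
        tensorμ A L.X A V.M ≫ (b ⊗ₘ t) ≫ (λ_ (𝟙_ C)).hom -
      swapLeft (A ⊗ L.X) (A ⊗ L.X) (A ⊗ V.M) ≫
        (A ⊗ L.X) ◁ (tensorμ A L.X A V.M ≫ (μ[A] ⊗ₘ V.act)) ≫
          tensorμ A L.X A V.M ≫ (b ⊗ₘ t) ≫ (λ_ (𝟙_ C)).hom := by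
  rw [reassoc_of% (regroup₃_left μ[A] L.bracket b t), reassoc_of% (regroup₃_right μ[A] V.act b t),
    reassoc_of% (swapLeft_regroup₃ A L.X V.M), tensorHom_comp_tensorHom_assoc, hb, ht', ht,
    add_tensorHom, tensorHom_neg]
  simp only [Preadditive.comp_add, Preadditive.add_comp, Preadditive.neg_comp,
    Preadditive.comp_neg, sub_neg_eq_add]

end BaseChangeCocycle

/-! ### The universal unital object and its contractibility modulo the unit. -/

section Universal

open Supercategory

variable {S : Type u} [Category.{v} S] [Abelian S] [MonoidalCategory S] [SymmetricCategory S]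
  [MonoidalPreadditive S] [Linear ℚ S] [MonoidalLinear ℚ S] [HasLimits S] [WellPowered.{v} S]
  [Supercategory S] (L₀ : LieObj S) (Ld : S) [ExactPairing L₀.X Ld]

/-- The coadjoint module, as a supercomplex with zero differential. -/
def coadjointCpx : LieMod (LieObj.trivialExt (oddLie S) L₀) :=
  LieMod.trivialExt (oddLie S) (coadjointMod L₀ Ld)

/-- The pairing of `L₀` with its dual, as a morphism of supercomplexes. -/
def dualPairingCpx :
    (LieObj.trivialExt (oddLie S) L₀).X ⊗ (coadjointCpx L₀ Ld).M ⟶ 𝟙_ (Cpx S) where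
  f := dualPairing L₀ Ld
  comm := by
    have h : leibnizAct (0 : (oddLie S).X ⊗ L₀.X ⟶ L₀.X) (0 : (oddLie S).X ⊗ Ld ⟶ Ld) = 0 := by
      simp [leibnizAct]
    exact comp_zero.trans ((h =≫ dualPairing L₀ Ld).trans zero_comp).symm

/-- The module `D ⊗ L₀*` over `D ⊗ L₀`. -/
def doubleDual : LMod L₀ := LieMod.baseChange (doubling S) (coadjointCpx L₀ Ld)

/-- The cocycle on `D ⊗ L₀*` that defines the universal connection. -/
def connectionCocycle : (doubleLie L₀).X ⊗ (doubleDual L₀ Ld).M ⟶ 𝟙_ (Cpx S) :=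
  tensorμ (doubling S) (LieObj.trivialExt (oddLie S) L₀).X (doubling S) (coadjointCpx L₀ Ld).M ≫
    (doublingForm ⊗ₘ dualPairingCpx L₀ Ld) ≫ (λ_ (𝟙_ (Cpx S))).hom

theorem connectionCocycle_cocycle : (α_ (doubleLie L₀).X (doubleLie L₀).X _).inv ≫
      (doubleLie L₀).bracket ▷ (doubleDual L₀ Ld).M ≫ connectionCocycle L₀ Ld =
    (doubleLie L₀).X ◁ (doubleDual L₀ Ld).act ≫ connectionCocycle L₀ Ld -
      swapLeft (doubleLie L₀).X (doubleLie L₀).X _ ≫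
        (doubleLie L₀).X ◁ (doubleDual L₀ Ld).act ≫ connectionCocycle L₀ Ld :=
  LieMod.baseChange_cocycle (doubling S) (coadjointCpx L₀ Ld) doublingForm (dualPairingCpx L₀ Ld)
    doublingForm_cocycle (LieMod.hom_ext (coadjoint_dualPairing L₀ Ld))
    (LieMod.hom_ext (swapLeft_coadjoint_dualPairing L₀ Ld))

/-- The unital object representing connections. -/
def universalObj : UnitalObj L₀ :=
  Under.mk (LieMod.extensionUnit (doubleDual L₀ Ld) (connectionCocycle L₀ Ld)
    (connectionCocycle_cocycle L₀ Ld))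

/-- The projection onto `D ⊗ L₀*`. -/
def universalProj : (universalObj L₀ Ld).right ⟶ doubleDual L₀ Ld :=
  LieMod.extensionProj (doubleDual L₀ Ld) (connectionCocycle L₀ Ld)
    (connectionCocycle_cocycle L₀ Ld)

/-- The inclusion of `D ⊗ L₀*`, as a morphism of supercomplexes. -/
def universalIncl : (doubleDual L₀ Ld).M ⟶ (universalObj L₀ Ld).right.M := biprod.inr

/-- The retraction of the unit, as a morphism of supercomplexes. -/
def universalRetr : (universalObj L₀ Ld).right.M ⟶ 𝟙_ (Cpx S) := biprod.fst

theorem incl_proj : universalIncl L₀ Ld ≫ (universalProj L₀ Ld).f = 𝟙 _ := biprod.inr_snd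

theorem unit_proj : (universalObj L₀ Ld).one.f ≫ (universalProj L₀ Ld).f = 0 := biprod.inl_snd

theorem unit_retr : (universalObj L₀ Ld).one.f ≫ universalRetr L₀ Ld = 𝟙 _ := biprod.inl_fst

theorem incl_retr : universalIncl L₀ Ld ≫ universalRetr L₀ Ld = 0 := biprod.inr_fst

theorem universal_total : universalRetr L₀ Ld ≫ (universalObj L₀ Ld).one.f +
    (universalProj L₀ Ld).f ≫ universalIncl L₀ Ld = 𝟙 _ := biprod.total

theorem universalIncl_act : (doubleLie L₀).X ◁ universalIncl L₀ Ld ≫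
    (universalObj L₀ Ld).right.act =
      connectionCocycle L₀ Ld ≫ (universalObj L₀ Ld).one.f +
        (doubleDual L₀ Ld).act ≫ universalIncl L₀ Ld := by
  have h : (doubleLie L₀).X ◁ (biprod.inr : _ ⟶ 𝟙_ (Cpx S) ⊞ (doubleDual L₀ Ld).M) ≫
      (doubleLie L₀).X ◁ biprod.snd = 𝟙 _ := by
    rw [← whiskerLeft_comp]
    simp
  exact ((reassoc_of% h) _)

/-- The splitting of the unit of the universal object, in supercomplexes. -/
def universalSplitting : UnitSplitting (universalObj L₀ Ld).one.f where
  N := (doubleDual L₀ Ld).M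
  v := universalRetr L₀ Ld
  i := universalIncl L₀ Ld
  q := (universalProj L₀ Ld).f
  u_v := unit_retr L₀ Ld
  i_q := incl_proj L₀ Ld
  u_q := unit_proj L₀ Ld
  i_v := incl_retr L₀ Ld
  total := universal_total L₀ Ld

/-- The splitting of the underlying unital object. -/
def UnitSplitting.forget {C : Type u} [Category.{v} C] [Preadditive C] [MonoidalCategory C]
    [MonoidalPreadditive C] [SymmetricCategory C] {L : LieObj C} {M : LieMod L}
    {u : 𝟙_ (LieMod L) ⟶ M} (D : UnitSplitting u) : UnitSplitting u.f where
  N := D.N.M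
  v := D.v.f
  i := D.i.f
  q := D.q.f
  u_v := congrArg LieMod.Hom.f D.u_v
  i_q := congrArg LieMod.Hom.f D.i_q
  u_q := congrArg LieMod.Hom.f D.u_q
  i_v := congrArg LieMod.Hom.f D.i_v
  total := congrArg LieMod.Hom.f D.total

/-- Transport of a splitting along an isomorphism of unital objects. -/
def UnitSplitting.ofIso {C : Type u} [Category.{v} C] [Preadditive C] [MonoidalCategory C]
    {M M' : C} {u : 𝟙_ C ⟶ M} {u' : 𝟙_ C ⟶ M'} (D : UnitSplitting u) (f : M ⟶ M') (g : M' ⟶ M)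
    (hfg : f ≫ g = 𝟙 _) (hgf : g ≫ f = 𝟙 _) (hu : u ≫ f = u') : UnitSplitting u' where
  N := D.N
  v := g ≫ D.v
  i := D.i ≫ f
  q := g ≫ D.q
  u_v := by rw [← hu, Category.assoc, reassoc_of% hfg, D.u_v]
  i_q := by rw [Category.assoc, reassoc_of% hfg, D.i_q]
  u_q := by rw [← hu, Category.assoc, reassoc_of% hfg, D.u_q]
  i_v := by rw [Category.assoc, reassoc_of% hfg, D.i_v]
  total := by
    have h := g ≫= D.total =≫ f
    simpa [hu, hgf, Preadditive.add_comp, Preadditive.comp_add] using h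

/-- The scalars `D`, as a trivial module. -/
def scalars : LMod L₀ := LieMod.trivial (doubleLie L₀) (doubling S)

/-- The unit of the scalars. -/
def scalarsUnit : 𝟙_ (LMod L₀) ⟶ scalars L₀ where
  f := η[doubling S]
  comm := comp_zero.trans zero_comp.symm

/-- The multiplication of `D ⊗ L₀*` by scalars. -/
def scalarsMul : scalars L₀ ⊗ doubleDual L₀ Ld ⟶ doubleDual L₀ Ld :=
  LieMod.baseChangeMul (doubling S) (coadjointCpx L₀ Ld)

theorem scalarsUnit_mul : (λ_ (doubleDual L₀ Ld)).inv ≫ scalarsUnit L₀ ▷ doubleDual L₀ Ld ≫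
    scalarsMul L₀ Ld = 𝟙 (doubleDual L₀ Ld) :=
  LieMod.hom_ext (LieMod.one_baseChangeMul (doubling S) (coadjointCpx L₀ Ld))

/-- A morphism from the universal object that kills the unit is contractible. -/
theorem exists_contraction {X : LMod L₀} (ψ : (universalObj L₀ Ld).right ⟶ X)
    (hψ : (universalObj L₀ Ld).one ≫ ψ = 0) :
    ∃ h : scalars L₀ ⊗ (universalObj L₀ Ld).right ⟶ X,
      scalars L₀ ◁ (universalObj L₀ Ld).one ≫ h = 0 ∧
        (λ_ _).inv ≫ scalarsUnit L₀ ▷ (universalObj L₀ Ld).right ≫ h = ψ := by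
  let π := universalProj L₀ Ld
  have hf : (universalObj L₀ Ld).one.f ≫ ψ.f = 0 := congrArg LieMod.Hom.f hψ
  have hψf : π.f ≫ universalIncl L₀ Ld ≫ ψ.f = ψ.f := by
    have h := universal_total L₀ Ld =≫ ψ.f
    rwa [Preadditive.add_comp, Category.assoc, hf, comp_zero, zero_add, Category.id_comp,
      Category.assoc] at h
  -- The inclusion of D ⊗ L₀* fails to be L-linear only by the cocycle times the unit, and `ψ` kills
  -- the unit.
  let φ : doubleDual L₀ Ld ⟶ X := ⟨universalIncl L₀ Ld ≫ ψ.f, by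
    rw [whiskerLeft_comp, Category.assoc, ψ.comm, ← Category.assoc, universalIncl_act,
      Preadditive.add_comp, Category.assoc, hf, comp_zero, zero_add, Category.assoc]⟩
  have hφ : π ≫ φ = ψ := LieMod.hom_ext hψf
  -- The contraction multiplies by scalars of D in D ⊗ L₀* before applying `φ`; the scalar 1 gives
  -- back `ψ`.
  refine ⟨scalars L₀ ◁ π ≫ scalarsMul L₀ Ld ≫ φ, ?_, ?_⟩
  · have h : (universalObj L₀ Ld).one ≫ π = 0 := LieMod.hom_ext (unit_proj L₀ Ld)
    rw [← whiskerLeft_comp_assoc, h]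
    simp
  · rw [← whisker_exchange_assoc, ← leftUnitor_inv_naturality_assoc,
      reassoc_of% (scalarsUnit_mul L₀ Ld), hφ]

end Universal

/-! ### Morphisms of supercomplexes out of D ⊗ V. -/

section DoublingMaps

open Supercategory

variable {S : Type u} [Category.{v} S] [Abelian S] [MonoidalCategory S] [SymmetricCategory S]
  [MonoidalPreadditive S] [Linear ℚ S] [MonoidalLinear ℚ S] [HasLimits S] [WellPowered.{v} S]
  [Supercategory S]

/-- The differential of a supercomplex. -/
def Cpx.d (Y : Cpx S) : P ⊗ Y.M ⟶ Y.M := Y.act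

/-- The zero bracket makes d² equal to its own swap, which is -d² since P is odd; thus 2d² = 0, and
2 is invertible. -/
theorem Cpx.d_comp_d (Y : Cpx S) : (P : S) ◁ Y.d ≫ Y.d = 0 := by
  have h := Y.act_bracket
  have h₀ : (oddLie S).bracket = 0 := rfl
  rw [h₀, MonoidalPreadditive.zero_whiskerRight, zero_comp, comp_zero] at h
  have h₁ : (P : S) ◁ Y.d ≫ Y.d - swapLeft (P : S) P Y.M ≫ (P : S) ◁ Y.d ≫ Y.d = 0 :=
    h.symm
  rw [swapLeft_odd, Preadditive.neg_comp, Category.id_comp, sub_neg_eq_add, ← two_smul ℚ] at h₁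
  exact (smul_eq_zero.1 h₁).resolve_left (by norm_num)

/-- Compatibility with the differentials, read on P ⊗ P ⊗ V. It determines `H` on I ⊗ V from its
restriction to P ⊗ V, and it is also the homotopy equation. -/
theorem leibnizAct_odd {V Y : S} (c : (P : S) ⊗ V ⟶ V) (d : (P : S) ⊗ Y ⟶ Y)
    (H : (𝟙_ S ⊞ P) ⊗ V ⟶ Y)
    (hH : P ◁ H ≫ d = leibnizAct (P ◁ biprod.snd ≫ pairing ≫ biprod.inl) c ≫ H) :
    P ◁ biprod.inr ▷ V ≫ P ◁ H ≫ d =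
      (α_ P P V).inv ≫ pairing ▷ V ≫ biprod.inl ▷ V ≫ H - P ◁ c ≫ biprod.inr ▷ V ≫ H := by
  have h₁ : P ◁ (biprod.inr : P ⟶ 𝟙_ S ⊞ P) ≫ P ◁ biprod.snd = 𝟙 _ := by
    rw [← whiskerLeft_comp]
    simp
  have h₂ : P ◁ (biprod.inr : P ⟶ 𝟙_ S ⊞ P) ▷ V ≫ (α_ P (𝟙_ S ⊞ P) V).inv ≫
      (P ◁ biprod.snd ≫ pairing ≫ (biprod.inl : 𝟙_ S ⟶ 𝟙_ S ⊞ P)) ▷ V =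
        (α_ P P V).inv ≫ pairing ▷ V ≫ (biprod.inl : 𝟙_ S ⟶ 𝟙_ S ⊞ P) ▷ V := by
    rw [associator_inv_naturality_middle_assoc, ← comp_whiskerRight, reassoc_of% h₁,
      comp_whiskerRight]
  rw [hH, leibnizAct, Preadditive.add_comp, Preadditive.comp_add, Category.assoc,
    reassoc_of% h₂, Category.assoc, reassoc_of% (swapLeft_nat₂ (P : S) (biprod.inr : P ⟶ 𝟙_ S ⊞ P) V),
    swapLeft_odd, ← whisker_exchange_assoc, Preadditive.neg_comp, Category.id_comp, sub_eq_add_neg]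

theorem doublingHom_odd {V Y : Cpx S} (H : doubling S ⊗ V ⟶ Y) :
    (P : S) ◁ biprod.inr ▷ V.M ≫ P ◁ H.f ≫ Y.d =
      (α_ P P V.M).inv ≫ pairing ▷ V.M ≫ (biprod.inl : 𝟙_ S ⟶ 𝟙_ S ⊞ P) ▷ V.M ≫ H.f -
        P ◁ V.d ≫ (biprod.inr : P ⟶ 𝟙_ S ⊞ P) ▷ V.M ≫ H.f :=
  leibnizAct_odd V.d Y.d H.f H.comm

theorem whiskerRight_biprod_ext {V Y : S} {f g : (𝟙_ S ⊞ P) ⊗ V ⟶ Y}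
    (h : (biprod.inl : 𝟙_ S ⟶ 𝟙_ S ⊞ P) ▷ V ≫ f = (biprod.inl : 𝟙_ S ⟶ 𝟙_ S ⊞ P) ▷ V ≫ g)
    (h' : (biprod.inr : P ⟶ 𝟙_ S ⊞ P) ▷ V ≫ f = (biprod.inr : P ⟶ 𝟙_ S ⊞ P) ▷ V ≫ g) : f = g := by
  have ht : (biprod.fst : 𝟙_ S ⊞ P ⟶ _) ▷ V ≫ (biprod.inl : _ ⟶ 𝟙_ S ⊞ P) ▷ V +
      (biprod.snd : 𝟙_ S ⊞ P ⟶ _) ▷ V ≫ (biprod.inr : _ ⟶ 𝟙_ S ⊞ P) ▷ V = 𝟙 _ := by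
    rw [← comp_whiskerRight, ← comp_whiskerRight, ← MonoidalPreadditive.add_whiskerRight,
      biprod.total, id_whiskerRight]
  rw [← Category.id_comp f, ← Category.id_comp g, ← ht, Preadditive.add_comp,
    Preadditive.add_comp, Category.assoc, Category.assoc, Category.assoc, Category.assoc, h, h']

/-- A morphism of supercomplexes out of `D ⊗ V` is determined by its restriction to `P ⊗ V`. -/
theorem doublingHom_eq_zero {V Y : Cpx S} (H : doubling S ⊗ V ⟶ Y)
    (h : (biprod.inr : P ⟶ 𝟙_ S ⊞ P) ▷ V.M ≫ H.f = 0) : H = 0 := by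
  have h₁ := doublingHom_odd H
  have h₂ : (P : S) ◁ (biprod.inr : P ⟶ 𝟙_ S ⊞ P) ▷ V.M ≫ P ◁ H.f = 0 := by
    refine (whiskerLeft_comp _ _ _).symm.trans ?_
    rw [h]
    simp
  rw [reassoc_of% h₂, h, zero_comp, comp_zero, sub_zero] at h₁
  have h₃ : (biprod.inl : 𝟙_ S ⟶ 𝟙_ S ⊞ P) ▷ V.M ≫ H.f = 0 := by
    rw [← cancel_epi ((α_ (P : S) P V.M).inv ≫ pairing ▷ V.M), comp_zero, Category.assoc]
    exact h₁.symm
  refine LieMod.hom_ext (whiskerRight_biprod_ext ?_ ?_)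
  · exact h₃.trans comp_zero.symm
  · exact h.trans comp_zero.symm

/-- On I ⊗ V the value is forced: I is identified with P ⊗ P, and the differential is applied to
`t`. Compatibility then reduces to d² = 0. -/
theorem leibnizAct_extend {V Y : S} (d : (P : S) ⊗ Y ⟶ Y) (hd : (P : S) ◁ d ≫ d = 0)
    (t : P ⊗ V ⟶ Y) (H : (𝟙_ S ⊞ P) ⊗ V ⟶ Y)
    (hH : H = (biprod.fst : 𝟙_ S ⊞ P ⟶ _) ▷ V ≫ inv (pairing (S := S)) ▷ V ≫ (α_ P P V).hom ≫
      P ◁ t ≫ d + (biprod.snd : 𝟙_ S ⊞ P ⟶ _) ▷ V ≫ t) :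
    P ◁ H ≫ d =
      leibnizAct ((P : S) ◁ (biprod.snd : 𝟙_ S ⊞ P ⟶ _) ≫ pairing ≫ biprod.inl)
        (0 : P ⊗ V ⟶ V) ≫ H := by
  have h : (P : S) ◁ P ◁ t ≫ P ◁ d ≫ d = 0 := by rw [hd, comp_zero]
  have h₁ : pairing (S := S) ▷ V ≫ inv (pairing (S := S)) ▷ V = 𝟙 _ := by
    rw [← comp_whiskerRight]
    simp
  have h₂ : (biprod.inl : 𝟙_ S ⟶ 𝟙_ S ⊞ P) ▷ V ≫ (biprod.fst : 𝟙_ S ⊞ P ⟶ _) ▷ V = 𝟙 _ := by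
    rw [← comp_whiskerRight]
    simp
  have h₃ : (biprod.inl : 𝟙_ S ⟶ 𝟙_ S ⊞ P) ▷ V ≫ (biprod.snd : 𝟙_ S ⊞ P ⟶ _) ▷ V = 0 := by
    rw [← comp_whiskerRight]
    simp
  subst hH
  simp only [leibnizAct, MonoidalPreadditive.whiskerLeft_add, Preadditive.add_comp,
    Preadditive.comp_add, whiskerLeft_comp, comp_whiskerRight, Category.assoc, h, comp_zero,
    MonoidalPreadditive.whiskerLeft_zero, zero_comp, reassoc_of% h₁, reassoc_of% h₂,
    reassoc_of% h₃]
  simp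

/-- An odd morphism out of `V` extends to a morphism of supercomplexes out of `D ⊗ V`. -/
theorem exists_doublingHom {V : S} {Y : Cpx S} (t : P ⊗ V ⟶ Y.M) :
    ∃ H : doubling S ⊗ LieMod.trivial (oddLie S) V ⟶ Y,
      (biprod.inr : P ⟶ 𝟙_ S ⊞ P) ▷ V ≫ H.f = t := by
  refine ⟨⟨_, leibnizAct_extend Y.d Y.d_comp_d t _ rfl⟩, ?_⟩
  have h₁ : (biprod.inr : P ⟶ 𝟙_ S ⊞ P) ▷ V ≫ (biprod.fst : 𝟙_ S ⊞ P ⟶ _) ▷ V = 0 := by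
    rw [← comp_whiskerRight]
    simp
  have h₂ : (biprod.inr : P ⟶ 𝟙_ S ⊞ P) ▷ V ≫ (biprod.snd : 𝟙_ S ⊞ P ⟶ _) ▷ V = 𝟙 _ := by
    rw [← comp_whiskerRight]
    simp
  change (biprod.inr : P ⟶ 𝟙_ S ⊞ P) ▷ V ≫ (_ + _) = t
  rw [Preadditive.comp_add, reassoc_of% h₁, reassoc_of% h₂, zero_comp, zero_add]

end DoublingMaps

/-! ### The universal object represents connections. -/

section Corepresentability

open Supercategory

section TensorMu

variable {C : Type u} [Category.{v} C] [MonoidalCategory C] [SymmetricCategory C]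

theorem whisker_tensorμ {A A' B B' : C} (a : A ⟶ A') (b : B ⟶ B') (L V : C) :
    a ▷ L ▷ (B ⊗ V) ≫ (A' ⊗ L) ◁ b ▷ V ≫ tensorμ A' L B' V =
      tensorμ A L B V ≫ (a ⊗ₘ b) ▷ (L ⊗ V) := by
  have h := tensorμ_natural a (𝟙 L) b (𝟙 V)
  rw [tensorHom_id, tensorHom_id, MonoidalCategory.tensorHom_def, Category.assoc,
    id_tensorHom_id, tensorHom_id] at h
  exact h

theorem leftUnitor_inv_tensorμ {L V W : C} (B : C) (c : L ⊗ V ⟶ W) :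
    (λ_ L).inv ▷ (B ⊗ V) ≫ tensorμ (𝟙_ C) L B V ≫ ((λ_ B).hom ⊗ₘ c) =
      swapLeft L B V ≫ B ◁ c := by
  simp [tensorμ, swapLeft, MonoidalCategory.tensorHom_def]

end TensorMu

variable {S : Type u} [Category.{v} S] [Abelian S] [MonoidalCategory S] [SymmetricCategory S]
  [MonoidalPreadditive S] [Linear ℚ S] [MonoidalLinear ℚ S] [HasLimits S] [WellPowered.{v} S]
  [Supercategory S]

theorem inl_inr_doublingMul : ((biprod.inl : 𝟙_ S ⟶ 𝟙_ S ⊞ P) ⊗ₘ biprod.inr) ≫ doublingMul =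
    (λ_ P).hom ≫ biprod.inr := by
  apply doubling_ext <;> simp [Preadditive.comp_add, tensorHom_comp_tensorHom_assoc]

theorem inr_inr_doublingMul : ((biprod.inr : P ⟶ 𝟙_ S ⊞ P) ⊗ₘ biprod.inr) ≫ doublingMul = 0 := by
  apply doubling_ext <;> simp [Preadditive.comp_add, tensorHom_comp_tensorHom_assoc]

section Components

variable {L V : S} (c : L ⊗ V ⟶ V) (t : L ⊗ V ⟶ 𝟙_ S)

/-- This and the next three lemmas compute the action and the form on P ⊗ V for the even and odd
parts of L: 1·P = P and P·P = 0 in D, while the form is nonzero only between odd parts. -/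
theorem even_act : ((λ_ L).inv ≫ (biprod.inl : _ ⟶ 𝟙_ S ⊞ P) ▷ L) ▷ (P ⊗ V) ≫
    ((𝟙_ S ⊞ P) ⊗ L) ◁ (biprod.inr : P ⟶ 𝟙_ S ⊞ P) ▷ V ≫
      tensorμ (𝟙_ S ⊞ P) L (𝟙_ S ⊞ P) V ≫ (doublingMul ⊗ₘ c) =
    swapLeft L P V ≫ P ◁ c ≫ (biprod.inr : P ⟶ 𝟙_ S ⊞ P) ▷ V := by
  rw [comp_whiskerRight, Category.assoc, reassoc_of% @whisker_tensorμ,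
    ← tensorHom_id (_ ⊗ₘ _),
    tensorHom_comp_tensorHom, inl_inr_doublingMul, Category.id_comp,
    ← reassoc_of% (leftUnitor_inv_tensorμ P c),
    ← tensorHom_id (biprod.inr : P ⟶ 𝟙_ S ⊞ P), tensorHom_comp_tensorHom, Category.comp_id]

theorem odd_act : (biprod.inr : P ⟶ 𝟙_ S ⊞ P) ▷ L ▷ (P ⊗ V) ≫
    ((𝟙_ S ⊞ P) ⊗ L) ◁ (biprod.inr : P ⟶ 𝟙_ S ⊞ P) ▷ V ≫
      tensorμ (𝟙_ S ⊞ P) L (𝟙_ S ⊞ P) V ≫ (doublingMul ⊗ₘ c) = 0 := by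
  rw [reassoc_of% @whisker_tensorμ, ← tensorHom_id,
    tensorHom_comp_tensorHom, inr_inr_doublingMul]
  simp

theorem even_form : ((λ_ L).inv ≫ (biprod.inl : _ ⟶ 𝟙_ S ⊞ P) ▷ L) ▷ (P ⊗ V) ≫
    ((𝟙_ S ⊞ P) ⊗ L) ◁ (biprod.inr : P ⟶ 𝟙_ S ⊞ P) ▷ V ≫
      tensorμ (𝟙_ S ⊞ P) L (𝟙_ S ⊞ P) V ≫
        (((biprod.snd ⊗ₘ biprod.snd) ≫ pairing) ⊗ₘ t) ≫ (λ_ (𝟙_ S)).hom = 0 := by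
  rw [comp_whiskerRight, Category.assoc, reassoc_of% @whisker_tensorμ,
    ← tensorHom_id (_ ⊗ₘ _),
    tensorHom_comp_tensorHom_assoc, tensorHom_comp_tensorHom_assoc]
  simp

theorem odd_form : (biprod.inr : P ⟶ 𝟙_ S ⊞ P) ▷ L ▷ (P ⊗ V) ≫
    ((𝟙_ S ⊞ P) ⊗ L) ◁ (biprod.inr : P ⟶ 𝟙_ S ⊞ P) ▷ V ≫
      tensorμ (𝟙_ S ⊞ P) L (𝟙_ S ⊞ P) V ≫
        (((biprod.snd ⊗ₘ biprod.snd) ≫ pairing) ⊗ₘ t) ≫ (λ_ (𝟙_ S)).hom =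
      tensorμ P L P V ≫ (pairing ⊗ₘ t) ≫ (λ_ (𝟙_ S)).hom := by
  rw [reassoc_of% @whisker_tensorμ, ← tensorHom_id,
    tensorHom_comp_tensorHom_assoc, tensorHom_comp_tensorHom_assoc]
  simp

end Components

variable {L₀ : LieObj S} {Ld : S} [ExactPairing L₀.X Ld]

/-- The failure of a morphism of supercomplexes `D ⊗ L₀* ⟶ Y` to commute with the action of `L` on
the universal object. -/
def connectionDefect {Y : UnitalObj L₀} (H : (doubleDual L₀ Ld).M ⟶ Y.right.M) :
    (doubleLie L₀).X ⊗ (doubleDual L₀ Ld).M ⟶ Y.right.M :=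
  (doubleLie L₀).X ◁ H ≫ Y.right.act -
    (connectionCocycle L₀ Ld ≫ Y.one.f + (doubleDual L₀ Ld).act ≫ H)

/-- The morphism of `S` underlying a morphism of supercomplexes out of `D ⊗ L₀*`. -/
def doubleDualMor {Y : Cpx S} (H : (doubleDual L₀ Ld).M ⟶ Y) : (𝟙_ S ⊞ P) ⊗ Ld ⟶ Y.M := H.f

/-- The restriction to `P ⊗ L₀*` of a morphism of supercomplexes out of `D ⊗ L₀*`. -/
def oddPart {Y : Cpx S} (H : (doubleDual L₀ Ld).M ⟶ Y) : P ⊗ Ld ⟶ Y.M :=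
  (biprod.inr : P ⟶ 𝟙_ S ⊞ P) ▷ Ld ≫ doubleDualMor H

variable {Y : UnitalObj L₀} (H : (doubleDual L₀ Ld).M ⟶ Y.right.M)

/-- The morphism of `S` underlying the defect. -/
def connectionDefectMor : ((𝟙_ S ⊞ P) ⊗ L₀.X) ⊗ ((𝟙_ S ⊞ P) ⊗ Ld) ⟶ Y.right.obj :=
  (connectionDefect H).f

theorem connectionDefectMor_eq : connectionDefectMor H =
    ((𝟙_ S ⊞ P) ⊗ L₀.X) ◁ doubleDualMor H ≫ Y.right.action -
      ((tensorμ (𝟙_ S ⊞ P) L₀.X (𝟙_ S ⊞ P) Ld ≫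
        (((biprod.snd ⊗ₘ biprod.snd) ≫ pairing) ⊗ₘ dualPairing L₀ Ld) ≫ (λ_ (𝟙_ S)).hom) ≫ Y.unit +
      (tensorμ (𝟙_ S ⊞ P) L₀.X (𝟙_ S ⊞ P) Ld ≫ (doublingMul ⊗ₘ coadjoint L₀ Ld)) ≫
        doubleDualMor H) := by
  rw [MonoidalCategory.tensorHom_def (doublingMul (S := S)),
    MonoidalCategory.tensorHom_def (_ ≫ pairing)]
  exact LieMod.sub_f _ _

theorem even_connectionDefect :
    ((λ_ L₀.X).inv ≫ (biprod.inl : _ ⟶ 𝟙_ S ⊞ P) ▷ L₀.X) ▷ (P ⊗ Ld) ≫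
      ((𝟙_ S ⊞ P) ⊗ L₀.X) ◁ (biprod.inr : P ⟶ 𝟙_ S ⊞ P) ▷ Ld ≫ connectionDefectMor H =
    L₀.X ◁ oddPart H ≫ Y.right.evenAction - swapLeft L₀.X P Ld ≫ P ◁ coadjoint L₀ Ld ≫ oddPart H := by
  have h₁ := even_act (coadjoint L₀ Ld)
  have h₂ := even_form (dualPairing L₀ Ld)
  rw [connectionDefectMor_eq]
  simp only [Preadditive.comp_sub, Preadditive.comp_add, Category.assoc, reassoc_of% h₁,
    reassoc_of% h₂, zero_comp, zero_add, oddPart, LMod.evenAction, whiskerLeft_comp,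
    ← whisker_exchange_assoc]

theorem odd_connectionDefect :
    (biprod.inr : P ⟶ 𝟙_ S ⊞ P) ▷ L₀.X ▷ (P ⊗ Ld) ≫
      ((𝟙_ S ⊞ P) ⊗ L₀.X) ◁ (biprod.inr : P ⟶ 𝟙_ S ⊞ P) ▷ Ld ≫ connectionDefectMor H =
    (P ⊗ L₀.X) ◁ oddPart H ≫ Y.right.oddAction - oddEvaluation L₀ Ld ≫ Y.unit := by
  have h₁ := odd_act (coadjoint L₀ Ld)
  have h₂ := odd_form (dualPairing L₀ Ld)
  rw [connectionDefectMor_eq]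
  simp only [Preadditive.comp_sub, Preadditive.comp_add, Category.assoc, reassoc_of% h₁,
    reassoc_of% h₂, zero_comp, add_zero]
  simp only [oddPart, LMod.oddAction, whiskerLeft_comp,
    ← whisker_exchange_assoc, oddEvaluation, dualPairing,
    Category.assoc]

/-- L-linearity up to the cocycle need only be checked on P ⊗ L₀*. There the even and the odd part
of L give respectively the equivariance and the contraction axiom. -/
theorem connectionDefect_eq_zero_iff : connectionDefect H = 0 ↔
    L₀.X ◁ oddPart H ≫ Y.right.evenAction =
      swapLeft L₀.X P Ld ≫ P ◁ coadjoint L₀ Ld ≫ oddPart H ∧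
    (P ⊗ L₀.X) ◁ oddPart H ≫ Y.right.oddAction = oddEvaluation L₀ Ld ≫ Y.unit := by
  rw [← sub_eq_zero (a := L₀.X ◁ oddPart H ≫ _), ← sub_eq_zero (a := (P ⊗ L₀.X) ◁ oddPart H ≫ _),
    ← even_connectionDefect, ← odd_connectionDefect]
  constructor
  · intro h
    have h' : connectionDefectMor H = 0 := congrArg LieMod.Hom.f h
    simp [h']
  · rintro ⟨h₁, h₂⟩
    have h₃ : ((𝟙_ S ⊞ P) ⊗ L₀.X) ◁ (biprod.inr : P ⟶ 𝟙_ S ⊞ P) ▷ Ld ≫ connectionDefectMor H = 0 := by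
      rw [← cancel_epi (α_ (𝟙_ S ⊞ P) L₀.X (P ⊗ Ld)).inv, comp_zero]
      apply whiskerRight_biprod_ext
      · rw [comp_whiskerRight, Category.assoc] at h₁
        have h₁' := (cancel_epi ((λ_ L₀.X).inv ▷ (P ⊗ Ld))).1 (h₁.trans comp_zero.symm)
        rw [associator_inv_naturality_left_assoc, h₁']
        simp
      · rw [associator_inv_naturality_left_assoc, h₂]
        simp
    -- Moving the D of D ⊗ L₀* to the front exhibits the defect as a morphism out of some D ⊗ V,
    -- which vanishes as soon as it does on P ⊗ V.
    have h₄ : swapLeft (doubling S) (doubleLie L₀).X (LieMod.trivial (oddLie S) Ld) ≫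
        connectionDefect H = 0 := by
      apply doublingHom_eq_zero
      have h := swapLeft_nat₁ (biprod.inr : P ⟶ 𝟙_ S ⊞ P) ((𝟙_ S ⊞ P) ⊗ L₀.X) Ld
      have h' := reassoc_of% h
      refine (h' (connectionDefectMor H)).trans ?_
      rw [h₃, comp_zero]
      rfl
    exact (cancel_epi (swapLeft (doubling S) (doubleLie L₀).X
      (LieMod.trivial (oddLie S) Ld))).1 (h₄.trans comp_zero.symm)

/-- The universal connection. -/
def universalConnection : Connection Ld (universalObj L₀ Ld) where
  θ := oddPart (universalIncl L₀ Ld)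
  equivariant := ((connectionDefect_eq_zero_iff (universalIncl L₀ Ld)).1
    (sub_eq_zero.2 (universalIncl_act L₀ Ld))).1
  contraction := ((connectionDefect_eq_zero_iff (universalIncl L₀ Ld)).1
    (sub_eq_zero.2 (universalIncl_act L₀ Ld))).2

theorem exists_universalHom (c : Connection Ld Y) :
    ∃ f : universalObj L₀ Ld ⟶ Y, universalConnection.map f = c := by
  obtain ⟨H, hH⟩ : ∃ H : (doubleDual L₀ Ld).M ⟶ Y.right.M, oddPart H = c.θ :=
    exists_doublingHom (Y := Y.right.M) c.θ
  have hδ : connectionDefect H = 0 :=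
    (connectionDefect_eq_zero_iff H).2 (by rw [hH]; exact ⟨c.equivariant, c.contraction⟩)
  -- Both summands are prescribed: the unit must go to the unit of `Y`, and D ⊗ L₀* maps by `H`.
  obtain ⟨φ, hφ⟩ : ∃ φ, φ = universalRetr L₀ Ld ≫ Y.one.f + (universalProj L₀ Ld).f ≫ H := ⟨_, rfl⟩
  have hu : (universalObj L₀ Ld).one.f ≫ φ = Y.one.f := by
    rw [hφ, Preadditive.comp_add, reassoc_of% (unit_retr L₀ Ld), reassoc_of% (unit_proj L₀ Ld)]
    simp
  have hi : universalIncl L₀ Ld ≫ φ = H := by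
    rw [hφ, Preadditive.comp_add, reassoc_of% (incl_retr L₀ Ld), reassoc_of% (incl_proj L₀ Ld)]
    simp
  have hcomm : (doubleLie L₀).X ◁ φ ≫ Y.right.act = (universalObj L₀ Ld).right.act ≫ φ := by
    apply (universalSplitting L₀ Ld).hom_ext
    · rw [← whiskerLeft_comp_assoc, hu, SymTensor.unit_act, reassoc_of% SymTensor.unit_act (universalObj L₀ Ld).one,
        zero_comp]
    · have h₁ : (doubleLie L₀).X ◁ universalIncl L₀ Ld ≫ (doubleLie L₀).X ◁ φ ≫ Y.right.act =
          (doubleLie L₀).X ◁ H ≫ Y.right.act := by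
        rw [← whiskerLeft_comp_assoc, hi]
      have h₂ : (doubleLie L₀).X ◁ universalIncl L₀ Ld ≫ (universalObj L₀ Ld).right.act ≫ φ =
          connectionCocycle L₀ Ld ≫ Y.one.f + (doubleDual L₀ Ld).act ≫ H := by
        rw [reassoc_of% (universalIncl_act L₀ Ld), Preadditive.add_comp, Category.assoc,
          Category.assoc, hu, hi]
      exact h₁.trans ((sub_eq_zero.1 hδ).trans h₂.symm)
  let f : (universalObj L₀ Ld).right ⟶ Y.right := ⟨φ, hcomm⟩
  refine ⟨Under.homMk f (LieMod.hom_ext hu), Connection.ext ?_⟩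
  rw [← hH, ← hi]
  exact Category.assoc _ _ _

theorem universalHom_ext {f g : universalObj L₀ Ld ⟶ Y}
    (h : universalConnection.map f = universalConnection.map g) : f = g := by
  have h₀ : universalIncl L₀ Ld ≫ (f.right - g.right).f = 0 := by
    apply doublingHom_eq_zero (V := LieMod.trivial (oddLie S) Ld)
    have h₁ : oddPart (universalIncl L₀ Ld) ≫ LMod.mor f.right =
      oddPart (universalIncl L₀ Ld) ≫ LMod.mor g.right := congrArg Connection.θ h
    have h₂ := sub_eq_zero.2 h₁
    rw [← Preadditive.comp_sub, oddPart, Category.assoc] at h₂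
    rw [LieMod.comp_f, LieMod.sub_f, LieMod.sub_f]
    exact h₂
  have h₁ : (universalObj L₀ Ld).one ≫ f.right = (universalObj L₀ Ld).one ≫ g.right :=
    (Under.w f).trans (Under.w g).symm
  have h₂ : (universalObj L₀ Ld).one.f ≫ (f.right - g.right).f = 0 := by
    rw [← LieMod.comp_f, Preadditive.comp_sub, h₁, sub_self]
    rfl
  ext1
  rw [← sub_eq_zero]
  apply LieMod.hom_ext
  have h₃ := universal_total L₀ Ld =≫ (f.right - g.right).f
  rw [Preadditive.add_comp, Category.assoc, Category.assoc, h₀, h₂, comp_zero, comp_zero,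
    add_zero, Category.id_comp] at h₃
  exact h₃.symm

variable (L₀ Ld) in
/-- The universal object represents connections. -/
def universalRep : (connectionFunctor L₀ Ld).CorepresentableBy (universalObj L₀ Ld) where
  homEquiv := Equiv.ofBijective (fun f => universalConnection.map f)
    ⟨fun _ _ h => universalHom_ext h, exists_universalHom⟩
  homEquiv_comp _ _ := Connection.ext (Category.assoc _ _ _).symm

end Corepresentability

/-! ### The homotopy from the identity to symmetrization. -/

section SymmetrizationHomotopy

namespace SymTensor

variable {C : Type u} [Category.{v} C] [Preadditive C] [MonoidalCategory C]
  [MonoidalPreadditive C] [SymmetricCategory C] {M : C} {u : 𝟙_ C ⟶ M} (A : SymTensor u)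

/-- The difference of the two inclusions of the generators into `T ⊗ T`. -/
def inclDiff : M ⟶ A.T ⊗ A.T :=
  (ρ_ M).inv ≫ (A.j ⊗ₘ A.o) - (λ_ M).inv ≫ (A.o ⊗ₘ A.j)

theorem u_inclDiff : u ≫ A.inclDiff = 0 := by
  have h₁ : u ≫ (ρ_ M).inv ≫ (A.j ⊗ₘ A.o) = (ρ_ _).inv ≫ (A.o ⊗ₘ A.o) := by
    rw [rightUnitor_inv_naturality_assoc, ← tensorHom_id, tensorHom_comp_tensorHom, u_j,
      Category.id_comp]
  have h₂ : u ≫ (λ_ M).inv ≫ (A.o ⊗ₘ A.j) = (λ_ _).inv ≫ (A.o ⊗ₘ A.o) := by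
    rw [leftUnitor_inv_naturality_assoc, ← id_tensorHom, tensorHom_comp_tensorHom, u_j,
      Category.id_comp]
  rw [inclDiff, Preadditive.comp_sub, h₁, h₂, unitors_inv_equal, sub_self]

theorem mul_inclDiff : A.T ◁ A.inclDiff ≫ (α_ A.T A.T A.T).inv ≫ A.mul ▷ A.T =
    A.s ≫ (ρ_ A.T).inv ≫ A.T ◁ A.o - A.T ◁ A.j := by
  have h₁ : A.T ◁ ((ρ_ M).inv ≫ (A.j ⊗ₘ A.o)) ≫ (α_ A.T A.T A.T).inv ≫ A.mul ▷ A.T =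
      A.s ≫ (ρ_ A.T).inv ≫ A.T ◁ A.o := by
    rw [MonoidalCategory.tensorHom_def']
    simp only [whiskerLeft_comp, Category.assoc, associator_inv_naturality_middle_assoc,
      associator_inv_naturality_right_assoc, ← comp_whiskerRight, j_mul]
    rw [whisker_exchange, rightUnitor_inv_naturality_assoc]
    simp
  have h₂ : A.T ◁ ((λ_ M).inv ≫ (A.o ⊗ₘ A.j)) ≫ (α_ A.T A.T A.T).inv ≫ A.mul ▷ A.T =
      A.T ◁ A.j := by
    rw [MonoidalCategory.tensorHom_def']
    simp only [whiskerLeft_comp, Category.assoc, associator_inv_naturality_middle_assoc,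
      associator_inv_naturality_right_assoc, ← comp_whiskerRight, o_mul]
    rw [whisker_exchange]
    simp
  rw [inclDiff, whiskerLeft_sub, Preadditive.sub_comp, h₁, h₂]

/-- `hD` contracts the universal derivation on generators, and recursion extends the contraction to
the whole algebra. About `e` only `o_e` is used. -/
theorem exists_homotopy {D : C} (η' : 𝟙_ C ⟶ D)
    (hD : ∀ {Z : C} (ψ : M ⟶ Z), u ≫ ψ = 0 →
      ∃ h : D ⊗ M ⟶ Z, D ◁ u ≫ h = 0 ∧ (λ_ M).inv ≫ η' ▷ M ≫ h = ψ) :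
    ∃ H : D ⊗ A.T ⟶ A.T, (λ_ A.T).inv ≫ η' ▷ A.T ≫ H = 𝟙 _ - A.e := by
  obtain ⟨h, hu, hψ⟩ := hD A.inclDiff A.u_inclDiff
  -- A ⊗ A is a bimodule: `f` multiplies the second factor on the right, while t·h(m) multiplies the
  -- first on the left. So `r` is a derivation into this bimodule with parameter D.
  let f : (A.T ⊗ A.T) ⊗ M ⟶ A.T ⊗ A.T := (α_ _ _ _).hom ≫ A.T ◁ A.s
  obtain ⟨r, h₀, hs⟩ := A.exists_rec (X := D) 0 f
    (swapLeft D A.T M ≫ A.T ◁ h ≫ (α_ _ _ _).inv ≫ A.mul ▷ A.T)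
    (by
      rw [associator_naturality_right_assoc, ← whiskerLeft_comp, s_unit]
      simp)
    (by
      rw [reassoc_of% (swapLeft_nat₃ D A.T u), ← whiskerLeft_comp_assoc, hu]
      simp)
  -- Over the unit of D both `r` and t ↦ t ⊗ 1 - 1 ⊗ t solve the recursion with term tm ⊗ 1 - t ⊗ m.
  have hr : η' ▷ A.T ≫ r =
      (λ_ _).hom ≫ ((ρ_ A.T).inv ≫ A.T ◁ A.o - (λ_ A.T).inv ≫ A.o ▷ A.T) := by
    have hη : η' ▷ M ≫ h = (λ_ M).hom ≫ A.inclDiff := by rw [← hψ, Iso.hom_inv_id_assoc]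
    have hG : η' ▷ (A.T ⊗ M) ≫ swapLeft D A.T M ≫ A.T ◁ h ≫ (α_ _ _ _).inv ≫ A.mul ▷ A.T =
        (λ_ _).hom ≫ (A.s ≫ (ρ_ A.T).inv ≫ A.T ◁ A.o - A.T ◁ A.j) := by
      rw [reassoc_of% (swapLeft_nat₁ η' A.T M), ← whiskerLeft_comp_assoc, hη,
        whiskerLeft_comp_assoc, mul_inclDiff]
      simp [swapLeft]
    refine A.rec_unique f
      ((λ_ _).hom ≫ (A.s ≫ (ρ_ A.T).inv ≫ A.T ◁ A.o - A.T ◁ A.j)) ?_ ?_ ?_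
    · rw [whisker_exchange_assoc, h₀, comp_zero, comp_zero, leftUnitor_naturality_assoc,
        Preadditive.comp_sub, rightUnitor_inv_naturality_assoc, leftUnitor_inv_naturality_assoc,
        unitors_inv_equal, whisker_exchange, sub_self, comp_zero]
    · rw [whisker_exchange_assoc, hs, Preadditive.comp_add, hG,
        associator_inv_naturality_left_assoc, comp_whiskerRight_assoc]
    · have e₁ : ((λ_ A.T).inv ≫ A.o ▷ A.T) ▷ M ≫ f = A.s ≫ (λ_ A.T).inv ≫ A.o ▷ A.T := by
        simp only [f, comp_whiskerRight, Category.assoc, associator_naturality_left_assoc,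
          ← whisker_exchange, leftUnitor_inv_naturality_assoc]
        simp
      have e₂ : ((ρ_ A.T).inv ≫ A.T ◁ A.o) ▷ M ≫ f = A.T ◁ A.j := by
        simp only [f, j, comp_whiskerRight, whiskerLeft_comp, Category.assoc,
          associator_naturality_middle_assoc]
        simp
      rw [leftUnitor_naturality_assoc, comp_whiskerRight, sub_whiskerRight, Category.assoc,
        Preadditive.sub_comp, e₁, e₂, Preadditive.comp_sub]
      simp only [Preadditive.comp_sub]
      simp
  -- Applying x ⊗ y ↦ x e(y) to t ⊗ 1 - 1 ⊗ t gives t - e(t), because e(1) = 1.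
  refine ⟨r ≫ A.T ◁ A.e ≫ A.mul, ?_⟩
  have e₁ : A.T ◁ A.o ≫ A.T ◁ A.e ≫ A.mul = (ρ_ _).hom := by
    rw [← whiskerLeft_comp_assoc, o_e, o_mul]
  have e₂ : A.o ▷ A.T ≫ A.T ◁ A.e ≫ A.mul = (λ_ _).hom ≫ A.e := by
    rw [← whisker_exchange_assoc]
    have h : A.o ▷ A.T ≫ A.mul = (λ_ _).hom := MonObj.one_mul A.T
    rw [h, leftUnitor_naturality]
  rw [reassoc_of% hr, Iso.inv_hom_id_assoc, Preadditive.sub_comp, Category.assoc, Category.assoc,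
    e₁, e₂]
  simp

end SymTensor

end SymmetrizationHomotopy

/-! ### Homotopies as morphisms out of D ⊗ X. -/

section Homotopies

open Supercategory

variable {S : Type u} [Category.{v} S] [Abelian S] [MonoidalCategory S] [SymmetricCategory S]
  [MonoidalPreadditive S] [Linear ℚ S] [MonoidalLinear ℚ S] [HasLimits S] [WellPowered.{v} S]
  [Supercategory S] {L₀ : LieObj S} {X Y : LMod L₀}

/-- The morphism of `S` underlying a morphism out of `D ⊗ X`. -/
def scalarsMor (H : scalars L₀ ⊗ X ⟶ Y) : (𝟙_ S ⊞ P) ⊗ X.obj ⟶ Y.obj := LMod.mor H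

theorem scalarsMor_action (H : scalars L₀ ⊗ X ⟶ Y) :
    ((𝟙_ S ⊞ P) ⊗ L₀.X) ◁ scalarsMor H ≫ Y.action =
      swapLeft ((𝟙_ S ⊞ P) ⊗ L₀.X) (𝟙_ S ⊞ P) X.obj ≫ (𝟙_ S ⊞ P) ◁ X.action ≫ scalarsMor H := by
  have h := LMod.mor_action H
  have h' : leibnizAct (0 : ((𝟙_ S ⊞ P) ⊗ L₀.X) ⊗ (𝟙_ S ⊞ P) ⟶ 𝟙_ S ⊞ P) X.action =
    swapLeft ((𝟙_ S ⊞ P) ⊗ L₀.X) (𝟙_ S ⊞ P) X.obj ≫ (𝟙_ S ⊞ P) ◁ X.action := leibnizAct_zero_left _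
  rw [← reassoc_of% h']
  exact h

/-- A morphism out of `D ⊗ X` is a homotopy. -/
def OddHomotopy.ofHom {f g : X ⟶ Y} (H : scalars L₀ ⊗ X ⟶ Y)
    (hH : (λ_ X).inv ≫ scalarsUnit L₀ ▷ X ≫ H = f - g) : OddHomotopy f g where
  h := (biprod.inr : P ⟶ 𝟙_ S ⊞ P) ▷ X.obj ≫ scalarsMor H
  comm := by
    rw [whiskerLeft_comp, Category.assoc, scalarsMor_action,
      reassoc_of% (swapLeft_nat₂ ((𝟙_ S ⊞ P) ⊗ L₀.X) (biprod.inr : P ⟶ 𝟙_ S ⊞ P) X.obj),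
      ← whisker_exchange_assoc]
  eq := by
    -- Restricted to P, compatibility of `H` with the differentials reads dh + hd = H on I ⊗ X, the
    -- sign coming from the exchange of two copies of P.
    have h₁ : P ◁ (biprod.inr : P ⟶ 𝟙_ S ⊞ P) ▷ X.obj ≫ P ◁ scalarsMor H ≫ Y.d =
      (α_ P P X.obj).inv ≫ pairing ▷ X.obj ≫ (biprod.inl : 𝟙_ S ⟶ 𝟙_ S ⊞ P) ▷ X.obj ≫ scalarsMor H -
        P ◁ X.d ≫ (biprod.inr : P ⟶ 𝟙_ S ⊞ P) ▷ X.obj ≫ scalarsMor H := doublingHom_odd H.f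
    have h₂ : (λ_ X.obj).inv ≫ (biprod.inl : 𝟙_ S ⟶ 𝟙_ S ⊞ P) ▷ X.obj ≫ scalarsMor H =
        LMod.mor f - LMod.mor g := by
      have h := congrArg LMod.mor hH
      simp only [LMod.mor, LieMod.sub_f] at h
      exact h
    rw [whiskerLeft_comp, Category.assoc, h₁, sub_add_cancel, ← h₂, Iso.hom_inv_id_assoc]

end Homotopies

/-! ### Transport to arbitrary representing objects, and conclusion. -/

section QuasiIsomorphism

open Supercategory

theorem exists_iso_of_corepresentableBy {C : Type*} [Category* C] {F : C ⥤ Type*} {X X' : C}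
    (e : F.CorepresentableBy X) (e' : F.CorepresentableBy X') :
    ∃ a : X ≅ X', e.homEquiv a.hom = e'.homEquiv (𝟙 X') := by
  have h {Z Z' : C} (e : F.CorepresentableBy Z) (e' : F.CorepresentableBy Z') :
      e.homEquiv.symm (e'.homEquiv (𝟙 Z')) ≫ e'.homEquiv.symm (e.homEquiv (𝟙 Z)) = 𝟙 Z := by
    apply e.homEquiv.injective
    rw [e.homEquiv_comp, Equiv.apply_symm_apply, ← e'.homEquiv_comp, Category.id_comp,
      Equiv.apply_symm_apply]
  exact ⟨⟨e.homEquiv.symm (e'.homEquiv (𝟙 X')), e'.homEquiv.symm (e.homEquiv (𝟙 X)), h e e', h e' e⟩,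
    Equiv.apply_symm_apply _ _⟩

variable {S : Type u} [Category.{v} S] [Abelian S] [MonoidalCategory S] [SymmetricCategory S]
  [MonoidalPreadditive S] [Linear ℚ S] [MonoidalLinear ℚ S] [HasLimits S] [WellPowered.{v} S]
  [Supercategory S] {L₀ : LieObj S} {Ld : S} [ExactPairing L₀.X Ld]

theorem exists_contraction_of_iso {M : UnitalObj L₀} (t : universalObj L₀ Ld ≅ M) {X : LMod L₀}
    (ψ : M.right ⟶ X) (hψ : M.one ≫ ψ = 0) :
    ∃ h : scalars L₀ ⊗ M.right ⟶ X, scalars L₀ ◁ M.one ≫ h = 0 ∧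
      (λ_ _).inv ≫ scalarsUnit L₀ ▷ M.right ≫ h = ψ := by
  have h₁ : (universalObj L₀ Ld).one ≫ t.hom.right = M.one := Under.w t.hom
  have h₂ : M.one ≫ t.inv.right = (universalObj L₀ Ld).one := Under.w t.inv
  have h₃ : t.inv.right ≫ t.hom.right = 𝟙 _ := congrArg (fun f => CommaMorphism.right f) t.inv_hom_id
  obtain ⟨h, hu, hh⟩ := exists_contraction L₀ Ld (t.hom.right ≫ ψ) (by rw [reassoc_of% h₁, hψ])
  refine ⟨scalars L₀ ◁ t.inv.right ≫ h, ?_, ?_⟩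
  · rw [← whiskerLeft_comp_assoc, h₂, hu]
  · rw [← whisker_exchange_assoc, ← leftUnitor_inv_naturality_assoc, hh, reassoc_of% h₃]

theorem isQuasiIsomorphism_of_homotopy {A B : Mon (LMod L₀)} (f : A ⟶ B) (g : B.X ⟶ A.X)
    (hg : g ≫ f.hom = 𝟙 _) (H : scalars L₀ ⊗ A.X ⟶ A.X)
    (hH : (λ_ A.X).inv ≫ scalarsUnit L₀ ▷ A.X ≫ H = f.hom ≫ g - 𝟙 _) : IsQuasiIsomorphism f := by
  refine ⟨g, ⟨OddHomotopy.ofHom 0 ?_⟩, ⟨OddHomotopy.ofHom H hH⟩⟩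
  rw [hg, sub_self, comp_zero, comp_zero]

theorem isQuasiIsomorphism_of_retract {A B : Mon (LMod L₀)} (f : A ⟶ B) {T Y : LMod L₀}
    {a : A.X ⟶ T} {a' : T ⟶ A.X} {c : B.X ⟶ Y} {c' : Y ⟶ B.X} {p : T ⟶ Y} {i : Y ⟶ T}
    (haa' : a ≫ a' = 𝟙 _) (ha'a : a' ≫ a = 𝟙 _) (hc : c ≫ c' = 𝟙 _) (hi : i ≫ p = 𝟙 _)
    (hf : f.hom ≫ c = a ≫ p) (H : scalars L₀ ⊗ T ⟶ T)
    (hH : (λ_ T).inv ≫ scalarsUnit L₀ ▷ T ≫ H = 𝟙 _ - p ≫ i) : IsQuasiIsomorphism f := by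
  -- The homotopy inverse is the symmetrization section `i`. The sign of `H` is reversed because the
  -- homotopy runs from the round trip to the identity.
  refine isQuasiIsomorphism_of_homotopy f (c ≫ i ≫ a') ?_ (scalars L₀ ◁ a ≫ (-H) ≫ a') ?_
  · have h : ((c ≫ i ≫ a') ≫ f.hom) ≫ c = c := by
      simp only [Category.assoc, hf, reassoc_of% ha'a, hi, Category.comp_id]
    have h' := h =≫ c'
    rwa [Category.assoc, hc, Category.comp_id] at h'
  · rw [reassoc_of% hf, ← whisker_exchange_assoc, ← leftUnitor_inv_naturality_assoc,
      Preadditive.neg_comp, Preadditive.comp_neg, Preadditive.comp_neg, Preadditive.comp_neg,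
      reassoc_of% hH]
    simp [Preadditive.comp_sub, haa']

theorem SymTensor.isQuasiIsomorphism (W : WeilObjects L₀ Ld) (A : SymTensor W.M.one)
    (H : scalars L₀ ⊗ A.T ⟶ A.T)
    (hH : (λ_ A.T).inv ≫ scalarsUnit L₀ ▷ A.T ≫ H = 𝟙 _ - A.e) :
    IsQuasiIsomorphism W.naturalMap := by
  obtain ⟨Y, p, i, hp, hip, hpi⟩ := A.exists_commMon
  obtain ⟨a, ha⟩ := exists_iso_of_corepresentableBy W.freeA A.isFreeAsso
  obtain ⟨c, hc⟩ := exists_iso_of_corepresentableBy W.freeC (A.isFreeComm hip hpi)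
  let p' : (⟨A.T⟩ : Mon (LMod L₀)) ⟶ Y.toMon := @Mon.Hom.mk _ _ _ ⟨A.T⟩ Y.toMon p hp
  let c₀ : W.C.toMon ⟶ Y.toMon := c.hom.hom
  -- Under the identifications of both algebras the natural map is `p`, since the two agree on the
  -- generators.
  have hsq : W.naturalMap ≫ c₀ = a.hom ≫ p' := by
    apply W.freeA.homEquiv.injective
    have h₁ := W.freeA.homEquiv_comp c₀ W.naturalMap
    have h₂ : W.freeA.homEquiv W.naturalMap = W.freeC.homEquiv (𝟙 W.C) :=
      Equiv.apply_symm_apply _ _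
    have h₃ := W.freeC.homEquiv_comp c.hom (𝟙 _)
    have h₄ := W.freeA.homEquiv_comp p' a.hom
    rw [Category.id_comp, hc] at h₃
    rw [ha] at h₄
    rw [h₂] at h₁
    refine h₁.trans (h₃.symm.trans (Eq.trans ?_ h₄.symm))
    apply Under.UnderMorphism.ext
    change A.j ≫ p ≫ 𝟙 _ = (A.j ≫ 𝟙 _) ≫ p
    rw [Category.comp_id, Category.comp_id]
  exact isQuasiIsomorphism_of_retract W.naturalMap (p := p) (congrArg Mon.Hom.hom a.hom_inv_id)
    (congrArg Mon.Hom.hom a.inv_hom_id) (congrArg commHom c.hom_inv_id) hip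
    (congrArg Mon.Hom.hom hsq) H (hpi.symm ▸ hH)

variable [HasColimitsOfShape (Discrete ℕ) S]
  [∀ X : S, PreservesColimitsOfShape (Discrete ℕ) (tensorLeft X)]

/-- The reduced tensor algebra of a unital object representing connections. -/
def connectionSymTensor {M : UnitalObj L₀} (t : universalObj L₀ Ld ≅ M) : SymTensor M.one :=
  (((universalSplitting L₀ Ld).forget.ofIso (LMod.mor t.hom.right) (LMod.mor t.inv.right)
    (congrArg (fun f => LMod.mor (CommaMorphism.right f)) t.hom_inv_id)
    (congrArg (fun f => LMod.mor (CommaMorphism.right f)) t.inv_hom_id)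
    (congrArg LMod.mor (Under.w t.hom)) : UnitSplitting M.one.f.f).symTensor).lift.lift

theorem nonempty_weilObjects : Nonempty (WeilObjects L₀ Ld) := by
  let A : SymTensor (universalObj L₀ Ld).one := connectionSymTensor (Iso.refl _)
  obtain ⟨Y, p, i, hp, hip, hpi⟩ := A.exists_commMon
  exact ⟨⟨universalObj L₀ Ld, universalRep L₀ Ld, ⟨A.T⟩, A.isFreeAsso, Y, A.isFreeComm hip hpi⟩⟩

theorem isQuasiIsomorphism_naturalMap (W : WeilObjects L₀ Ld) :
    IsQuasiIsomorphism W.naturalMap := by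
  obtain ⟨t, -⟩ := exists_iso_of_corepresentableBy (universalRep L₀ Ld) W.repM
  obtain ⟨H, hH⟩ := (connectionSymTensor t).exists_homotopy (scalarsUnit L₀)
    (exists_contraction_of_iso t)
  exact (connectionSymTensor t).isQuasiIsomorphism W H hH

end QuasiIsomorphism

end SuperWeil

end

theorem mainTheorem3 {S : Type u} [Category.{v} S] [Abelian S] [MonoidalCategory S]
    [SymmetricCategory S] [MonoidalPreadditive S] [Linear ℚ S] [MonoidalLinear ℚ S]
    [HasLimits S] [WellPowered.{v} S] [SuperWeil.Supercategory S]
    [HasColimitsOfShape (Discrete ℕ) S]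
    [∀ X : S, PreservesColimitsOfShape (Discrete ℕ) (tensorLeft X)]
    (L₀ : SuperWeil.LieObj S) (Ld : S) [ExactPairing L₀.X Ld] :
    Nonempty (SuperWeil.WeilObjects L₀ Ld) ∧
      ∀ W : SuperWeil.WeilObjects L₀ Ld, SuperWeil.IsQuasiIsomorphism W.naturalMap :=
  ⟨SuperWeil.nonempty_weilObjects, SuperWeil.isQuasiIsomorphism_naturalMap⟩
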